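/- Let $(N,I,g)$ be a para-Hermitian symmetric space of dimension $2n$: $I$ is a para-complex structure (a smooth $(1,1)$-tensor with $I^2=\mathrm{id}$, $n$-dimensional $\pm1$-eigenspaces and vanishing Nijenhuis tensor), $g$ is a pseudo-Riemannian metric with $g(IX,Y)+g(X,IY)=0$, and at each $p\in N$ there is a symmetry $s_p$, i.e. a diffeomorphism preserving $I$ and $g$ with $s_p(\gamma(t))=\gamma(-t)$ for every geodesic $\gamma$ with $\gamma(0)=p$. Write $N=G/H$, where $G$ is a connected Lie group acting smoothly and transitively on $N$ by automorphisms of $(N,I,g)$, $H$ is the isotropy group at a point $o$, and conjugation $a\mapsto s_o\circ a\circ s_o$ by the symmetry at $o$ is induced by a smooth involutive automorphism $\sigma$ of $G$ (for example, $G$ is the identity component of the automorphism group of $(N,I,g)$). Let $\mathfrak g,\mathfrak h$ be the Lie algebras of $G,H$, let $B$ be the Killing form of $\mathfrak g$, and let $\mathfrak n\subset\mathfrak g$ be the $(-1)$-eigenspace of the derivative of $\sigma$, which is identified with $T_oN$ by the derivative of $a\mapsto a\cdot o$. Assume that $G$ is simple, i.e. that $\mathfrak g$ is a simple real Lie algebra.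 1. If the center of $H$ is one-dimensional, then $g$ is the $G$-invariant extension of $\lambda B|_{\mathfrak n\times\mathfrak n}$ for some real $\lambda\neq0$. 2. If the center of $H$ is two-dimensional, then $\mathfrak g$ admits a complex structure $i$ (an $\mathbb R$-linear map with $i^2=-\mathrm{id}$ and $[iX,Y]=i[X,Y]$) such that, with $$f_{(\lambda,\mu)}:=\lambda B(\cdot,\cdot)+\mu B(i\,\cdot,\cdot),$$ the following hold. - The metric $g$ is the $G$-invariant extension of the restriction of $f_{(\lambda,\mu)}$ to $\mathfrak n$ for some real $(\lambda,\mu)\neq(0,0)$. - For every real $(\lambda,\mu)\neq(0,0)$, the restriction of $f_{(\lambda,\mu)}$ to the $2n$-dimensional space $\mathfrak n$ is an $\mathrm{ad}_{\mathfrak h}$-invariant, nondegenerate, symmetric bilinear form of signature $(n,n)$, and it extends to a $G$-invariant pseudo-Riemannian metric $g_{(\lambda,\mu)}$ on $N$ such that $(N,I,g_{(\lambda,\mu)})$ is a para-Hermitian symmetric space. -/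

import Mathlib

open scoped Manifold ContDiff
open Bundle Module

/-- A smooth real Lie group is regular enough for the Lie bracket on its tangent space at the
identity. -/
instance LieGroup.minSmoothnessOfSmooth {m : ℕ} {G : Type*} [TopologicalSpace G]
    [ChartedSpace (EuclideanSpace ℝ (Fin m)) G] [Group G] [LieGroup (𝓡 m) ∞ G] :
    LieGroup (𝓡 m) (minSmoothness ℝ 3) G :=
  LieGroup.of_le (n := ∞) (by
    rw [minSmoothness_of_isRCLikeNormedField]
    exact ENat.LEInfty.out)

noncomputable section

namespace ParaHermitian

section Manifold

/-- A smooth pseudo-Riemannian metric on a manifold. -/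
structure PseudoMetric (d : ℕ) (N : Type*) [TopologicalSpace N]
    [ChartedSpace (EuclideanSpace ℝ (Fin d)) N] [IsManifold (𝓡 d) ∞ N] where
  /-- The bilinear form on each tangent space. -/
  val (x : N) : TangentSpace (𝓡 d) x →L[ℝ] TangentSpace (𝓡 d) x →L[ℝ] ℝ
  symm (x : N) (v w : TangentSpace (𝓡 d) x) : val x v w = val x w v
  nondegenerate (x : N) (v : TangentSpace (𝓡 d) x) (hv : ∀ w, val x v w = 0) : v = 0
  contMDiff : ContMDiff (𝓡 d) ((𝓡 d).prod
      𝓘(ℝ, EuclideanSpace ℝ (Fin d) →L[ℝ] EuclideanSpace ℝ (Fin d) →L[ℝ] ℝ)) ∞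
    (fun x ↦ TotalSpace.mk'
      (EuclideanSpace ℝ (Fin d) →L[ℝ] EuclideanSpace ℝ (Fin d) →L[ℝ] ℝ)
      (E := fun y : N ↦ TangentSpace (𝓡 d) y →L[ℝ] TangentSpace (𝓡 d) y →L[ℝ] ℝ) x (val x))

/-- A para-complex structure on a `2n`-dimensional manifold: a smooth `(1,1)`-tensor `J` with
`J ^ 2 = 1`, with `n`-dimensional `1`- and `(-1)`-eigenspaces, and with vanishing Nijenhuis
tensor. -/
structure ParaComplex (n : ℕ) (N : Type*) [TopologicalSpace N]
    [ChartedSpace (EuclideanSpace ℝ (Fin (2 * n))) N] [IsManifold (𝓡 (2 * n)) ∞ N] where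
  /-- The endomorphism of each tangent space. -/
  val (x : N) : TangentSpace (𝓡 (2 * n)) x →L[ℝ] TangentSpace (𝓡 (2 * n)) x
  contMDiff : ContMDiff (𝓡 (2 * n)) ((𝓡 (2 * n)).prod
      𝓘(ℝ, EuclideanSpace ℝ (Fin (2 * n)) →L[ℝ] EuclideanSpace ℝ (Fin (2 * n)))) ∞
    (fun x ↦ TotalSpace.mk'
      (EuclideanSpace ℝ (Fin (2 * n)) →L[ℝ] EuclideanSpace ℝ (Fin (2 * n)))
      (E := fun y : N ↦ TangentSpace (𝓡 (2 * n)) y →L[ℝ] TangentSpace (𝓡 (2 * n)) y) x (val x))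
  sq (x : N) (v : TangentSpace (𝓡 (2 * n)) x) : val x (val x v) = v
  finrank_pos (x : N) : finrank ℝ (End.eigenspace (val x).toLinearMap (1 : ℝ)) = n
  finrank_neg (x : N) : finrank ℝ (End.eigenspace (val x).toLinearMap (-1 : ℝ)) = n
  integrable (X Y : ∀ x : N, TangentSpace (𝓡 (2 * n)) x)
    (hX : ContMDiff (𝓡 (2 * n)) (𝓡 (2 * n)).tangent ∞
      (fun x ↦ (⟨x, X x⟩ : TangentBundle (𝓡 (2 * n)) N)))
    (hY : ContMDiff (𝓡 (2 * n)) (𝓡 (2 * n)).tangent ∞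
      (fun x ↦ (⟨x, Y x⟩ : TangentBundle (𝓡 (2 * n)) N))) (x : N) :
    VectorField.mlieBracket (𝓡 (2 * n)) (fun y ↦ val y (X y)) (fun y ↦ val y (Y y)) x
      - val x (VectorField.mlieBracket (𝓡 (2 * n)) (fun y ↦ val y (X y)) Y x)
      - val x (VectorField.mlieBracket (𝓡 (2 * n)) X (fun y ↦ val y (Y y)) x)
      + VectorField.mlieBracket (𝓡 (2 * n)) X Y x = 0

variable {d : ℕ} {N : Type*} [TopologicalSpace N]
  [ChartedSpace (EuclideanSpace ℝ (Fin d)) N] [IsManifold (𝓡 d) ∞ N]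

/-- The components `g_y(v, w)` of the metric in the preferred chart at `x`, at the point of the
manifold with coordinates `y`, for coordinate vectors `v` and `w`. -/
def PseudoMetric.inChart (g : PseudoMetric d N) (x : N) (y v w : EuclideanSpace ℝ (Fin d)) : ℝ :=
  g.val ((extChartAt (𝓡 d) x).symm y)
    (mfderiv 𝓘(ℝ, EuclideanSpace ℝ (Fin d)) (𝓡 d) (extChartAt (𝓡 d) x).symm y v)
    (mfderiv 𝓘(ℝ, EuclideanSpace ℝ (Fin d)) (𝓡 d) (extChartAt (𝓡 d) x).symm y w)

/-- The Christoffel symbols of the first kind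
`Γ(u, v; w) = (∂_u g(v, w) + ∂_v g(u, w) - ∂_w g(u, v)) / 2` of the Levi-Civita connection of `g`
in the preferred chart at `x`, at the point with coordinates `y`. -/
def PseudoMetric.christoffel (g : PseudoMetric d N) (x : N)
    (y u v w : EuclideanSpace ℝ (Fin d)) : ℝ :=
  (fderiv ℝ (fun z ↦ g.inChart x z v w) y u + fderiv ℝ (fun z ↦ g.inChart x z u w) y v
    - fderiv ℝ (fun z ↦ g.inChart x z u v) y w) / 2

/-- A smooth curve `γ` is a geodesic of `g` on the open set `s` of parameters: in coordinates,
`g(γ'' , w) + Γ(γ', γ'; w) = 0` for all `w`. This is the geodesic equation `γ'' + Γ(γ', γ') = 0` of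
the Levi-Civita connection, paired with `w` by the nondegenerate form `g`. It is written at each
parameter `t` in the preferred chart at `γ t`. -/
def PseudoMetric.IsGeodesicOn (g : PseudoMetric d N) (γ : ℝ → N) (s : Set ℝ) : Prop :=
  ContMDiffOn 𝓘(ℝ, ℝ) (𝓡 d) ∞ γ s ∧
  ∀ t ∈ s, ∀ w : EuclideanSpace ℝ (Fin d),
    let c : ℝ → EuclideanSpace ℝ (Fin d) := fun τ ↦ extChartAt (𝓡 d) (γ t) (γ τ)
    g.inChart (γ t) (c t) (deriv (deriv c) t) w
      + g.christoffel (γ t) (c t) (deriv c t) (deriv c t) w = 0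

end Manifold

section Symmetric

variable {n : ℕ} {N : Type*} [TopologicalSpace N]
  [ChartedSpace (EuclideanSpace ℝ (Fin (2 * n))) N] [IsManifold (𝓡 (2 * n)) ∞ N]

/-- The metric `g` is compatible with `J`; that is, `(N, J, g)` is a para-Hermitian manifold. -/
def IsParaHermitian (J : ParaComplex n N) (g : PseudoMetric (2 * n) N) : Prop :=
  ∀ (x : N) (v w : TangentSpace (𝓡 (2 * n)) x),
    g.val x (J.val x v) w + g.val x v (J.val x w) = 0

/-- The derivative of `φ` preserves both `J` and `g`. A diffeomorphism with this property is an
automorphism of `(N, J, g)`. -/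
def Preserves (J : ParaComplex n N) (g : PseudoMetric (2 * n) N) (φ : N → N) : Prop :=
  ∀ (x : N) (v w : TangentSpace (𝓡 (2 * n)) x),
    mfderiv (𝓡 (2 * n)) (𝓡 (2 * n)) φ x (J.val x v) =
      J.val (φ x) (mfderiv (𝓡 (2 * n)) (𝓡 (2 * n)) φ x v) ∧
    g.val (φ x) (mfderiv (𝓡 (2 * n)) (𝓡 (2 * n)) φ x v)
      (mfderiv (𝓡 (2 * n)) (𝓡 (2 * n)) φ x w) = g.val x v w

/-- The diffeomorphism `s` is a symmetry of `(N, J, g)` at `p`: an automorphism with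
`s (γ t) = γ (-t)` for all geodesics `γ` with `γ 0 = p`. -/
def IsSymmetryAt (J : ParaComplex n N) (g : PseudoMetric (2 * n) N) (p : N)
    (s : Diffeomorph (𝓡 (2 * n)) (𝓡 (2 * n)) N N ∞) : Prop :=
  Preserves J g s ∧
  ∀ (γ : ℝ → N) (ε : ℝ), 0 < ε → g.IsGeodesicOn γ (Set.Ioo (-ε) ε) → γ 0 = p →
    ∀ t ∈ Set.Ioo (-ε) ε, s (γ t) = γ (-t)

/-- `(N, J, g)` is a para-Hermitian symmetric space. -/
def IsParaHermitianSymmetric (J : ParaComplex n N) (g : PseudoMetric (2 * n) N) : Prop :=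
  IsParaHermitian J g ∧ ∀ p : N, ∃ s, IsSymmetryAt J g p s

end Symmetric

section Group

variable {m : ℕ} {G : Type*} [TopologicalSpace G] [ChartedSpace (EuclideanSpace ℝ (Fin m)) G]
  [Group G] [LieGroup (𝓡 m) ∞ G]

/-- The Lie algebra of a closed subgroup `K` of `G`: all `X` with `exp (t X) ∈ K` for all real `t`.
Here `c t = exp (t X)` is the integral curve through `1` of the left-invariant vector field
of `X`. -/
def lieAlgebraOf (K : Subgroup G) : Set (GroupLieAlgebra (𝓡 m) G) :=
  {X | ∃ c : ℝ → G, c 0 = 1 ∧ IsMIntegralCurve c (mulInvariantVectorField (I := 𝓡 m) X) ∧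
    ∀ t, c t ∈ K}

/-- The dimension of a closed subgroup of `G` as a Lie group. -/
def lieDim (K : Subgroup G) : ℕ := Set.finrank ℝ (lieAlgebraOf (m := m) K)

/-- The derivative at the identity of an endomorphism `σ` of `G`, as an endomorphism of the Lie
algebra (note that `σ 1 = 1`). -/
def lieMap (σ : G →* G) : GroupLieAlgebra (𝓡 m) G →ₗ[ℝ] GroupLieAlgebra (𝓡 m) G :=
  (show GroupLieAlgebra (𝓡 m) G →L[ℝ] GroupLieAlgebra (𝓡 m) G from
    mfderiv (𝓡 m) (𝓡 m) σ (1 : G)).toLinearMap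

/-- The `(-1)`-eigenspace of the derivative of `σ`. -/
def minusSpace (σ : G →* G) : Submodule ℝ (GroupLieAlgebra (𝓡 m) G) :=
  End.eigenspace (lieMap (m := m) σ) (-1 : ℝ)

/-- A complex structure on a real Lie algebra: `i ^ 2 = -1` and the bracket is `i`-bilinear. -/
def IsComplexStructure {L : Type*} [LieRing L] [LieAlgebra ℝ L] (i : L →ₗ[ℝ] L) : Prop :=
  (∀ X, i (i X) = -X) ∧ ∀ X Y : L, ⁅i X, Y⁆ = i ⁅X, Y⁆

/-- The bilinear form `a B(·, ·) + b B(i ·, ·)`, where `B` is the Killing form. -/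
def twistedKilling {L : Type*} [LieRing L] [LieAlgebra ℝ L] (i : L →ₗ[ℝ] L) (a b : ℝ) :
    LinearMap.BilinForm ℝ L :=
  a • killingForm ℝ L + b • (killingForm ℝ L).comp i LinearMap.id

variable {n : ℕ} {N : Type*} [TopologicalSpace N]
  [ChartedSpace (EuclideanSpace ℝ (Fin (2 * n))) N] [IsManifold (𝓡 (2 * n)) ∞ N] [MulAction G N]

/-- The para-Hermitian symmetric space `(N, J, g)` is presented as `G / H`, where `H` is the
isotropy group at `o`, and `σ` is the resulting involution of `G`: the Lie group `G` acts smoothly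
and transitively on `N` by automorphisms of `(N, J, g)`, and the smooth involutive automorphism `σ`
of `G` is `a ↦ s ∘ a ∘ s` for a symmetry `s` at `o`. The identity component of the automorphism
group of `(N, J, g)` has this property, and so have its coverings to which `σ` lifts; the action
need not be effective. -/
structure IsSymmetricCosetSpace (J : ParaComplex n N) (g : PseudoMetric (2 * n) N) (o : N)
    (σ : G →* G) : Prop where
  symmetric : IsParaHermitianSymmetric J g
  smooth_smul : ContMDiff ((𝓡 m).prod (𝓡 (2 * n))) (𝓡 (2 * n)) ∞ (fun p : G × N ↦ p.1 • p.2)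
  transitive : MulAction.IsPretransitive G N
  preserves (a : G) : Preserves J g (fun x ↦ a • x)
  smooth_involution : ContMDiff (𝓡 m) (𝓡 m) ∞ σ
  involutive (a : G) : σ (σ a) = a
  conj_symmetry : ∃ s, IsSymmetryAt J g o s ∧ ∀ (a : G) (x : N), s (a • x) = σ a • s x

/-- The metric `g` on `N = G / H` is the `G`-invariant extension of the restriction of the bilinear
form `f` to the `(-1)`-eigenspace `𝔫` of `σ`, where `𝔫` is identified with the tangent space of `N`
at `o = 1 • o` by the derivative of the orbit map `a ↦ a • o`. -/
structure IsInvariantExtension (g : PseudoMetric (2 * n) N) (o : N) (σ : G →* G)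
    (f : LinearMap.BilinForm ℝ (GroupLieAlgebra (𝓡 m) G)) : Prop where
  bijOn : Set.BijOn (mfderiv (𝓡 m) (𝓡 (2 * n)) (fun a : G ↦ a • o) 1)
    (minusSpace (m := m) σ) Set.univ
  val_eq (X Y : GroupLieAlgebra (𝓡 m) G) (hX : X ∈ minusSpace (m := m) σ)
    (hY : Y ∈ minusSpace (m := m) σ) :
    g.val ((1 : G) • o) (mfderiv (𝓡 m) (𝓡 (2 * n)) (fun a : G ↦ a • o) 1 X)
      (mfderiv (𝓡 m) (𝓡 (2 * n)) (fun a : G ↦ a • o) 1 Y) = f X Y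
  invariant (a : G) (x : N) (v w : TangentSpace (𝓡 (2 * n)) x) :
    g.val (a • x) (mfderiv (𝓡 (2 * n)) (𝓡 (2 * n)) (fun y : N ↦ a • y) x v)
      (mfderiv (𝓡 (2 * n)) (𝓡 (2 * n)) (fun y : N ↦ a • y) x w) = g.val x v w

/-- The restriction of `f` to the `(-1)`-eigenspace `𝔫` of `σ` is a symmetric, nondegenerate,
`ad_𝔥`-invariant bilinear form of signature `(n, n)`, where `𝔥` is the Lie algebra of `H`. -/
structure IsAdmissible (n : ℕ) (H : Subgroup G) (σ : G →* G)
    (f : LinearMap.BilinForm ℝ (GroupLieAlgebra (𝓡 m) G)) : Prop where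
  finrank_eq : finrank ℝ (minusSpace (m := m) σ) = 2 * n
  symm : (f.restrict (minusSpace (m := m) σ)).IsSymm
  nondegenerate : (f.restrict (minusSpace (m := m) σ)).Nondegenerate
  ad_mem (W : GroupLieAlgebra (𝓡 m) G) (hW : W ∈ lieAlgebraOf (m := m) H)
    (X : GroupLieAlgebra (𝓡 m) G) (hX : X ∈ minusSpace (m := m) σ) :
    ⁅W, X⁆ ∈ minusSpace (m := m) σ
  ad_invariant (W : GroupLieAlgebra (𝓡 m) G) (hW : W ∈ lieAlgebraOf (m := m) H)
    (X Y : GroupLieAlgebra (𝓡 m) G) (hX : X ∈ minusSpace (m := m) σ)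
    (hY : Y ∈ minusSpace (m := m) σ) : f ⁅W, X⁆ Y + f X ⁅W, Y⁆ = 0
  sigPos_eq : sigPos (LinearMap.BilinMap.toQuadraticMap (f.restrict (minusSpace (m := m) σ))) = n
  sigNeg_eq : sigNeg (LinearMap.BilinMap.toQuadraticMap (f.restrict (minusSpace (m := m) σ))) = n

/-- The center of `H`, as a subgroup of `G`. -/
def centerOf (H : Subgroup G) : Subgroup G := (Subgroup.center H).map H.subtype

end Group

end ParaHermitian

end

/-!
The theorem reduces to the Lie algebra `L` of `G`, with the involution `θ` induced by `σ`, the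
projection `p` of `L` onto the tangent space at `o`, and the values `γ` and `J` at `o` of the metric
and of the para-complex structure (`InfinitesimalModel`, `IsSymmetricCosetSpace.model`). Write `𝔥` and
`𝔫` for the `1`- and `(-1)`-eigenspaces of `θ`.

*The algebra.* Since `L` is simple, `𝔥 = ker p` acts faithfully on `𝔫`. The curvature `⁅⁅X, Y⁆, Z⁆` has
the pair symmetry with respect to every `𝔥`-invariant symmetric form on `𝔫`. Applied to `γ`, this shows
that `J`, extended by zero to `𝔥`, is a derivation of `L`, so that `J = ad Z` for a characteristic
element `Z` in `𝔥` (`InfinitesimalModel.exists_characteristic`). Applied to an arbitrary invariant form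
and to the Killing form `B`, it shows that every invariant symmetric form on `𝔫` is `B(A ·, ·)` for an
element `A` of the centroid of `L` (`InfinitesimalModel.exists_centroid_of_form`). An element of the
centroid is determined by its value at `Z`. For the form `γ`, the value `A Z` is fixed by the isotropy
group `H`, and for the form `B(⁅W, ·⁆, ⁅Z, ·⁆)`, where `W` belongs to the Lie algebra `𝔷` of the center
of `H`, the value is `A Z = -W`. So if `𝔷` is spanned by `Z`, then `A` is a scalar, and `γ` is a
multiple of `B`. If `𝔷` is two-dimensional, the element `A` with `A Z = W` for some `W` in `𝔷` that is
not a multiple of `Z` satisfies a quadratic equation. As the centroid has no zero divisors, its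
discriminant is negative, so a combination `i` of `A` and `1` is a complex structure, and `γ` is
given by `a + b i`. Every such form with `(a, b) ≠ (0, 0)` is nondegenerate on `𝔫` since `a + b i` is
invertible, and `ad Z` is skew, so that its `1`-eigenspace is isotropic and the signature is `(n, n)`.

*The geometry.* The bracket is the derivative of the adjoint representation (`hasDerivAt_Ad`), so
invariance under `H` yields invariance under `𝔥`, and the Lie algebra of the center of `H` is the
space of vectors of `𝔥` fixed by `Ad H` (`mem_lieAlgebraOf_center`). The orbit map is a submersion, by
Baire's theorem and because smooth maps do not raise the Hausdorff dimension
(`surjective_orbitDeriv`). Local sections of it make the invariant extension of an `Ad H`-invariant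
form smooth (`exists_invariant_metric`). A symmetry at `o` fixes `o` and has the derivative `-1` there,
because short geodesics exist in every direction. Its compatibility with `σ` makes it an isometry of
every invariant metric `g'`. An isometric point reflection determines the Christoffel symbols at its
center, so `g` and `g'` have the same geodesics, and the symmetries of `g` are symmetries of `g'`
(`isParaHermitianSymmetric_of_invariant`).
-/

noncomputable section

set_option linter.unusedSectionVars false

namespace ParaHermitian

/-! ### The infinitesimal model and its characteristic element -/

section Algebra

/-- The infinitesimal data of a para-Hermitian symmetric space `G / H`: the Lie algebra `L` of `G`
with the involution `θ`, the projection `p` of `L` onto the tangent space `T` at the base point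
(so that `ker p` is the Lie algebra of `H`), and the metric `γ` and the para-complex structure `J`
on `T`, both invariant under the isotropy action of `ker p`. -/
structure InfinitesimalModel (L T : Type*) [LieRing L] [LieAlgebra ℝ L] [AddCommGroup T]
    [Module ℝ T] where
  /-- The projection onto the tangent space. -/
  p : L →ₗ[ℝ] T
  /-- The involution of the Lie algebra. -/
  θ : L ≃ₗ⁅ℝ⁆ L
  /-- The metric. -/
  γ : T →ₗ[ℝ] T →ₗ[ℝ] ℝ
  /-- The para-complex structure. -/
  J : T →ₗ[ℝ] T
  surj : Function.Surjective p
  inv (X : L) : θ (θ X) = X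
  p_θ (X : L) : p (θ X) = -p X
  symm (v w : T) : γ v w = γ w v
  nondeg (v : T) (hv : ∀ w, γ v w = 0) : v = 0
  sq (v : T) : J (J v) = v
  skew (v w : T) : γ (J v) w + γ v (J w) = 0
  γ_lie (W X Y : L) (hW : p W = 0) : γ (p ⁅W, X⁆) (p Y) + γ (p X) (p ⁅W, Y⁆) = 0
  J_lie (W X X' : L) (hW : p W = 0) (h : J (p X) = p X') : J (p ⁅W, X⁆) = p ⁅W, X'⁆

variable {L T : Type*} [LieRing L] [LieAlgebra ℝ L] [AddCommGroup T] [Module ℝ T]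

/-- The symmetry under exchange of pairs of an algebraic curvature tensor. -/
lemma curvature_pair_symm {S : Type*} (R : S → S → S → S → ℝ)
    (h1 : ∀ x y z w, R x y z w = -R y x z w) (h2 : ∀ x y z w, R x y z w = -R x y w z)
    (h3 : ∀ x y z w, R x y z w + R y z x w + R z x y w = 0) (x y z w : S) :
    R x y z w = R z w x y := by
  linarith [h3 x y z w, h3 y z w x, h3 z w x y, h3 w x y z, h1 x y z w, h2 x y z w, h1 y z x w,
    h2 y z x w, h1 z x y w, h2 z x y w, h1 y z w x, h1 z w y x, h1 w y z x, h2 y z w x, h2 z w y x,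
    h2 w y z x, h1 z w x y, h1 w x z y, h1 x z w y, h2 z w x y, h2 w x z y, h2 x z w y, h1 w x y z,
    h1 x y w z, h1 y w x z, h2 w x y z, h2 x y w z, h2 y w x z, h1 x z y w, h1 y w z x]

namespace InfinitesimalModel

variable (M : InfinitesimalModel L T)
include M

lemma p_lie_eq_zero {W V : L} (hW : M.p W = 0) (hV : M.p V = 0) : M.p ⁅W, V⁆ = 0 := by
  refine M.nondeg _ fun w ↦ ?_
  obtain ⟨Y, rfl⟩ := M.surj w
  simpa [hV] using M.γ_lie W V Y hW

/-- The kernel of the isotropy representation of `ker p` on the tangent space. It is an ideal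
since `(U, V, Y) ↦ γ (p ⁅U, ⁅X, V⁆⁆, p Y)` is symmetric in `U` and `V` and skew in `U` and `Y`. -/
def isotropyKernel : LieIdeal ℝ L where
  carrier := {X | M.p X = 0 ∧ ∀ Y, M.p ⁅X, Y⁆ = 0}
  add_mem' := by
    rintro X Y ⟨h1, h2⟩ ⟨h3, h4⟩
    exact ⟨by simp [h1, h3], fun Z ↦ by simp [add_lie, h2 Z, h4 Z]⟩
  zero_mem' := ⟨by simp, by simp⟩
  smul_mem' := by
    rintro c X ⟨h1, h2⟩
    exact ⟨by simp [h1], fun Z ↦ by simp [h2 Z]⟩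
  lie_mem := by
    rintro U X ⟨h1, h2⟩
    have hUX (A B : L) : M.p ⁅A, ⁅X, B⁆⁆ = M.p ⁅B, ⁅X, A⁆⁆ := by
      have := h2 ⁅A, B⁆
      rw [leibniz_lie, map_add, ← lie_skew, map_neg] at this
      rw [← sub_eq_zero, ← this]; abel
    have hsk (A B C : L) : M.γ (M.p ⁅A, ⁅X, B⁆⁆) (M.p C) = -M.γ (M.p ⁅C, ⁅X, B⁆⁆) (M.p A) := by
      have := M.γ_lie ⁅X, B⁆ A C (h2 B)
      rw [← lie_skew ⁅X, B⁆ A, ← lie_skew ⁅X, B⁆ C] at this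
      simp only [map_neg, LinearMap.neg_apply] at this
      rw [M.symm (M.p A)] at this
      linarith
    refine ⟨by rw [← lie_skew, map_neg, h2, neg_zero], fun V ↦ ?_⟩
    rw [lie_lie, map_sub, h2, sub_zero]
    refine M.nondeg _ fun w ↦ ?_
    obtain ⟨Y, rfl⟩ := M.surj w
    have e1 := hsk U V Y
    have e2 := hsk V Y U
    have e3 := hsk Y U V
    rw [hUX Y V] at e1
    rw [hUX U Y] at e2
    rw [hUX V U] at e3
    linarith

lemma mem_isotropyKernel {X : L} : X ∈ M.isotropyKernel ↔ M.p X = 0 ∧ ∀ Y, M.p ⁅X, Y⁆ = 0 :=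
  Iff.rfl

variable [LieAlgebra.IsSimple ℝ L] [Nontrivial T]

/-- `L` is simple, and the ideal is not all of `L` as `p` is onto a nonzero space. -/
lemma eq_zero_of_mem_isotropyKernel {X : L} (h1 : M.p X = 0) (h2 : ∀ Y, M.p ⁅X, Y⁆ = 0) :
    X = 0 := by
  rcases LieAlgebra.IsSimple.eq_bot_or_eq_top M.isotropyKernel with h | h
  · have : X ∈ M.isotropyKernel := M.mem_isotropyKernel.2 ⟨h1, h2⟩
    simpa [h] using this
  · exfalso
    obtain ⟨v, hv⟩ := exists_ne (0 : T)
    obtain ⟨Y, rfl⟩ := M.surj v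
    have : Y ∈ M.isotropyKernel := by simp [h]
    exact hv (M.mem_isotropyKernel.1 this).1

/-- If `θ X = -X` and `p X = 0`, then `p ⁅X, θ Y⁆ = p ⁅X, Y⁆`, while `θ Y + Y` lies in `ker p`; hence
`X` lies in the kernel of the isotropy representation. -/
lemma eq_zero_of_p_eq_zero {X : L} (hX : M.θ X = -X) (h : M.p X = 0) : X = 0 := by
  refine M.eq_zero_of_mem_isotropyKernel h fun Y ↦ ?_
  have h1 : M.p ⁅X, M.θ Y⁆ = M.p ⁅X, Y⁆ := by
    have := M.p_θ ⁅X, Y⁆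
    rw [LieEquiv.map_lie, hX, neg_lie, map_neg] at this
    simpa using this
  have h2 : M.p ⁅X, M.θ Y + Y⁆ = 0 := M.p_lie_eq_zero h (by rw [map_add, M.p_θ]; simp)
  rw [lie_add, map_add, h1] at h2
  have : (2 : ℝ) • M.p ⁅X, Y⁆ = 0 := by rw [two_smul]; exact h2
  simpa using this

/-- The isotropy algebra is the full fixed algebra of the involution. -/
lemma p_eq_zero_iff {X : L} : M.p X = 0 ↔ M.θ X = X := by
  constructor
  · intro h
    have : X - M.θ X = 0 := by
      refine M.eq_zero_of_p_eq_zero (by rw [map_sub, M.inv]; abel) ?_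
      rw [map_sub, M.p_θ, h]; simp
    rw [sub_eq_zero] at this
    exact this.symm
  · intro h
    have h1 := M.p_θ X
    rw [h] at h1
    have : (2 : ℝ) • M.p X = 0 := by rw [two_smul]; nth_rewrite 1 [h1]; simp
    simpa using this

omit [LieAlgebra.IsSimple ℝ L] [Nontrivial T] in
/-- The tangent space embeds into the Lie algebra as the `(-1)`-eigenspace of the involution. -/
lemma exists_lift : ∃ s : T →ₗ[ℝ] L, ∀ v, M.p (s v) = v ∧ M.θ (s v) = -s v := by
  obtain ⟨r, hr⟩ := M.p.exists_rightInverse_of_surjective (LinearMap.range_eq_top.2 M.surj)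
  have hr' (v : T) : M.p (r v) = v := LinearMap.congr_fun hr v
  refine ⟨(1 / 2 : ℝ) • (r - (M.θ : L →ₗ[ℝ] L) ∘ₗ r), fun v ↦ ⟨?_, ?_⟩⟩
  · have : M.p (M.θ (r v)) = -v := by rw [M.p_θ, hr']
    simp [this, hr', ← two_smul ℝ v]
  · simp [M.inv]
    rw [← smul_neg]; congr 1; abel

/-- The lift of tangent vectors to the `(-1)`-eigenspace of the involution. -/
def lift : T →ₗ[ℝ] L := M.exists_lift.choose

omit [LieAlgebra.IsSimple ℝ L] [Nontrivial T] in
@[simp] lemma p_lift (v : T) : M.p (M.lift v) = v := (M.exists_lift.choose_spec v).1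

omit [LieAlgebra.IsSimple ℝ L] [Nontrivial T] in
@[simp] lemma θ_lift (v : T) : M.θ (M.lift v) = -M.lift v := (M.exists_lift.choose_spec v).2

lemma lift_p {X : L} (hX : M.θ X = -X) : M.lift (M.p X) = X := by
  rw [← sub_eq_zero]
  exact M.eq_zero_of_p_eq_zero (by simp [hX]; abel) (by simp)

lemma θ_sub_lift (X : L) : M.θ (X - M.lift (M.p X)) = X - M.lift (M.p X) :=
  M.p_eq_zero_iff.1 (by simp)

/-- To prove a statement for all elements of `L`, treat the eigenspaces of the involution. -/
lemma induction {P : L → Prop} (h0 : ∀ W, M.θ W = W → P W) (h1 : ∀ X, M.θ X = -X → P X)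
    (hadd : ∀ X Y, P X → P Y → P (X + Y)) (X : L) : P X := by
  have := hadd _ _ (h0 _ (M.θ_sub_lift X)) (h1 _ (M.θ_lift (M.p X)))
  simpa using this

omit [LieAlgebra.IsSimple ℝ L] [Nontrivial T] in
lemma θ_lie_minus {W X : L} (hW : M.θ W = W) (hX : M.θ X = -X) : M.θ ⁅W, X⁆ = -⁅W, X⁆ := by
  rw [LieEquiv.map_lie, hW, hX, lie_neg]

omit [LieAlgebra.IsSimple ℝ L] [Nontrivial T] in
lemma θ_lie_plus {W V : L} (hW : M.θ W = W) (hV : M.θ V = V) : M.θ ⁅W, V⁆ = ⁅W, V⁆ := by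
  rw [LieEquiv.map_lie, hW, hV]

omit [LieAlgebra.IsSimple ℝ L] [Nontrivial T] in
lemma θ_lie_minus_minus {X Y : L} (hX : M.θ X = -X) (hY : M.θ Y = -Y) : M.θ ⁅X, Y⁆ = ⁅X, Y⁆ := by
  rw [LieEquiv.map_lie, hX, hY]; simp

/-- The isotropy representation is faithful. -/
lemma eq_zero_of_lie_eq_zero {W : L} (hW : M.θ W = W) (h : ∀ X, M.θ X = -X → ⁅W, X⁆ = 0) :
    W = 0 := by
  refine M.eq_zero_of_mem_isotropyKernel (M.p_eq_zero_iff.2 hW) fun Y ↦ ?_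
  induction Y using M.induction with
  | h0 V hV => exact M.p_lie_eq_zero (M.p_eq_zero_iff.2 hW) (M.p_eq_zero_iff.2 hV)
  | h1 X hX => rw [h X hX, map_zero]
  | hadd X Y hX hY => rw [lie_add, map_add, hX, hY, add_zero]

lemma eq_of_lie_eq {W V : L} (hW : M.θ W = W) (hV : M.θ V = V)
    (h : ∀ X, M.θ X = -X → ⁅W, X⁆ = ⁅V, X⁆) : W = V := by
  rw [← sub_eq_zero]
  exact M.eq_zero_of_lie_eq_zero (by rw [map_sub, hW, hV])
    fun X hX ↦ by rw [sub_lie, h X hX, sub_self]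

omit [LieAlgebra.IsSimple ℝ L] [Nontrivial T] in
/-- The pair symmetry of the curvature `⁅⁅X, Y⁆, Z⁆` with respect to any invariant symmetric form
on the `(-1)`-eigenspace. -/
lemma form_pair_symm (b : L → L → ℝ) (hs : ∀ X Y, M.θ X = -X → M.θ Y = -Y → b X Y = b Y X)
    (hadd : ∀ X Y Z, M.θ X = -X → M.θ Y = -Y → M.θ Z = -Z → b (X + Y) Z = b X Z + b Y Z)
    (h0 : ∀ Z, M.θ Z = -Z → b 0 Z = 0)
    (hi : ∀ W X Y, M.θ W = W → M.θ X = -X → M.θ Y = -Y → b ⁅W, X⁆ Y + b X ⁅W, Y⁆ = 0)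
    {X Y Z V : L} (hX : M.θ X = -X) (hY : M.θ Y = -Y) (hZ : M.θ Z = -Z) (hV : M.θ V = -V) :
    b ⁅⁅X, Y⁆, Z⁆ V = b ⁅⁅Z, V⁆, X⁆ Y := by
  have hn (A B : L) (hA : M.θ A = -A) (hB : M.θ B = -B) : b (-A) B = -b A B := by
    have := hadd (-A) A B (by simp [hA]) hA hB
    rw [neg_add_cancel, h0 B hB] at this
    linarith
  have hm {A B C : L} (hA : M.θ A = -A) (hB : M.θ B = -B) (hC : M.θ C = -C) :
      M.θ ⁅⁅A, B⁆, C⁆ = -⁅⁅A, B⁆, C⁆ := M.θ_lie_minus (M.θ_lie_minus_minus hA hB) hC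
  refine curvature_pair_symm (S := {X : L // M.θ X = -X})
    (fun X Y Z V ↦ b ⁅⁅X.1, Y.1⁆, Z.1⁆ V.1) ?_ ?_ ?_ ⟨X, hX⟩ ⟨Y, hY⟩ ⟨Z, hZ⟩ ⟨V, hV⟩
  · rintro ⟨x, hx⟩ ⟨y, hy⟩ ⟨z, hz⟩ ⟨w, hw⟩
    dsimp only
    rw [← lie_skew x y, neg_lie, hn _ _ (hm hy hx hz) hw]
  · rintro ⟨x, hx⟩ ⟨y, hy⟩ ⟨z, hz⟩ ⟨w, hw⟩
    dsimp only
    have := hi ⁅x, y⁆ z w (M.θ_lie_minus_minus hx hy) hz hw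
    rw [hs z _ hz (hm hx hy hw)] at this
    linarith
  · rintro ⟨x, hx⟩ ⟨y, hy⟩ ⟨z, hz⟩ ⟨w, hw⟩
    dsimp only
    rw [← hadd _ _ _ (hm hx hy hz) (hm hy hz hx) hw,
      ← hadd _ _ _ (by rw [map_add, hm hx hy hz, hm hy hz hx]; abel) (hm hz hx hy) hw,
      ← h0 w hw]
    congr 1
    have := lie_jacobi x y z
    rw [← lie_skew x ⁅y, z⁆, ← lie_skew y ⁅z, x⁆, ← lie_skew z ⁅x, y⁆] at this
    rw [← neg_eq_zero, ← this]; abel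

/-- The para-complex structure as an endomorphism of `L` vanishing on the isotropy algebra. -/
def structureMap : L →ₗ[ℝ] L := M.lift ∘ₗ M.J ∘ₗ M.p

omit [LieAlgebra.IsSimple ℝ L] [Nontrivial T] in
@[simp] lemma p_structureMap (X : L) : M.p (M.structureMap X) = M.J (M.p X) := by
  simp [structureMap]

omit [LieAlgebra.IsSimple ℝ L] [Nontrivial T] in
@[simp] lemma θ_structureMap (X : L) : M.θ (M.structureMap X) = -M.structureMap X := by
  simp [structureMap]

lemma structureMap_of_plus {W : L} (hW : M.θ W = W) : M.structureMap W = 0 := by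
  simp [structureMap, M.p_eq_zero_iff.2 hW]

lemma structureMap_lie {W : L} (X : L) (hW : M.θ W = W) :
    M.structureMap ⁅W, X⁆ = ⁅W, M.structureMap X⁆ := by
  have h := M.J_lie W X (M.structureMap X) (M.p_eq_zero_iff.2 hW) (by simp)
  rw [structureMap, LinearMap.comp_apply, LinearMap.comp_apply, h]
  exact M.lift_p (M.θ_lie_minus hW (by simp))

lemma eq_of_p_eq {X Y : L} (hX : M.θ X = -X) (hY : M.θ Y = -Y) (h : M.p X = M.p Y) : X = Y := by
  rw [← M.lift_p hX, ← M.lift_p hY, h]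

/-- The pair symmetry of the curvature and the skewness of `J` show that `J` is a derivation. -/
lemma structureMap_lie_add {X Y : L} (hX : M.θ X = -X) (hY : M.θ Y = -Y) :
    ⁅M.structureMap X, Y⁆ + ⁅X, M.structureMap Y⁆ = 0 := by
  have hI := M.θ_structureMap
  have key {A B C D : L} (hA : M.θ A = -A) (hB : M.θ B = -B) (hC : M.θ C = -C)
      (hD : M.θ D = -D) :
      M.γ (M.p ⁅⁅A, B⁆, C⁆) (M.p D) = M.γ (M.p ⁅⁅C, D⁆, A⁆) (M.p B) :=
    M.form_pair_symm (fun A B ↦ M.γ (M.p A) (M.p B)) (fun _ _ _ _ ↦ M.symm _ _)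
      (fun _ _ _ _ _ _ ↦ by simp) (fun _ _ ↦ by simp)
      (fun W X Y hW _ _ ↦ M.γ_lie W X Y (M.p_eq_zero_iff.2 hW)) hA hB hC hD
  refine M.eq_zero_of_lie_eq_zero ?_ fun Z hZ ↦ ?_
  · rw [map_add, M.θ_lie_minus_minus (hI X) hY, M.θ_lie_minus_minus hX (hI Y)]
  · have hW : M.θ (⁅M.structureMap X, Y⁆ + ⁅X, M.structureMap Y⁆) =
        ⁅M.structureMap X, Y⁆ + ⁅X, M.structureMap Y⁆ := by
      rw [map_add, M.θ_lie_minus_minus (hI X) hY, M.θ_lie_minus_minus hX (hI Y)]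
    refine M.eq_zero_of_p_eq_zero (M.θ_lie_minus hW hZ) (M.nondeg _ fun v ↦ ?_)
    obtain ⟨V, hV, rfl⟩ : ∃ V, M.θ V = -V ∧ M.p V = v := ⟨M.lift v, by simp, by simp⟩
    rw [add_lie, map_add, map_add, LinearMap.add_apply, key (hI X) hY hZ hV, key hX (hI Y) hZ hV,
      ← M.structureMap_lie X (M.θ_lie_minus_minus hZ hV), p_structureMap, p_structureMap]
    exact M.skew _ _

variable [FiniteDimensional ℝ L]

/-- The para-complex structure is a derivation, so it is the adjoint action of an element of the
simple Lie algebra `L`. -/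
lemma exists_characteristic : ∃ Z : L, ∀ X, ⁅Z, X⁆ = M.structureMap X := by
  let D : LieDerivation ℝ L L :=
    { toLinearMap := M.structureMap
      leibniz' := fun A B ↦ by
        suffices h : M.structureMap ⁅A, B⁆ = ⁅M.structureMap A, B⁆ + ⁅A, M.structureMap B⁆ by
          rw [h, ← lie_skew B]; abel
        induction A using M.induction with
        | h0 W hW =>
          induction B using M.induction with
          | h0 V hV =>
            rw [M.structureMap_of_plus hW, M.structureMap_of_plus hV,
              M.structureMap_of_plus (M.θ_lie_plus hW hV)]; simp
          | h1 X hX => rw [M.structureMap_of_plus hW, M.structureMap_lie X hW]; simp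
          | hadd X Y hX hY => rw [lie_add, map_add, hX, hY, map_add]; simp only [lie_add]; abel
        | h1 X hX =>
          induction B using M.induction with
          | h0 V hV =>
            rw [M.structureMap_of_plus hV, ← lie_skew, map_neg, M.structureMap_lie X hV,
              ← lie_skew]; simp
          | h1 Y hY =>
            rw [M.structureMap_of_plus (M.θ_lie_minus_minus hX hY), M.structureMap_lie_add hX hY]
          | hadd X Y hX hY => rw [lie_add, map_add, hX, hY, map_add]; simp only [lie_add]; abel
        | hadd X Y hX hY => rw [add_lie, map_add, hX, hY, map_add]; simp only [add_lie]; abel }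
  obtain ⟨Z, hZ⟩ := LieDerivation.IsKilling.exists_eq_ad D
  exact ⟨Z, fun X ↦ by simpa using! DFunLike.congr_fun hZ X⟩

/-- The characteristic element `Z` of the model: `ad Z` is the para-complex structure. -/
def char : L := M.exists_characteristic.choose

lemma char_lie (X : L) : ⁅M.char, X⁆ = M.structureMap X := M.exists_characteristic.choose_spec X

omit M [Nontrivial T] [FiniteDimensional ℝ L] in
lemma eq_zero_of_forall_lie {X : L} (h : ∀ Y : L, ⁅X, Y⁆ = 0) : X = 0 := by
  have h2 : X ∈ LieAlgebra.center ℝ L := by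
    rw [LieModule.mem_maxTrivSubmodule]
    exact fun Y ↦ by rw [← lie_skew, h Y, neg_zero]
  rwa [LieAlgebra.center_eq_bot, LieSubmodule.mem_bot] at h2

lemma θ_char : M.θ M.char = M.char := by
  rw [← sub_eq_zero]
  refine eq_zero_of_forall_lie fun Y ↦ ?_
  obtain ⟨X, rfl⟩ : ∃ X, M.θ X = Y := ⟨M.θ Y, M.inv Y⟩
  rw [sub_lie, ← LieEquiv.map_lie, M.char_lie, M.char_lie, θ_structureMap, structureMap]
  simp [M.p_θ]

lemma p_char : M.p M.char = 0 := M.p_eq_zero_iff.2 M.θ_char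

lemma char_lie_char_lie {X : L} (hX : M.θ X = -X) : ⁅M.char, ⁅M.char, X⁆⁆ = X := by
  rw [M.char_lie, M.char_lie]
  exact M.eq_of_p_eq (by simp) hX (by simp [M.sq])

lemma char_lie_plus {W : L} (hW : M.θ W = W) : ⁅M.char, W⁆ = 0 := by
  rw [M.char_lie, M.structureMap_of_plus hW]

lemma char_ne_zero : M.char ≠ 0 := by
  intro h
  obtain ⟨v, hv⟩ := exists_ne (0 : T)
  have := M.char_lie_char_lie (M.θ_lift v)
  rw [h, zero_lie] at this
  exact hv (by rw [← M.p_lift v, ← this, map_zero])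

end InfinitesimalModel

end Algebra

/-! ### Invariant forms and the centroid -/

section Centroid

variable {L T : Type*} [LieRing L] [LieAlgebra ℝ L] [AddCommGroup T] [Module ℝ T]

/-- The centroid of a Lie algebra: the endomorphisms commuting with the adjoint action. -/
def IsCentroid (A : L →ₗ[ℝ] L) : Prop := ∀ X Y : L, A ⁅X, Y⁆ = ⁅A X, Y⁆

namespace IsCentroid

variable {A A' : L →ₗ[ℝ] L}

lemma lie_right (hA : IsCentroid A) (X Y : L) : A ⁅X, Y⁆ = ⁅X, A Y⁆ := by
  rw [← lie_skew, map_neg, hA, lie_skew]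

lemma id_smul (c : ℝ) : IsCentroid (c • LinearMap.id : L →ₗ[ℝ] L) := fun X Y ↦ by simp

lemma add (hA : IsCentroid A) (hA' : IsCentroid A') : IsCentroid (A + A') := fun X Y ↦ by
  simp [hA X Y, hA' X Y]

lemma sub (hA : IsCentroid A) (hA' : IsCentroid A') : IsCentroid (A - A') := fun X Y ↦ by
  simp [hA X Y, hA' X Y]

lemma smul (hA : IsCentroid A) (c : ℝ) : IsCentroid (c • A) := fun X Y ↦ by
  simp [hA X Y]

lemma comp (hA : IsCentroid A) (hA' : IsCentroid A') : IsCentroid (A ∘ₗ A') := fun X Y ↦ by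
  simp [hA' X Y, hA (A' X) Y]

/-- The kernel of an element of the centroid is an ideal, so on a simple Lie algebra two elements
of the centroid that agree at a nonzero vector are equal. -/
lemma eq_of_apply_eq [LieAlgebra.IsSimple ℝ L] (hA : IsCentroid A) (hA' : IsCentroid A') {Z : L}
    (hZ : Z ≠ 0) (h : A Z = A' Z) : A = A' := by
  let I : LieIdeal ℝ L :=
    { LinearMap.ker (A - A') with
      lie_mem := fun {X Y} hY ↦ by
        have hY' : (A - A') Y = 0 := hY
        change (A - A') ⁅X, Y⁆ = 0
        rw [(hA.sub hA').lie_right, hY', lie_zero] }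
  have hI (X : L) : X ∈ I ↔ (A - A') X = 0 := Iff.rfl
  rcases LieAlgebra.IsSimple.eq_bot_or_eq_top I with h0 | h0
  · have : Z ∈ I := by rw [hI]; simp [h]
    rw [h0] at this
    exact absurd (by simpa using this) hZ
  · ext X
    have : X ∈ I := by simp [h0]
    rw [hI] at this
    simpa [sub_eq_zero] using this

lemma killingForm_apply [FiniteDimensional ℝ L] (hA : IsCentroid A) (X Y : L) :
    killingForm ℝ L (A X) Y = killingForm ℝ L X (A Y) := by
  have h1 : LieAlgebra.ad ℝ L (A X) = A ∘ₗ LieAlgebra.ad ℝ L X := by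
    ext Z; simp [hA X Z]
  have h2 : LieAlgebra.ad ℝ L (A Y) = LieAlgebra.ad ℝ L Y ∘ₗ A := by
    ext Z; simp [← hA Y Z, hA.lie_right Y Z]
  rw [killingForm_apply_apply, killingForm_apply_apply, h1, h2, LinearMap.comp_assoc,
    LinearMap.trace_comp_comm', LinearMap.comp_assoc]

end IsCentroid

namespace InfinitesimalModel

variable (M : InfinitesimalModel L T)
include M

lemma killingForm_θ (X Y : L) : killingForm ℝ L (M.θ X) Y = killingForm ℝ L X (M.θ Y) := by
  rw [← LieAlgebra.killingForm_of_equiv_apply M.θ X (M.θ Y), M.inv]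

omit M in
lemma killingForm_lie (X Y Z : L) : killingForm ℝ L ⁅X, Y⁆ Z = -killingForm ℝ L Y ⁅X, Z⁆ := by
  rw [← lie_skew, map_neg, LinearMap.neg_apply]
  exact congrArg Neg.neg (LieModule.traceForm_apply_lie_apply ℝ L L Y X Z)

variable [LieAlgebra.IsSimple ℝ L] [FiniteDimensional ℝ L]

omit M in
lemma eq_of_killingForm_eq {X Y : L} (h : ∀ Z, killingForm ℝ L X Z = killingForm ℝ L Y Z) :
    X = Y := by
  have h1 : X - Y ∈ LinearMap.ker (killingForm ℝ L) := by
    rw [LinearMap.mem_ker]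
    ext Z
    simp [h Z]
  rw [LieAlgebra.IsKilling.ker_killingForm_eq_bot, Submodule.mem_bot, sub_eq_zero] at h1
  exact h1

lemma killingForm_plus_minus {W X : L} (hW : M.θ W = W) (hX : M.θ X = -X) :
    killingForm ℝ L X W = 0 := by
  have h := M.killingForm_θ X W
  rw [hX, hW, map_neg, LinearMap.neg_apply] at h
  linarith

variable [Nontrivial T]

lemma eq_of_killingForm_eq_minus {X Y : L} (hX : M.θ X = -X) (hY : M.θ Y = -Y)
    (h : ∀ Z, M.θ Z = -Z → killingForm ℝ L X Z = killingForm ℝ L Y Z) : X = Y := by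
  refine eq_of_killingForm_eq fun Z ↦ ?_
  induction Z using M.induction with
  | h0 W hW => rw [M.killingForm_plus_minus hW hX, M.killingForm_plus_minus hW hY]
  | h1 Z hZ => exact h Z hZ
  | hadd V W hV hW => rw [map_add, map_add, hV, hW]

/-- The projection onto the `(-1)`-eigenspace of the involution. -/
def proj : L →ₗ[ℝ] L := M.lift ∘ₗ M.p

omit [LieAlgebra.IsSimple ℝ L] [FiniteDimensional ℝ L] [Nontrivial T] in
lemma θ_proj (X : L) : M.θ (M.proj X) = -M.proj X := by simp [proj]

lemma proj_minus {X : L} (hX : M.θ X = -X) : M.proj X = X := M.lift_p hX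

lemma proj_plus {W : L} (hW : M.θ W = W) : M.proj W = 0 := by
  simp [proj, M.p_eq_zero_iff.2 hW]

lemma proj_lie {W : L} (X : L) (hW : M.θ W = W) : M.proj ⁅W, X⁆ = ⁅W, M.proj X⁆ := by
  induction X using M.induction with
  | h0 V hV => rw [M.proj_plus hV, M.proj_plus (M.θ_lie_plus hW hV), lie_zero]
  | h1 X hX => rw [M.proj_minus hX, M.proj_minus (M.θ_lie_minus hW hX)]
  | hadd X Y hX hY => rw [lie_add, map_add, hX, hY, map_add, lie_add]

/-- A bilinear form on the `(-1)`-eigenspace, expressed through the Killing form. -/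
lemma exists_killing_dual (b : LinearMap.BilinForm ℝ L) : ∃ a : L →ₗ[ℝ] L, ∀ X Y,
    killingForm ℝ L (a X) Y = b (M.proj X) (M.proj Y) := by
  let e := LinearMap.BilinForm.toDual (killingForm ℝ L)
    (LieAlgebra.IsKilling.killingForm_nondegenerate ℝ L)
  refine ⟨e.symm.toLinearMap ∘ₗ (b.compl₁₂ M.proj M.proj), fun X Y ↦ ?_⟩
  exact LinearMap.congr_fun (e.apply_symm_apply ((b.compl₁₂ M.proj M.proj) X)) Y

/-- An endomorphism `a` of the `(-1)`-eigenspace that intertwines the isotropy action and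
satisfies `⁅⁅X, Y⁆, a Z⁆ = ⁅⁅a X, Y⁆, Z⁆` extends to an element of the centroid. The elements
`U` for which `a ∘ ad U` is the adjoint action of some element of the isotropy algebra form, together
with the `(-1)`-eigenspace, an ideal, which is everything. -/
lemma exists_centroid (a : L →ₗ[ℝ] L) (h1 : ∀ X, M.θ (a X) = -a X)
    (h0 : ∀ W, M.θ W = W → a W = 0)
    (hW : ∀ W X, M.θ W = W → M.θ X = -X → a ⁅W, X⁆ = ⁅W, a X⁆)
    (hR : ∀ X Y Z, M.θ X = -X → M.θ Y = -Y → M.θ Z = -Z → ⁅⁅X, Y⁆, a Z⁆ = ⁅⁅a X, Y⁆, Z⁆) :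
    ∃ A : L →ₗ[ℝ] L, IsCentroid A ∧ (∀ X, A (M.θ X) = M.θ (A X)) ∧
      ∀ X, M.θ X = -X → A X = a X := by
  let P : LieIdeal ℝ L :=
    { carrier := {U | ∃ V, M.θ V = V ∧ ∀ X, M.θ X = -X → ⁅V, X⁆ = a ⁅U - M.proj U, X⁆}
      add_mem' := by
        rintro U U' ⟨V, hV, h⟩ ⟨V', hV', h'⟩
        refine ⟨V + V', by rw [map_add, hV, hV'], fun X hX ↦ ?_⟩
        rw [add_lie, h X hX, h' X hX, ← map_add, ← add_lie]
        congr 2; rw [map_add]; abel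
      zero_mem' := ⟨0, by simp, fun X _ ↦ by simp⟩
      smul_mem' := by
        rintro c U ⟨V, hV, h⟩
        refine ⟨c • V, by simp [hV], fun X hX ↦ ?_⟩
        rw [smul_lie, h X hX, ← map_smul, ← smul_lie, map_smul, smul_sub]
      lie_mem := by
        rintro Y U ⟨V, hV, h⟩
        have hU : M.θ (U - M.proj U) = U - M.proj U := M.θ_sub_lift U
        set U₀ := U - M.proj U with hU₀
        have hUe : U = U₀ + M.proj U := by rw [hU₀]; abel
        induction Y using M.induction with
        | h0 Y hY =>
          refine ⟨⁅Y, V⁆, M.θ_lie_plus hY hV, fun X hX ↦ ?_⟩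
          have hYX := M.θ_lie_minus hY hX
          rw [M.proj_lie U hY, ← lie_sub, ← hU₀, lie_lie, lie_lie, h X hX, h _ hYX, map_sub,
            hW _ _ hY (M.θ_lie_minus hU hX)]
        | h1 Y hY =>
          refine ⟨⁅a Y, M.proj U⁆, M.θ_lie_minus_minus (h1 Y) (M.θ_proj U), fun X hX ↦ ?_⟩
          have e : ⁅Y, U⁆ - M.proj ⁅Y, U⁆ = ⁅Y, M.proj U⁆ := by
            have e1 : M.θ ⁅Y, U₀⁆ = -⁅Y, U₀⁆ := by
              rw [← lie_skew, map_neg, M.θ_lie_minus hU hY]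
            conv_lhs => rw [hUe, lie_add, map_add, M.proj_minus e1,
              M.proj_plus (M.θ_lie_minus_minus hY (M.θ_proj _))]
            abel
          rw [e, hW _ _ (M.θ_lie_minus_minus hY (M.θ_proj U)) hX, hR _ _ _ hY (M.θ_proj U) hX]
        | hadd Y Y' hY hY' =>
          obtain ⟨V, hV, h⟩ := hY
          obtain ⟨V', hV', h'⟩ := hY'
          refine ⟨V + V', by rw [map_add, hV, hV'], fun X hX ↦ ?_⟩
          rw [add_lie, h X hX, h' X hX, ← map_add, ← add_lie]
          congr 2; rw [add_lie, map_add]; abel }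
  have hP (U : L) : U ∈ P ↔
      ∃ V, M.θ V = V ∧ ∀ X, M.θ X = -X → ⁅V, X⁆ = a ⁅U - M.proj U, X⁆ := Iff.rfl
  have htop : P = ⊤ := by
    refine (LieAlgebra.IsSimple.eq_bot_or_eq_top P).resolve_left fun hbot ↦ ?_
    obtain ⟨v, hv⟩ := exists_ne (0 : T)
    have : M.lift v ∈ P := (hP _).2 ⟨0, by simp, fun X _ ↦ by
      rw [M.proj_minus (M.θ_lift v)]; simp⟩
    rw [hbot, LieSubmodule.mem_bot] at this
    exact hv (by rw [← M.p_lift v, this, map_zero])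
  have hall (U : L) : ∃ V, M.θ V = V ∧ ∀ X, M.θ X = -X → ⁅V, X⁆ = a ⁅U - M.proj U, X⁆ :=
    (hP U).1 (by simp [htop])
  choose V hV hVX using hall
  -- the isotropy representation is faithful, so that `V U` is unique, hence linear in `U`
  have huniq (U W : L) (hW : M.θ W = W)
      (h : ∀ X, M.θ X = -X → ⁅W, X⁆ = a ⁅U - M.proj U, X⁆) : V U = W :=
    M.eq_of_lie_eq (hV U) hW fun X hX ↦ by rw [hVX U X hX, h X hX]
  let Vl : L →ₗ[ℝ] L :=
    { toFun := V
      map_add' := fun U U' ↦ huniq _ _ (by rw [map_add, hV, hV]) fun X hX ↦ by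
        rw [add_lie, hVX _ _ hX, hVX _ _ hX, ← map_add, ← add_lie]
        congr 2; rw [map_add]; abel
      map_smul' := fun c U ↦ huniq _ _ (by simp [hV]) fun X hX ↦ by
        rw [RingHom.id_apply, smul_lie, hVX _ _ hX, ← map_smul, ← smul_lie, map_smul, smul_sub] }
  have hVminus (X : L) (hX : M.θ X = -X) : V X = 0 :=
    huniq _ _ (by simp) fun Y _ ↦ by rw [M.proj_minus hX]; simp
  have hVplus (W X : L) (hW : M.θ W = W) (hX : M.θ X = -X) : ⁅V W, X⁆ = a ⁅W, X⁆ := by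
    rw [hVX _ _ hX, M.proj_plus hW, sub_zero]
  refine ⟨a + Vl, ?_, ?_, fun X hX ↦ by simp [Vl, hVminus X hX]⟩
  · have hA0 (W : L) (h : M.θ W = W) : (a + Vl) W = V W := by simp [Vl, h0 W h]
    have hA1 (X : L) (h : M.θ X = -X) : (a + Vl) X = a X := by simp [Vl, hVminus X h]
    intro X Y
    induction X using M.induction with
    | h0 W hθW =>
      induction Y using M.induction with
      | h0 W' hθW' =>
        rw [hA0 W hθW, hA0 _ (M.θ_lie_plus hθW hθW')]
        refine M.eq_of_lie_eq (hV _) (M.θ_lie_plus (hV _) hθW') fun X hX ↦ ?_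
        rw [hVplus _ _ (M.θ_lie_plus hθW hθW') hX, lie_lie, lie_lie,
          hVplus _ _ hθW (M.θ_lie_minus hθW' hX), hVplus _ _ hθW hX, map_sub,
          hW _ _ hθW' (M.θ_lie_minus hθW hX)]
      | h1 X hX => rw [hA0 W hθW, hA1 _ (M.θ_lie_minus hθW hX), hVplus _ _ hθW hX]
      | hadd Y Y' h h' => rw [lie_add, map_add, h, h', lie_add]
    | h1 X hX =>
      induction Y using M.induction with
      | h0 W hθW =>
        rw [← lie_skew, map_neg, hA1 _ (M.θ_lie_minus hθW hX), hA1 X hX, hW _ _ hθW hX, lie_skew]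
      | h1 Y hY =>
        rw [hA1 X hX, hA0 _ (M.θ_lie_minus_minus hX hY)]
        refine M.eq_of_lie_eq (hV _) (M.θ_lie_minus_minus (h1 X) hY) fun Z hZ ↦ ?_
        rw [hVplus _ _ (M.θ_lie_minus_minus hX hY) hZ, hW _ _ (M.θ_lie_minus_minus hX hY) hZ,
          hR _ _ _ hX hY hZ]
      | hadd Y Y' h h' => rw [lie_add, map_add, h, h', lie_add]
    | hadd X X' h h' => rw [add_lie, map_add, h, h', map_add, add_lie]
  · intro X
    induction X using M.induction with
    | h0 W hW => simp [Vl, hW, h0 W hW, hV W]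
    | h1 X hX => simp [Vl, hX, hVminus X hX, hVminus (-X) (by simp [hX]), h1 X]
    | hadd X Y hX hY => rw [map_add, map_add, hX, hY, map_add, map_add]

/-- Every invariant symmetric form on the `(-1)`-eigenspace is `B(A ·, ·)` with the Killing form `B`
and an element `A` of the centroid: compare the pair symmetries of the curvature for the two
forms. -/
lemma exists_centroid_of_form (b : LinearMap.BilinForm ℝ L)
    (hs : ∀ X Y, M.θ X = -X → M.θ Y = -Y → b X Y = b Y X)
    (hi : ∀ W X Y, M.θ W = W → M.θ X = -X → M.θ Y = -Y → b ⁅W, X⁆ Y + b X ⁅W, Y⁆ = 0) :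
    ∃ A : L →ₗ[ℝ] L, IsCentroid A ∧ (∀ X, A (M.θ X) = M.θ (A X)) ∧
      ∀ X Y, M.θ X = -X → M.θ Y = -Y → b X Y = killingForm ℝ L (A X) Y := by
  obtain ⟨a, ha⟩ := M.exists_killing_dual b
  have ha' (X Y : L) (hX : M.θ X = -X) (hY : M.θ Y = -Y) : killingForm ℝ L (a X) Y = b X Y := by
    rw [ha, M.proj_minus hX, M.proj_minus hY]
  have hθ (X : L) : M.proj (M.θ X) = -M.proj X := by simp [proj, M.p_θ]
  have h1 (X : L) : M.θ (a X) = -a X := by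
    refine eq_of_killingForm_eq fun Y ↦ ?_
    rw [M.killingForm_θ, ha, hθ, map_neg, map_neg, LinearMap.neg_apply, ha]
  have h0 (W : L) (hW : M.θ W = W) : a W = 0 := by
    refine eq_of_killingForm_eq fun Y ↦ ?_
    rw [ha, M.proj_plus hW]; simp
  have hW (W X : L) (hW : M.θ W = W) (hX : M.θ X = -X) : a ⁅W, X⁆ = ⁅W, a X⁆ := by
    have hWX := M.θ_lie_minus hW hX
    refine M.eq_of_killingForm_eq_minus (h1 _) (M.θ_lie_minus hW (h1 X)) fun Z hZ ↦ ?_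
    rw [ha' _ _ hWX hZ, killingForm_lie, ha' _ _ hX (M.θ_lie_minus hW hZ)]
    linarith [hi W X Z hW hX hZ]
  obtain ⟨A, hA, hAθ, hAa⟩ := M.exists_centroid a h1 h0 hW fun X Y Z hX hY hZ ↦ by
    have hXY := M.θ_lie_minus_minus hX hY
    have haXY := M.θ_lie_minus_minus (h1 X) hY
    refine M.eq_of_killingForm_eq_minus (M.θ_lie_minus hXY (h1 Z)) (M.θ_lie_minus haXY hZ)
      fun V hV ↦ ?_
    have hZV := M.θ_lie_minus_minus hZ hV
    rw [← hW _ _ hXY hZ, ha' _ _ (M.θ_lie_minus hXY hZ) hV,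
      M.form_pair_symm (fun A B ↦ b A B) hs (by simp) (by simp) hi hX hY hZ hV,
      M.form_pair_symm (fun A B ↦ killingForm ℝ L A B) (fun A B _ _ ↦ LieModule.traceForm_comm ..)
        (by simp) (by simp) (fun W X Y _ _ _ ↦ by rw [killingForm_lie]; ring) (h1 X) hY hZ hV,
      ← ha' _ _ (M.θ_lie_minus hZV hX) hY, hW _ _ hZV hX]
  exact ⟨A, hA, hAθ, fun X Y hX hY ↦ by rw [hAa X hX, ha' X Y hX hY]⟩

end InfinitesimalModel

end Centroid

/-! ### The center of the isotropy group and the form of the metric -/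

section Classification

variable {L T : Type*} [LieRing L] [LieAlgebra ℝ L] [AddCommGroup T] [Module ℝ T]

lemma IsCentroid.conj {A : L →ₗ[ℝ] L} (hA : IsCentroid A) (Φ : L ≃ₗ⁅ℝ⁆ L) :
    IsCentroid ((Φ : L →ₗ[ℝ] L) ∘ₗ A ∘ₗ (Φ.symm : L →ₗ[ℝ] L)) := fun X Y ↦ by
  have e : Φ.symm ⁅X, Y⁆ = ⁅Φ.symm X, Φ.symm Y⁆ := Φ.symm.map_lie X Y
  simp only [LinearMap.comp_apply, LieEquiv.coe_toLinearEquiv, LinearEquiv.coe_coe, e, hA (Φ.symm X),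
    LieEquiv.map_lie, LieEquiv.apply_symm_apply]

lemma IsComplexStructure.isCentroid {i : L →ₗ[ℝ] L} (hi : IsComplexStructure i) : IsCentroid i :=
  fun X Y ↦ (hi.2 X Y).symm

lemma twistedKilling_apply (i : L →ₗ[ℝ] L) (a b : ℝ) (X Y : L) :
    twistedKilling i a b X Y = killingForm ℝ L ((a • (LinearMap.id : L →ₗ[ℝ] L) + b • i) X) Y := by
  simp [twistedKilling]

lemma exists_eq_smul_add_smul_of_finrank_eq_two {V : Type*} [AddCommGroup V] [Module ℝ V]
    {S : Submodule ℝ V} (hS : finrank ℝ S = 2) {Z W : V} (hZ : Z ∈ S) (hW : W ∈ S)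
    (hZW : LinearIndependent ℝ ![Z, W]) {U : V} (hU : U ∈ S) : ∃ x y : ℝ, U = x • Z + y • W := by
  have : FiniteDimensional ℝ S := FiniteDimensional.of_finrank_eq_succ hS
  have hli : LinearIndependent ℝ ![(⟨Z, hZ⟩ : S), ⟨W, hW⟩] := by
    refine LinearIndependent.of_comp S.subtype ?_
    convert hZW using 1
    ext k; fin_cases k <;> rfl
  have htop := hli.span_eq_top_of_card_eq_finrank' (by simp [hS])
  have hmem : (⟨U, hU⟩ : S) ∈ Submodule.span ℝ (Set.range ![(⟨Z, hZ⟩ : S), ⟨W, hW⟩]) := by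
    rw [htop]; trivial
  rw [Matrix.range_cons, Matrix.range_cons, Matrix.range_empty, Set.union_empty,
    Set.singleton_union, Submodule.mem_span_pair] at hmem
  obtain ⟨x, y, h⟩ := hmem
  exact ⟨x, y, by simpa using (congrArg Subtype.val h).symm⟩

namespace InfinitesimalModel

variable (M : InfinitesimalModel L T)

/-- The automorphisms of `L` that induce linear isometries of the tangent space commuting with the
para-complex structure, such as `Ad h` for `h` in the isotropy group. -/
structure IsIsotropy (Φ : L ≃ₗ⁅ℝ⁆ L) : Prop where
  metric (X Y : L) : M.γ (M.p (Φ X)) (M.p (Φ Y)) = M.γ (M.p X) (M.p Y)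
  paraComplex (X X' : L) (h : M.J (M.p X) = M.p X') : M.J (M.p (Φ X)) = M.p (Φ X')

variable {M} {Φ : L ≃ₗ⁅ℝ⁆ L}

lemma IsIsotropy.p_eq_zero (hΦ : M.IsIsotropy Φ) {X : L} (hX : M.p X = 0) : M.p (Φ X) = 0 := by
  refine M.nondeg _ fun w ↦ ?_
  obtain ⟨Y, rfl⟩ := M.surj w
  obtain ⟨Y, rfl⟩ : ∃ V, Φ V = Y := ⟨Φ.symm Y, Φ.apply_symm_apply Y⟩
  rw [hΦ.metric, hX]; simp

variable [LieAlgebra.IsSimple ℝ L] [Nontrivial T] [FiniteDimensional ℝ L]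

lemma IsIsotropy.apply_char (hΦ : M.IsIsotropy Φ) : Φ M.char = M.char := by
  have h0 : M.p (Φ M.char) = 0 := hΦ.p_eq_zero M.p_char
  rw [← sub_eq_zero]
  refine M.eq_zero_of_mem_isotropyKernel (by rw [map_sub, h0, M.p_char, sub_zero]) fun Y ↦ ?_
  obtain ⟨Y, rfl⟩ : ∃ V, Φ V = Y := ⟨Φ.symm Y, Φ.apply_symm_apply Y⟩
  rw [sub_lie, map_sub, ← LieEquiv.map_lie, M.char_lie, M.char_lie, M.p_structureMap, sub_eq_zero,
    hΦ.paraComplex Y (M.structureMap Y) (M.p_structureMap Y).symm]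

lemma IsIsotropy.θ_plus (hΦ : M.IsIsotropy Φ) {W : L} (hW : M.θ W = W) : M.θ (Φ W) = Φ W :=
  M.p_eq_zero_iff.1 (hΦ.p_eq_zero (M.p_eq_zero_iff.2 hW))

lemma IsIsotropy.θ_minus (hΦ : M.IsIsotropy Φ) {X : L} (hX : M.θ X = -X) :
    M.θ (Φ X) = -Φ X := by
  have : Φ X = ⁅M.char, Φ ⁅M.char, X⁆⁆ := by
    have e : ⁅M.char, Φ ⁅M.char, X⁆⁆ = ⁅Φ M.char, Φ ⁅M.char, X⁆⁆ := by rw [hΦ.apply_char]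
    rw [e, ← LieEquiv.map_lie, M.char_lie_char_lie hX]
  rw [this, M.char_lie, M.θ_structureMap]

/-- An element of the centroid that defines an invariant form commutes with the isotropy
automorphisms. -/
lemma IsIsotropy.comm_of_form (hΦ : M.IsIsotropy Φ) {A : L →ₗ[ℝ] L} (hA : IsCentroid A)
    (hAθ : ∀ X, A (M.θ X) = M.θ (A X))
    (h : ∀ X Y, M.θ X = -X → M.θ Y = -Y →
      killingForm ℝ L (A (Φ X)) (Φ Y) = killingForm ℝ L (A X) Y) (X : L) : A (Φ X) = Φ (A X) := by
  obtain ⟨v, hv⟩ := exists_ne (0 : T)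
  set X₀ := M.lift v with hX₀def
  have hX₀ : M.θ X₀ = -X₀ := by simp [X₀]
  have hX₀ne : X₀ ≠ 0 := fun h0 ↦ hv (by rw [← M.p_lift v, ← hX₀def, h0, map_zero])
  have hAminus {X : L} (hX : M.θ X = -X) : M.θ (A X) = -A X := by rw [← hAθ, hX, map_neg]
  have key : A (Φ X₀) = Φ (A X₀) := by
    refine M.eq_of_killingForm_eq_minus (hAminus (hΦ.θ_minus hX₀)) (hΦ.θ_minus (hAminus hX₀))
      fun Z hZ ↦ ?_
    obtain ⟨Z, rfl⟩ : ∃ V, Φ V = Z := ⟨Φ.symm Z, Φ.apply_symm_apply Z⟩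
    have hZ' : M.θ Z = -Z := by
      have h1 := hΦ.θ_plus (M.θ_sub_lift Z)
      have h2 := hΦ.θ_minus (M.θ_lift (M.p Z))
      rw [map_sub, map_sub, hZ, h2] at h1
      have h3 : (2 : ℝ) • Φ (Z - M.lift (M.p Z)) = 0 := by
        rw [map_sub, two_smul]; nth_rewrite 1 [← h1]; abel
      have h4 : Z - M.lift (M.p Z) = 0 := by
        rw [← Φ.symm_apply_apply (Z - M.lift (M.p Z)), (smul_eq_zero.1 h3).resolve_left two_ne_zero,
          map_zero]
      rw [sub_eq_zero] at h4
      rw [h4]; simp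
    rw [h _ _ hX₀ hZ', LieAlgebra.killingForm_of_equiv_apply]
  have := (hA.conj Φ).eq_of_apply_eq hA (Z := Φ X₀) (by simpa using hX₀ne) (by simp [key])
  simpa using (LinearMap.congr_fun this (Φ X)).symm

lemma IsIsotropy.comm_of_apply_char (hΦ : M.IsIsotropy Φ) {A : L →ₗ[ℝ] L} (hA : IsCentroid A)
    (h : Φ (A M.char) = A M.char) (X : L) : A (Φ X) = Φ (A X) := by
  have e : Φ.symm M.char = M.char := by
    rw [LieEquiv.symm_apply_eq]; exact hΦ.apply_char.symm
  have := (hA.conj Φ).eq_of_apply_eq hA M.char_ne_zero (by simp [e, h])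
  simpa using (LinearMap.congr_fun this (Φ X)).symm

variable (M)

/-- The metric is `B(A ·, ·)` for an element `A` of the centroid, and `A Z` for the characteristic
element `Z` is again an invariant element of the isotropy algebra. -/
lemma exists_centroid_of_metric : ∃ A : L →ₗ[ℝ] L, IsCentroid A ∧ (∀ X, A (M.θ X) = M.θ (A X)) ∧
    (∀ Φ, M.IsIsotropy Φ → Φ (A M.char) = A M.char) ∧
    ∀ X Y, M.θ X = -X → M.θ Y = -Y → M.γ (M.p X) (M.p Y) = killingForm ℝ L (A X) Y := by
  obtain ⟨A, hA, hAθ, h⟩ := M.exists_centroid_of_form (M.γ.compl₁₂ M.p M.p)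
    (fun X Y _ _ ↦ M.symm _ _) (fun W X Y hW _ _ ↦ M.γ_lie W X Y (M.p_eq_zero_iff.2 hW))
  refine ⟨A, hA, hAθ, fun Φ hΦ ↦ ?_, h⟩
  rw [← hΦ.comm_of_form hA hAθ, hΦ.apply_char]
  intro X Y hX hY
  rw [← h _ _ hX hY, ← h _ _ (hΦ.θ_minus hX) (hΦ.θ_minus hY)]
  exact hΦ.metric X Y

/-- The central elements `W` of the isotropy algebra are the multiples of the characteristic element
`Z` by the centroid: `B(⁅W, ·⁆, ⁅Z, ·⁆)` is an invariant symmetric form on the `(-1)`-eigenspace. -/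
lemma exists_centroid_of_central {W : L} (hW : M.θ W = W) (hc : ∀ V, M.θ V = V → ⁅W, V⁆ = 0) :
    ∃ A : L →ₗ[ℝ] L, IsCentroid A ∧ (∀ X, A (M.θ X) = M.θ (A X)) ∧ A M.char = W := by
  have hcomm {U V X : L} (h : ⁅U, V⁆ = 0) : ⁅U, ⁅V, X⁆⁆ = ⁅V, ⁅U, X⁆⁆ := by
    rw [leibniz_lie, h, zero_lie, zero_add]
  have hZW : ⁅M.char, W⁆ = 0 := M.char_lie_plus hW
  obtain ⟨A, hA, hAθ, h⟩ := M.exists_centroid_of_form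
    ((killingForm ℝ L).compl₁₂ (LieAlgebra.ad ℝ L W) (LieAlgebra.ad ℝ L M.char))
    (fun X Y _ _ ↦ by
      simp only [LinearMap.compl₁₂_apply, LieAlgebra.ad_apply]
      rw [killingForm_lie W Y, LieModule.traceForm_comm ℝ L L ⁅W, X⁆, killingForm_lie, hcomm hZW])
    (fun V X Y hV _ _ ↦ by
      simp only [LinearMap.compl₁₂_apply, LieAlgebra.ad_apply]
      rw [hcomm (hc V hV), hcomm (M.char_lie_plus hV), killingForm_lie]; ring)
  refine ⟨-A, by simpa using hA.smul (-1), fun X ↦ by simp [hAθ], ?_⟩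
  have hAX {X : L} (hX : M.θ X = -X) : A X = -⁅M.char, ⁅W, X⁆⁆ := by
    have hWX := M.θ_lie_minus hW hX
    refine M.eq_of_killingForm_eq_minus (by rw [← hAθ, hX, map_neg])
      (by rw [map_neg, M.θ_lie_minus M.θ_char hWX]) fun Y hY ↦ ?_
    rw [← h X Y hX hY, map_neg, LinearMap.neg_apply, killingForm_lie, neg_neg]
    simp
  refine M.eq_of_lie_eq (by simp [← hAθ, M.θ_char]) hW fun X hX ↦ ?_
  rw [LinearMap.neg_apply, neg_lie, ← hA, hAX (M.θ_lie_minus M.θ_char hX), neg_neg, ← hcomm hZW,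
    M.char_lie_char_lie (M.θ_lie_minus hW hX)]

/-- The fixed vectors in the isotropy algebra of a family of automorphisms of `L`. -/
def fixedSpace (𝒮 : Set (L ≃ₗ⁅ℝ⁆ L)) : Submodule ℝ L where
  carrier := {W | M.p W = 0 ∧ ∀ Φ ∈ 𝒮, Φ W = W}
  add_mem' := fun ⟨h1, h2⟩ ⟨h3, h4⟩ ↦
    ⟨by simp [h1, h3], fun Φ hΦ ↦ by rw [map_add, h2 Φ hΦ, h4 Φ hΦ]⟩
  zero_mem' := ⟨by simp, fun Φ _ ↦ by simp⟩
  smul_mem' := fun c _ ⟨h1, h2⟩ ↦ ⟨by simp [h1], fun Φ hΦ ↦ by rw [map_smul, h2 Φ hΦ]⟩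

variable {𝒮 : Set (L ≃ₗ⁅ℝ⁆ L)} (h𝒮 : ∀ Φ ∈ 𝒮, M.IsIsotropy Φ)
include h𝒮

lemma char_mem_fixedSpace : M.char ∈ M.fixedSpace 𝒮 :=
  ⟨M.p_char, fun Φ hΦ ↦ (h𝒮 Φ hΦ).apply_char⟩

/-- If the characteristic element spans the invariant elements of the isotropy algebra, the element
of the centroid that defines the metric is a scalar. -/
theorem exists_killing_of_finrank_eq_one (h : finrank ℝ (M.fixedSpace 𝒮) = 1) :
    ∃ a : ℝ, a ≠ 0 ∧
      ∀ X Y, M.θ X = -X → M.θ Y = -Y → M.γ (M.p X) (M.p Y) = a * killingForm ℝ L X Y := by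
  obtain ⟨A, hA, hAθ, hAZ, hγ⟩ := M.exists_centroid_of_metric
  have hmem : A M.char ∈ M.fixedSpace 𝒮 :=
    ⟨M.p_eq_zero_iff.2 (by rw [← hAθ, M.θ_char]), fun Φ hΦ ↦ hAZ Φ (h𝒮 Φ hΦ)⟩
  obtain ⟨c, hc⟩ := exists_smul_eq_of_finrank_eq_one h
    (x := ⟨M.char, M.char_mem_fixedSpace h𝒮⟩) (by simpa using M.char_ne_zero) ⟨_, hmem⟩
  have hc' : c • M.char = A M.char := congrArg Subtype.val hc
  have hAc : A = c • LinearMap.id :=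
    hA.eq_of_apply_eq (IsCentroid.id_smul c) M.char_ne_zero (by simp [hc'])
  have hγ' (X Y : L) (hX : M.θ X = -X) (hY : M.θ Y = -Y) :
      M.γ (M.p X) (M.p Y) = c * killingForm ℝ L X Y := by
    rw [hγ X Y hX hY, hAc]; simp
  refine ⟨c, ?_, hγ'⟩
  rintro rfl
  obtain ⟨v, hv⟩ := exists_ne (0 : T)
  refine hv (M.nondeg v fun w ↦ ?_)
  rw [← M.p_lift v, ← M.p_lift w, hγ' _ _ (by simp) (by simp), zero_mul]

omit h𝒮 in
/-- A root of a real quadratic polynomial in the centroid that is not a scalar yields a complex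
structure. -/
lemma exists_complexStructure {A : L →ₗ[ℝ] L} (hA : IsCentroid A) {x y : ℝ}
    (hA2 : A (A M.char) = x • M.char + y • A M.char) (hns : ∀ c : ℝ, A M.char ≠ c • M.char) :
    ∃ (i : L →ₗ[ℝ] L) (r s : ℝ), IsComplexStructure i ∧ i = r • A + s • LinearMap.id := by
  have hAA : A ∘ₗ A = x • LinearMap.id + y • A :=
    (hA.comp hA).eq_of_apply_eq ((IsCentroid.id_smul x).add (hA.smul y)) M.char_ne_zero (by simp [hA2])
  have hAX (X : L) : A (A X) = x • X + y • A X := by simpa using LinearMap.congr_fun hAA X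
  have hd : x + y ^ 2 / 4 < 0 := by
    by_contra! hd
    -- otherwise `A` would have a real eigenvalue, hence be a scalar
    set q := Real.sqrt (x + y ^ 2 / 4) with hq
    have hq2 : q ^ 2 = x + y ^ 2 / 4 := Real.sq_sqrt hd
    have h1 : A M.char - (y / 2 + q) • M.char ≠ 0 := sub_ne_zero.2 (hns _)
    refine hns (y / 2 - q) ?_
    have : A = (y / 2 - q) • LinearMap.id := by
      refine hA.eq_of_apply_eq (IsCentroid.id_smul _) h1 ?_
      have e : x = q ^ 2 - y ^ 2 / 4 := by linarith
      simp only [map_sub, map_smul, hAX, LinearMap.smul_apply, LinearMap.id_apply, e]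
      module
    rw [this]; simp
  set q := Real.sqrt (-(x + y ^ 2 / 4)) with hq
  have hq2 : q ^ 2 = -(x + y ^ 2 / 4) := Real.sq_sqrt (by linarith)
  have hq0 : q ≠ 0 := by
    intro h0
    rw [h0] at hq2; norm_num at hq2; linarith
  refine ⟨q⁻¹ • A + (-(y / (2 * q))) • LinearMap.id, q⁻¹, -(y / (2 * q)), ⟨fun X ↦ ?_, fun X Y ↦ ?_⟩,
    rfl⟩
  · have e : x = -q ^ 2 - y ^ 2 / 4 := by linarith
    simp only [LinearMap.add_apply, LinearMap.smul_apply, LinearMap.id_apply, map_add, map_smul,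
      hAX, e]
    match_scalars
    · field_simp; ring
    · field_simp; ring
  · exact (((hA.smul _).add (IsCentroid.id_smul _)) X Y).symm

/-- A second invariant element `W` of the isotropy algebra is `A Z` for an element `A` of the
centroid that is not a scalar; it generates the field of complex numbers. -/
theorem exists_twistedKilling_of_finrank_eq_two (h : finrank ℝ (M.fixedSpace 𝒮) = 2)
    (hc : ∀ W ∈ M.fixedSpace 𝒮, ∀ V, M.p V = 0 → ⁅W, V⁆ = 0) :
    ∃ i : L →ₗ[ℝ] L, IsComplexStructure i ∧ (∀ X, i (M.θ X) = M.θ (i X)) ∧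
      (∀ Φ ∈ 𝒮, ∀ X, i (Φ X) = Φ (i X)) ∧ ∃ a b : ℝ, (a, b) ≠ (0, 0) ∧
      ∀ X Y, M.θ X = -X → M.θ Y = -Y → M.γ (M.p X) (M.p Y) = twistedKilling i a b X Y := by
  have hZ := M.char_mem_fixedSpace h𝒮
  obtain ⟨W, hW, hWns⟩ : ∃ W ∈ M.fixedSpace 𝒮, ∀ c : ℝ, W ≠ c • M.char := by
    by_contra! hcon
    have : finrank ℝ (M.fixedSpace 𝒮) ≤ 1 :=
      finrank_le_one (⟨M.char, hZ⟩ : M.fixedSpace 𝒮) fun W ↦ by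
        obtain ⟨c, hc⟩ := hcon W W.2
        exact ⟨c, Subtype.ext hc.symm⟩
    omega
  have hW0 : M.θ W = W := M.p_eq_zero_iff.1 hW.1
  obtain ⟨A, hA, hAθ, hAZ⟩ := M.exists_centroid_of_central hW0
    fun V hV ↦ hc W hW V (M.p_eq_zero_iff.2 hV)
  have hAΦ (Φ) (hΦ : Φ ∈ 𝒮) (X : L) : A (Φ X) = Φ (A X) :=
    (h𝒮 Φ hΦ).comm_of_apply_char hA (by rw [hAZ]; exact hW.2 Φ hΦ) X
  have hli : LinearIndependent ℝ ![M.char, W] := by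
    rw [LinearIndependent.pair_iff' M.char_ne_zero]
    exact fun c h ↦ hWns c h.symm
  obtain ⟨x, y, hxy⟩ := exists_eq_smul_add_smul_of_finrank_eq_two h hZ hW hli (U := A W)
    ⟨M.p_eq_zero_iff.2 (by rw [← hAθ, hW0]), fun Φ hΦ ↦ by rw [← hAΦ Φ hΦ, hW.2 Φ hΦ]⟩
  obtain ⟨i, r, s, hi, hirs⟩ := M.exists_complexStructure hA (x := x) (y := y)
    (by rw [hAZ]; exact hxy) (by rwa [hAZ])
  have hiθ (X : L) : i (M.θ X) = M.θ (i X) := by simp [hirs, hAθ]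
  have hiΦ (Φ) (hΦ : Φ ∈ 𝒮) (X : L) : i (Φ X) = Φ (i X) := by simp [hirs, hAΦ Φ hΦ]
  refine ⟨i, hi, hiθ, hiΦ, ?_⟩
  have hiZns (c : ℝ) : c • M.char ≠ i M.char := by
    intro h
    have h2 := hi.1 M.char
    rw [← h, map_smul, ← h, smul_smul, ← neg_one_smul ℝ M.char] at h2
    have h3 := smul_left_injective ℝ M.char_ne_zero h2
    nlinarith
  obtain ⟨A', hA', hA'θ, hA'Z, hγ⟩ := M.exists_centroid_of_metric
  obtain ⟨a, b, hab⟩ := exists_eq_smul_add_smul_of_finrank_eq_two h hZ (W := i M.char)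
    ⟨M.p_eq_zero_iff.2 (by rw [← hiθ, M.θ_char]),
      fun Φ hΦ ↦ by rw [← hiΦ Φ hΦ, (h𝒮 Φ hΦ).apply_char]⟩
    ((LinearIndependent.pair_iff' M.char_ne_zero).2 hiZns) (U := A' M.char)
    ⟨M.p_eq_zero_iff.2 (by rw [← hA'θ, M.θ_char]), fun Φ hΦ ↦ hA'Z Φ (h𝒮 Φ hΦ)⟩
  have hA'i : A' = a • LinearMap.id + b • i :=
    hA'.eq_of_apply_eq ((IsCentroid.id_smul a).add (hi.isCentroid.smul b)) M.char_ne_zero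
      (by simp [hab])
  refine ⟨a, b, ?_, fun X Y hX hY ↦ by rw [hγ X Y hX hY, hA'i, twistedKilling_apply]⟩
  rintro h0
  obtain ⟨rfl, rfl⟩ := Prod.mk.inj h0
  obtain ⟨v, hv⟩ := exists_ne (0 : T)
  refine hv (M.nondeg v fun w ↦ ?_)
  rw [← M.p_lift v, ← M.p_lift w, hγ _ _ (by simp) (by simp), hA'i]
  simp

end InfinitesimalModel

end Classification

/-! ### Derivatives and charts on manifolds -/

section TangentCalculus

open Filter Topology

variable {E F F' : Type*} [NormedAddCommGroup E] [NormedSpace ℝ E] [NormedAddCommGroup F]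
  [NormedSpace ℝ F] [NormedAddCommGroup F'] [NormedSpace ℝ F']
  {M : Type*} [TopologicalSpace M] [ChartedSpace E M]
  {N : Type*} [TopologicalSpace N] [ChartedSpace F N]
  {P : Type*} [TopologicalSpace P] [ChartedSpace F' P]

variable (E F) in
/-- The derivative of a map between manifolds, as a map between the model spaces: every tangent
space is, by definition, the model space, through the preferred chart at its base point. -/
def tderiv (f : M → N) (x : M) : E →L[ℝ] F := mfderiv 𝓘(ℝ, E) 𝓘(ℝ, F) f x

lemma _root_.HasMFDerivAt.tderiv_eq {f : M → N} {x : M}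
    {f' : TangentSpace 𝓘(ℝ, E) x →L[ℝ] TangentSpace 𝓘(ℝ, F) (f x)}
    (h : HasMFDerivAt 𝓘(ℝ, E) 𝓘(ℝ, F) f x f') : tderiv E F f x = f' := h.mfderiv

lemma tderiv_comp {g : N → P} {f : M → N} (x : M)
    (hg : MDifferentiableAt 𝓘(ℝ, F) 𝓘(ℝ, F') g (f x))
    (hf : MDifferentiableAt 𝓘(ℝ, E) 𝓘(ℝ, F) f x) :
    tderiv E F' (fun z ↦ g (f z)) x = (tderiv F F' g (f x)).comp (tderiv E F f x) :=
  mfderiv_comp x hg hf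

lemma tderiv_comp_apply {g : N → P} {f : M → N} (x : M)
    (hg : MDifferentiableAt 𝓘(ℝ, F) 𝓘(ℝ, F') g (f x))
    (hf : MDifferentiableAt 𝓘(ℝ, E) 𝓘(ℝ, F) f x) (v : E) :
    tderiv E F' (fun z ↦ g (f z)) x v = tderiv F F' g (f x) (tderiv E F f x v) := by
  rw [tderiv_comp x hg hf]; rfl

lemma _root_.Filter.EventuallyEq.tderiv_eq {f g : M → N} {x : M} (h : f =ᶠ[𝓝 x] g) :
    tderiv E F f x = tderiv E F g x := h.mfderiv_eq

lemma tderiv_id (x : M) : tderiv E E (fun z : M ↦ z) x = ContinuousLinearMap.id ℝ E := mfderiv_id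

lemma tderiv_const (y : N) (x : M) : tderiv E F (fun _ : M ↦ y) x = 0 := mfderiv_const

lemma tderiv_eq_fderiv {f : E → F} {x : E} : tderiv E F f x = fderiv ℝ f x := mfderiv_eq_fderiv

lemma _root_.ContMDiffAt.mdiff {f : M → N} {x : M} (h : ContMDiffAt 𝓘(ℝ, E) 𝓘(ℝ, F) ∞ f x) :
    MDifferentiableAt 𝓘(ℝ, E) 𝓘(ℝ, F) f x := h.mdifferentiableAt (by simp)

lemma _root_.ContMDiff.mdiff {f : M → N} (h : ContMDiff 𝓘(ℝ, E) 𝓘(ℝ, F) ∞ f) (x : M) :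
    MDifferentiableAt 𝓘(ℝ, E) 𝓘(ℝ, F) f x := (h x).mdiff

/-- If `g ∘ f` is the identity near `x`, the derivatives are inverse to each other. -/
lemma tderiv_leftInverse {f : M → N} {g : N → M} {x : M}
    (hg : MDifferentiableAt 𝓘(ℝ, F) 𝓘(ℝ, E) g (f x))
    (hf : MDifferentiableAt 𝓘(ℝ, E) 𝓘(ℝ, F) f x) (h : ∀ᶠ z in 𝓝 x, g (f z) = z) (v : E) :
    tderiv F E g (f x) (tderiv E F f x v) = v := by
  have e : (fun z ↦ g (f z)) =ᶠ[𝓝 x] fun z ↦ z := h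
  rw [← tderiv_comp_apply x hg hf, e.tderiv_eq, tderiv_id]; rfl

variable (E) in
/-- The preferred chart at `x`, as a map to the model space. -/
def chartMap (x : M) : M → E := extChartAt 𝓘(ℝ, E) x

variable (E) in
/-- The inverse of the preferred chart at `x`. -/
def chartInv (x : M) : E → M := (extChartAt 𝓘(ℝ, E) x).symm

variable (E) in
/-- The domain of the preferred chart at `x`. -/
def chartDom (x : M) : Set M := (extChartAt 𝓘(ℝ, E) x).source

variable (E) in
/-- The range of the preferred chart at `x`. -/
def chartRan (x : M) : Set E := (extChartAt 𝓘(ℝ, E) x).target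

lemma isOpen_chartDom (x : M) : IsOpen (chartDom E x) := isOpen_extChartAt_source x

lemma isOpen_chartRan (x : M) : IsOpen (chartRan E x) := isOpen_extChartAt_target x

lemma mem_chartDom (x : M) : x ∈ chartDom E x := mem_extChartAt_source x

lemma chartMap_mem {x y : M} (hy : y ∈ chartDom E x) : chartMap E x y ∈ chartRan E x :=
  (extChartAt 𝓘(ℝ, E) x).map_source hy

lemma chartInv_mem {x : M} {y : E} (hy : y ∈ chartRan E x) : chartInv E x y ∈ chartDom E x :=
  (extChartAt 𝓘(ℝ, E) x).map_target hy

lemma chartInv_chartMap {x y : M} (hy : y ∈ chartDom E x) : chartInv E x (chartMap E x y) = y :=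
  (extChartAt 𝓘(ℝ, E) x).left_inv hy

lemma chartMap_chartInv {x : M} {y : E} (hy : y ∈ chartRan E x) :
    chartMap E x (chartInv E x y) = y :=
  (extChartAt 𝓘(ℝ, E) x).right_inv hy

lemma chartMap_self_mem (x : M) : chartMap E x x ∈ chartRan E x := chartMap_mem (mem_chartDom x)

lemma chartInv_chartMap_self (x : M) : chartInv E x (chartMap E x x) = x :=
  chartInv_chartMap (mem_chartDom x)

variable [IsManifold 𝓘(ℝ, E) ∞ M]

lemma contMDiffAt_chartMap {x y : M} (hy : y ∈ chartDom E x) :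
    ContMDiffAt 𝓘(ℝ, E) 𝓘(ℝ, E) ∞ (chartMap E x) y :=
  contMDiffAt_extChartAt' (by rwa [← extChartAt_source 𝓘(ℝ, E)])

lemma contMDiffAt_chartInv {x : M} {y : E} (hy : y ∈ chartRan E x) :
    ContMDiffAt 𝓘(ℝ, E) 𝓘(ℝ, E) ∞ (chartInv E x) y :=
  (contMDiffOn_extChartAt_symm x).contMDiffAt ((isOpen_extChartAt_target x).mem_nhds hy)

lemma tderiv_chartMap_self (x : M) : tderiv E E (chartMap E x) x = ContinuousLinearMap.id ℝ E :=
  haveI : IsManifold 𝓘(ℝ, E) 1 M := .of_le (n := ∞) (by simp)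
  mfderiv_extChartAt_self

lemma tderiv_chartInv_tderiv_chartMap {x y : M} (hy : y ∈ chartDom E x) (v : E) :
    tderiv E E (chartInv E x) (chartMap E x y) (tderiv E E (chartMap E x) y v) = v :=
  tderiv_leftInverse (contMDiffAt_chartInv (chartMap_mem hy)).mdiff (contMDiffAt_chartMap hy).mdiff
    (by filter_upwards [(isOpen_chartDom x).mem_nhds hy] with z hz using chartInv_chartMap hz) v

lemma tderiv_chartMap_tderiv_chartInv {x : M} {y : E} (hy : y ∈ chartRan E x) (v : E) :
    tderiv E E (chartMap E x) (chartInv E x y) (tderiv E E (chartInv E x) y v) = v :=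
  tderiv_leftInverse (contMDiffAt_chartMap (chartInv_mem hy)).mdiff (contMDiffAt_chartInv hy).mdiff
    (by filter_upwards [(isOpen_chartRan x).mem_nhds hy] with z hz using chartMap_chartInv hz) v

lemma tderiv_chartInv_self (x : M) :
    tderiv E E (chartInv E x) (chartMap E x x) = ContinuousLinearMap.id ℝ E := by
  ext v
  have := tderiv_chartInv_tderiv_chartMap (mem_chartDom x) v
  rwa [tderiv_chartMap_self] at this

lemma continuousAt_chartInv {x : M} {y : E} (hy : y ∈ chartRan E x) :
    ContinuousAt (chartInv E x) y := (contMDiffAt_chartInv hy).continuousAt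

lemma continuousAt_chartMap {x y : M} (hy : y ∈ chartDom E x) :
    ContinuousAt (chartMap E x) y := (contMDiffAt_chartMap hy).continuousAt

end TangentCalculus

/-! ### The adjoint representation and the Lie bracket -/

section LieGroup

open Filter Topology

/-- The model space of a `d`-dimensional manifold. -/
abbrev Eu (d : ℕ) : Type := EuclideanSpace ℝ (Fin d)

variable {m : ℕ} {G : Type*} [TopologicalSpace G] [ChartedSpace (EuclideanSpace ℝ (Fin m)) G]
  [Group G] [LieGroup (𝓡 m) ∞ G]

variable (m G) in
/-- `LieGroup` provides this for `𝓡 m`; instance search does not identify `𝓡 m` with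
`𝓘(ℝ, Eu m)`. -/
lemma isManifold_group : IsManifold 𝓘(ℝ, Eu m) ∞ G := inferInstanceAs (IsManifold (𝓡 m) ∞ G)

attribute [local instance] isManifold_group

lemma contMDiff_mulLeft (a : G) : ContMDiff 𝓘(ℝ, Eu m) 𝓘(ℝ, Eu m) ∞ (fun b : G ↦ a * b) :=
  contMDiff_mul_left

lemma contMDiff_mulRight (a : G) : ContMDiff 𝓘(ℝ, Eu m) 𝓘(ℝ, Eu m) ∞ (fun b : G ↦ b * a) :=
  contMDiff_mul_right

lemma contMDiff_conj (a : G) : ContMDiff 𝓘(ℝ, Eu m) 𝓘(ℝ, Eu m) ∞ (fun b : G ↦ a * b * a⁻¹) :=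
  (contMDiff_mulRight a⁻¹).comp (contMDiff_mulLeft a)

variable (m) in
/-- The adjoint representation. -/
def Ad (a : G) : Eu m →L[ℝ] Eu m := tderiv (Eu m) (Eu m) (fun b : G ↦ a * b * a⁻¹) 1

variable (m G) in
/-- The multiplication of `G` in the preferred chart at `1`. -/
def chartMul (q : Eu m × Eu m) : Eu m :=
  chartMap (Eu m) (1 : G) (chartInv (Eu m) (1 : G) q.1 * chartInv (Eu m) (1 : G) q.2)

variable (m G) in
/-- The coordinates of the identity. -/
def chartOne : Eu m := chartMap (Eu m) (1 : G) 1

lemma chartInv_chartOne : chartInv (Eu m) (1 : G) (chartOne m G) = 1 := chartInv_chartMap_self 1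

lemma chartOne_mem : chartOne m G ∈ chartRan (Eu m) (1 : G) := chartMap_self_mem 1

lemma tderiv_chartInv_chartOne : tderiv (Eu m) (Eu m) (chartInv (Eu m) (1 : G)) (chartOne m G) =
    ContinuousLinearMap.id ℝ (Eu m) := tderiv_chartInv_self 1

lemma contDiffAt_chartMul {y z : Eu m} (hy : y ∈ chartRan (Eu m) (1 : G))
    (hz : z ∈ chartRan (Eu m) (1 : G))
    (h : chartInv (Eu m) (1 : G) y * chartInv (Eu m) (1 : G) z ∈ chartDom (Eu m) (1 : G)) :
    ContDiffAt ℝ ∞ (chartMul m G) (y, z) := by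
  rw [← contMDiffAt_iff_contDiffAt]
  have f1 : ContMDiffAt 𝓘(ℝ, Eu m × Eu m) 𝓘(ℝ, Eu m) ∞ Prod.fst (y, z) :=
    contDiffAt_fst.contMDiffAt
  have f2 : ContMDiffAt 𝓘(ℝ, Eu m × Eu m) 𝓘(ℝ, Eu m) ∞ Prod.snd (y, z) :=
    contDiffAt_snd.contMDiffAt
  have h1 := (ContMDiffAt.comp (y, z) (f := Prod.fst) (contMDiffAt_chartInv hy) f1).mul
    (ContMDiffAt.comp (y, z) (f := Prod.snd) (contMDiffAt_chartInv hz) f2)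
  exact ContMDiffAt.comp (y, z) (contMDiffAt_chartMap h) h1

lemma contDiffAt_chartMul_one : ContDiffAt ℝ ∞ (chartMul m G) (chartOne m G, chartOne m G) :=
  contDiffAt_chartMul chartOne_mem chartOne_mem
    (by rw [chartInv_chartOne, mul_one]; exact mem_chartDom 1)

lemma fderiv_chartMul_right {y : Eu m} (hy : y ∈ chartRan (Eu m) (1 : G)) (v : Eu m) :
    fderiv ℝ (chartMul m G) (y, chartOne m G) (0, v) =
      tderiv (Eu m) (Eu m) (chartMap (Eu m) (1 : G)) (chartInv (Eu m) (1 : G) y)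
        (tderiv (Eu m) (Eu m) (fun b ↦ chartInv (Eu m) (1 : G) y * b) (1 : G) v) := by
  have hd : DifferentiableAt ℝ (chartMul m G) (y, chartOne m G) :=
    (contDiffAt_chartMul hy chartOne_mem
      (by rw [chartInv_chartOne, mul_one]; exact chartInv_mem hy)).differentiableAt (by simp)
  have h1 : HasFDerivAt (fun z : Eu m ↦ (y, z)) (ContinuousLinearMap.inr ℝ (Eu m) (Eu m))
      (chartOne m G) := hasFDerivAt_prodMk_right y _
  have h2 := (hd.hasFDerivAt.comp (chartOne m G) h1).fderiv
  have h3 : fderiv ℝ (chartMul m G) (y, chartOne m G) (0, v) =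
      fderiv ℝ (fun z ↦ chartMap (Eu m) (1 : G) (chartInv (Eu m) (1 : G) y *
        chartInv (Eu m) (1 : G) z)) (chartOne m G) v := by
    change _ = fderiv ℝ (chartMul m G ∘ fun z : Eu m ↦ (y, z)) (chartOne m G) v
    rw [h2]; simp
  rw [h3, ← tderiv_eq_fderiv]
  have hI := (contMDiffAt_chartInv (chartOne_mem (G := G) (m := m))).mdiff
  have hM : MDifferentiableAt 𝓘(ℝ, Eu m) 𝓘(ℝ, Eu m) (chartMap (Eu m) (1 : G))
      (chartInv (Eu m) (1 : G) y * chartInv (Eu m) (1 : G) (chartOne m G)) :=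
    (contMDiffAt_chartMap (by rw [chartInv_chartOne, mul_one]; exact chartInv_mem hy)).mdiff
  have hL := (contMDiff_mulLeft (m := m) (chartInv (Eu m) (1 : G) y)).mdiff
  rw [tderiv_comp_apply (g := chartMap (Eu m) (1 : G))
      (f := fun z ↦ chartInv (Eu m) (1 : G) y * chartInv (Eu m) (1 : G) z) (chartOne m G) hM
      ((hL _).comp _ hI),
    tderiv_comp_apply (f := chartInv (Eu m) (1 : G)) (g := fun b ↦ chartInv (Eu m) (1 : G) y * b)
      (chartOne m G) (hL _) hI,
    tderiv_chartInv_chartOne, chartInv_chartOne, mul_one]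
  rfl

lemma fderiv_chartMul_left {y : Eu m} (hy : y ∈ chartRan (Eu m) (1 : G)) (v : Eu m) :
    fderiv ℝ (chartMul m G) (chartOne m G, y) (v, 0) =
      tderiv (Eu m) (Eu m) (chartMap (Eu m) (1 : G)) (chartInv (Eu m) (1 : G) y)
        (tderiv (Eu m) (Eu m) (fun b ↦ b * chartInv (Eu m) (1 : G) y) (1 : G) v) := by
  have hd : DifferentiableAt ℝ (chartMul m G) (chartOne m G, y) :=
    (contDiffAt_chartMul chartOne_mem hy
      (by rw [chartInv_chartOne, one_mul]; exact chartInv_mem hy)).differentiableAt (by simp)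
  have h1 : HasFDerivAt (fun z : Eu m ↦ (z, y)) (ContinuousLinearMap.inl ℝ (Eu m) (Eu m))
      (chartOne m G) := hasFDerivAt_prodMk_left _ y
  have h2 := (hd.hasFDerivAt.comp (chartOne m G) h1).fderiv
  have h3 : fderiv ℝ (chartMul m G) (chartOne m G, y) (v, 0) =
      fderiv ℝ (fun z ↦ chartMap (Eu m) (1 : G) (chartInv (Eu m) (1 : G) z *
        chartInv (Eu m) (1 : G) y)) (chartOne m G) v := by
    change _ = fderiv ℝ (chartMul m G ∘ fun z : Eu m ↦ (z, y)) (chartOne m G) v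
    rw [h2]; simp
  rw [h3, ← tderiv_eq_fderiv]
  have hI := (contMDiffAt_chartInv (chartOne_mem (G := G) (m := m))).mdiff
  have hM : MDifferentiableAt 𝓘(ℝ, Eu m) 𝓘(ℝ, Eu m) (chartMap (Eu m) (1 : G))
      (chartInv (Eu m) (1 : G) (chartOne m G) * chartInv (Eu m) (1 : G) y) :=
    (contMDiffAt_chartMap (by rw [chartInv_chartOne, one_mul]; exact chartInv_mem hy)).mdiff
  have hL := (contMDiff_mulRight (m := m) (chartInv (Eu m) (1 : G) y)).mdiff
  rw [tderiv_comp_apply (g := chartMap (Eu m) (1 : G))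
      (f := fun z ↦ chartInv (Eu m) (1 : G) z * chartInv (Eu m) (1 : G) y) (chartOne m G) hM
      ((hL _).comp _ hI),
    tderiv_comp_apply (f := chartInv (Eu m) (1 : G)) (g := fun b ↦ b * chartInv (Eu m) (1 : G) y)
      (chartOne m G) (hL _) hI,
    tderiv_chartInv_chartOne, chartInv_chartOne, one_mul]
  rfl

open VectorField in
variable (G) in
/-- The left-invariant vector field of `X` in the preferred chart at `1`. -/
def chartField (X : GroupLieAlgebra (𝓡 m) G) (y : Eu m) : Eu m :=
  mpullbackWithin 𝓘(ℝ, Eu m) (𝓡 m) (extChartAt (𝓡 m) (1 : G)).symm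
    (mulInvariantVectorField X) (Set.range (𝓡 m)) y

lemma chartField_eq (X : GroupLieAlgebra (𝓡 m) G) {y : Eu m} (hy : y ∈ chartRan (Eu m) (1 : G)) :
    chartField G X y = fderiv ℝ (chartMul m G) (y, chartOne m G) (0, X) := by
  have hman : IsManifold (𝓡 m) 1 G := .of_le (n := ∞) (by simp)
  have h := ContinuousLinearMap.inverse_eq
    (mfderivWithin_extChartAt_symm_comp_mfderiv_extChartAt hy)
    (mfderiv_extChartAt_comp_mfderivWithin_extChartAt_symm hy)
  refine Eq.trans ?_ (fderiv_chartMul_right hy X).symm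
  exact congrFun (congrArg DFunLike.coe h) _

open VectorField in
/-- The Lie bracket in terms of the second derivative of the multiplication. -/
lemma lie_eq_chartMul (W X : GroupLieAlgebra (𝓡 m) G) :
    ⁅W, X⁆ = (fderiv ℝ (fun y ↦ fderiv ℝ (chartMul m G) (y, chartOne m G) (0, X))
        (chartOne m G) W : Eu m)
      - fderiv ℝ (fun y ↦ fderiv ℝ (chartMul m G) (y, chartOne m G) (0, W)) (chartOne m G) X := by
  have hman : IsManifold (𝓡 m) 1 G := .of_le (n := ∞) (by simp)
  have key (X : GroupLieAlgebra (𝓡 m) G) : chartField G X =ᶠ[𝓝 (chartOne m G)]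
      fun y ↦ fderiv ℝ (chartMul m G) (y, chartOne m G) (0, X) := by
    filter_upwards [(isOpen_chartRan (1 : G)).mem_nhds (chartOne_mem (m := m))] with y hy
    exact chartField_eq X hy
  have h1 : ⁅W, X⁆ = lieBracketWithin ℝ (chartField G W) (chartField G X)
      ((extChartAt (𝓡 m) (1 : G)).symm ⁻¹' Set.univ ∩ Set.range (𝓡 m)) (chartOne m G) := by
    rw [GroupLieAlgebra.bracket_def, ← mlieBracketWithin_univ, mlieBracketWithin_apply,
      mfderiv_extChartAt_self]
    exact congrFun (congrArg DFunLike.coe (ContinuousLinearMap.inverse_id (R := ℝ) (M := Eu m))) _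
  have e0 : (extChartAt (𝓡 m) (1 : G)).symm ⁻¹' Set.univ ∩ Set.range (𝓡 m) = Set.univ := by simp
  refine h1.trans ?_
  rw [e0, lieBracketWithin_univ, (key W).lieBracket_vectorField_eq (key X), lieBracket_eq]
  have e1 (X : Eu m) : fderiv ℝ (chartMul m G) (chartOne m G, chartOne m G) (0, X) = X := by
    rw [fderiv_chartMul_right chartOne_mem, chartInv_chartOne, tderiv_chartMap_self]
    have : (fun b : G ↦ 1 * b) = fun b ↦ b := by ext; simp
    rw [this, tderiv_id]; rfl
  exact congrArg₂ (· - ·) (congrArg _ (e1 W)) (congrArg _ (e1 X))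

/-- `a b = (a b a⁻¹) a`, differentiated at `b = 1`. -/
lemma mul_eq_Ad_mul (a : G) (v : Eu m) :
    tderiv (Eu m) (Eu m) (fun b ↦ a * b) (1 : G) v =
      tderiv (Eu m) (Eu m) (fun b ↦ b * a) (1 : G) (Ad m a v) := by
  have h : (fun b : G ↦ a * b) = fun b ↦ (a * b * a⁻¹) * a := by ext; group
  rw [h, tderiv_comp_apply (g := fun b : G ↦ b * a) (1 : G) ((contMDiff_mulRight a).mdiff _)
    ((contMDiff_conj a).mdiff _)]
  simp [Ad]

lemma Ad_one : Ad m (1 : G) = ContinuousLinearMap.id ℝ (Eu m) := by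
  have : (fun b : G ↦ 1 * b * 1⁻¹) = fun b ↦ b := by ext; simp
  rw [Ad, this, tderiv_id]

/-- The derivative of `Ad` in coordinates: differentiate `D₁μ(e, y) (Ad y X) = D₂μ(y, e) X`, where `D₁`
and `D₂` are the partial derivatives of the multiplication `μ` with unit `e`. The differentiability of
`α` is part of the conclusion, as `D₁μ(e, y)` is invertible near `e`. -/
lemma hasDerivAt_of_fderiv_mul_eq {E : Type*} [NormedAddCommGroup E] [NormedSpace ℝ E]
    [CompleteSpace E] {μ : E × E → E} {e W X : E} (hμ : ContDiffAt ℝ 2 μ (e, e))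
    (h1 : ∀ v, fderiv ℝ μ (e, e) (v, 0) = v) {y α : ℝ → E} (hy0 : y 0 = e)
    (hy : HasDerivAt y W 0) (hα0 : α 0 = X)
    (hα : ∀ᶠ t in 𝓝 (0 : ℝ), fderiv ℝ μ (e, y t) (α t, 0) = fderiv ℝ μ (y t, e) (0, X)) :
    HasDerivAt α (fderiv ℝ (fun z ↦ fderiv ℝ μ (z, e) (0, X)) e W
      - fderiv ℝ (fun z ↦ fderiv ℝ μ (z, e) (0, W)) e X) 0 := by
  have hD : DifferentiableAt ℝ (fderiv ℝ μ) (e, e) :=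
    (hμ.fderiv_right (m := 1) (by norm_num)).differentiableAt (by simp)
  set B := fderiv ℝ (fderiv ℝ μ) (e, e) with hB
  have hDl : HasFDerivAt (fun z : E ↦ fderiv ℝ μ (z, e))
      (B.comp (ContinuousLinearMap.inl ℝ E E)) e :=
    HasFDerivAt.comp (f := fun z : E ↦ (z, e)) e hD.hasFDerivAt (hasFDerivAt_prodMk_left e e)
  have hDr : HasFDerivAt (fun z : E ↦ fderiv ℝ μ (e, z))
      (B.comp (ContinuousLinearMap.inr ℝ E E)) e :=
    HasFDerivAt.comp (f := fun z : E ↦ (e, z)) e hD.hasFDerivAt (hasFDerivAt_prodMk_right e e)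
  have hV (X W : E) : fderiv ℝ (fun z ↦ fderiv ℝ μ (z, e) (0, X)) e W = B (W, 0) (0, X) := by
    have := (hDl.clm_apply (hasFDerivAt_const ((0 : E), X) e)).fderiv
    rw [this]; simp
  have hsymm : IsSymmSndFDerivAt ℝ μ (e, e) := hμ.isSymmSndFDerivAt (by simp)
  have hDly : HasDerivAt (fun t ↦ fderiv ℝ μ (y t, e)) (B (W, 0)) 0 := by
    rw [← hy0] at hDl
    have := HasFDerivAt.comp_hasDerivAt (0 : ℝ) (f := y) hDl hy
    simpa [Function.comp_def, hy0] using this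
  have hDry : HasDerivAt (fun t ↦ fderiv ℝ μ (e, y t)) (B (0, W)) 0 := by
    rw [← hy0] at hDr
    have := HasFDerivAt.comp_hasDerivAt (0 : ℝ) (f := y) hDr hy
    simpa [Function.comp_def, hy0] using this
  have hVd : HasDerivAt (fun t ↦ fderiv ℝ μ (y t, e) (0, X)) (B (W, 0) (0, X)) 0 := by
    simpa using hDly.clm_apply (hasDerivAt_const 0 ((0 : E), X))
  let Q : ℝ → E →L[ℝ] E := fun t ↦ (fderiv ℝ μ (e, y t)).comp (ContinuousLinearMap.inl ℝ E E)
  have hQd : HasDerivAt Q ((B (0, W)).comp (ContinuousLinearMap.inl ℝ E E)) 0 := by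
    simpa using hDry.clm_comp (hasDerivAt_const 0 (ContinuousLinearMap.inl ℝ E E))
  have hQ0 : Q 0 = ((ContinuousLinearEquiv.refl ℝ E : E ≃L[ℝ] E) : E →L[ℝ] E) := by
    ext v; simp [Q, hy0, h1]
  have hev : ∀ᶠ t in 𝓝 (0 : ℝ), Q t (α t) = fderiv ℝ μ (y t, e) (0, X) := hα
  have hinv : ∀ᶠ t in 𝓝 (0 : ℝ), ∃ A : E ≃L[ℝ] E, (A : E →L[ℝ] E) = Q t := by
    have h2 : ∀ᶠ A in 𝓝 (Q 0), ∃ A' : E ≃L[ℝ] E, (A' : E →L[ℝ] E) = A := by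
      rw [hQ0]; exact ContinuousLinearEquiv.nhds _
    exact hQd.continuousAt.eventually h2
  have hαd : DifferentiableAt ℝ α 0 := by
    have h2 : DifferentiableAt ℝ
        (fun t ↦ (Q t).inverse (fderiv ℝ μ (y t, e) (0, X))) 0 := by
      have h3 : DifferentiableAt ℝ ContinuousLinearMap.inverse (Q 0) := by
        rw [hQ0]
        exact (contDiffAt_map_inverse (n := 1) _).differentiableAt (by simp)
      exact (h3.comp (0 : ℝ) hQd.differentiableAt).clm_apply hVd.differentiableAt
    refine h2.congr_of_eventuallyEq ?_
    filter_upwards [hev, hinv] with t h3 h4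
    obtain ⟨A, hA⟩ := h4
    rw [← h3, ← hA, ContinuousLinearMap.inverse_equiv]
    simp
  have h2 := (hQd.clm_apply hαd.hasDerivAt).unique (hVd.congr_of_eventuallyEq hev)
  have h3 : deriv α 0 = B (W, 0) (0, X) - B (X, 0) (0, W) := by
    rw [hQ0, hα0] at h2
    have h4 := hsymm.eq (0, W) (X, 0)
    rw [← hB] at h4
    simp only [ContinuousLinearMap.comp_apply, ContinuousLinearMap.inl_apply] at h2
    rw [← h2, ← h4]
    simp
  rw [hV, hV, ← h3]
  exact hαd.hasDerivAt

/-- The derivative of the adjoint representation is the Lie bracket. -/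
lemma hasDerivAt_Ad {c : ℝ → G} (h0 : c 0 = 1) (hc : MDifferentiableAt 𝓘(ℝ, ℝ) 𝓘(ℝ, Eu m) c 0)
    (W X : GroupLieAlgebra (𝓡 m) G) (hW : tderiv ℝ (Eu m) c 0 1 = W) :
    HasDerivAt (fun t ↦ Ad m (c t) X) (⁅W, X⁆ : GroupLieAlgebra (𝓡 m) G) 0 := by
  have hφ : MDifferentiableAt 𝓘(ℝ, Eu m) 𝓘(ℝ, Eu m) (chartMap (Eu m) (1 : G)) (c 0) := by
    rw [h0]; exact (contMDiffAt_chartMap (mem_chartDom 1)).mdiff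
  have hyd : HasDerivAt (fun t ↦ chartMap (Eu m) (1 : G) (c t)) W 0 := by
    have h1 : DifferentiableAt ℝ (fun t ↦ chartMap (Eu m) (1 : G) (c t)) 0 :=
      mdifferentiableAt_iff_differentiableAt.1 (hφ.comp 0 hc)
    have h2 : deriv (fun t ↦ chartMap (Eu m) (1 : G) (c t)) 0 = W := by
      rw [← fderiv_apply_one_eq_deriv, ← tderiv_eq_fderiv, tderiv_comp_apply 0 hφ hc, hW, h0,
        tderiv_chartMap_self]
      rfl
    rw [← h2]; exact h1.hasDerivAt
  rw [lie_eq_chartMul]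
  refine hasDerivAt_of_fderiv_mul_eq (contDiffAt_chartMul_one.of_le ENat.LEInfty.out) (fun v ↦ ?_)
    (by rw [h0]; rfl) hyd (by rw [h0, Ad_one]; rfl) ?_
  · rw [fderiv_chartMul_left chartOne_mem, chartInv_chartOne, tderiv_chartMap_self]
    have : (fun b : G ↦ b * 1) = fun b ↦ b := by ext; simp
    rw [this, tderiv_id]; rfl
  · have h1 : chartDom (Eu m) (1 : G) ∈ 𝓝 (c 0) := by
      rw [h0]; exact (isOpen_chartDom 1).mem_nhds (mem_chartDom 1)
    have hdom : ∀ᶠ t in 𝓝 (0 : ℝ), c t ∈ chartDom (Eu m) (1 : G) :=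
      hc.continuousAt.eventually_mem h1
    filter_upwards [hdom] with t ht
    refine Eq.trans ?_ (fderiv_chartMul_right (chartMap_mem ht) X).symm
    rw [fderiv_chartMul_left (chartMap_mem ht), chartInv_chartMap ht]
    exact congrArg _ (mul_eq_Ad_mul (c t) X).symm

end LieGroup

/-! ### One-parameter groups -/

section Exponential

open Filter Topology

attribute [local instance] isManifold_group

variable {m : ℕ} {G : Type*} [TopologicalSpace G] [ChartedSpace (EuclideanSpace ℝ (Fin m)) G]
  [Group G] [LieGroup (𝓡 m) ∞ G]

variable (m) in
/-- The left-invariant vector field of an element of the Lie algebra. -/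
def leftField (a : G) : Eu m →L[ℝ] Eu m := tderiv (Eu m) (Eu m) (fun b : G ↦ a * b) 1

lemma tderiv_mulLeft_leftField (a b : G) (X : Eu m) :
    tderiv (Eu m) (Eu m) (fun z ↦ a * z) b (leftField m b X) = leftField m (a * b) X := by
  have h := tderiv_comp_apply (g := fun z : G ↦ a * z) (f := fun z : G ↦ b * z) (1 : G)
    ((contMDiff_mulLeft (m := m) a).mdiff _) ((contMDiff_mulLeft b).mdiff _) X
  simp only [mul_one] at h
  rw [leftField, ← h, leftField]
  simp only [mul_assoc]

lemma tderiv_hom_leftField {Φ : G →* G} (hΦ : ContMDiff 𝓘(ℝ, Eu m) 𝓘(ℝ, Eu m) ∞ Φ) (a : G)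
    (X : Eu m) : tderiv (Eu m) (Eu m) Φ a (leftField m a X) =
      leftField m (Φ a) (tderiv (Eu m) (Eu m) Φ 1 X) := by
  have h1 := tderiv_comp_apply (g := Φ) (f := fun z : G ↦ a * z) (1 : G)
    (hΦ.mdiff _) ((contMDiff_mulLeft (m := m) a).mdiff _) X
  have h2 := tderiv_comp_apply (g := fun z : G ↦ Φ a * z) (f := Φ) (1 : G)
    ((contMDiff_mulLeft (m := m) (Φ a)).mdiff _) (hΦ.mdiff _) X
  simp only [map_mul] at h1
  rw [h1] at h2
  simpa [leftField] using h2

/-- A curve is integral for a left-invariant vector field iff it has the right derivative. -/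
lemma isMIntegralCurve_iff {X : GroupLieAlgebra (𝓡 m) G} {c : ℝ → G} :
    IsMIntegralCurve c (mulInvariantVectorField (I := 𝓡 m) X) ↔
      ∀ t, MDifferentiableAt 𝓘(ℝ, ℝ) 𝓘(ℝ, Eu m) c t ∧
        tderiv ℝ (Eu m) c t 1 = leftField m (c t) X := by
  constructor
  · intro h t
    refine ⟨(h t).mdifferentiableAt, ?_⟩
    have h1 := (h t).tderiv_eq
    refine (congrFun (congrArg DFunLike.coe h1) (1 : ℝ)).trans ?_
    exact one_smul ℝ (leftField m (c t) X)
  · intro h t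
    refine (h t).1.hasMFDerivAt.congr_mfderiv ?_
    ext1
    refine (h t).2.trans ?_
    exact (one_smul ℝ (leftField m (c t) X)).symm

/-- A smooth endomorphism maps one-parameter groups to one-parameter groups. -/
lemma integralCurve_hom {X : GroupLieAlgebra (𝓡 m) G} {c : ℝ → G}
    (hc : IsMIntegralCurve c (mulInvariantVectorField (I := 𝓡 m) X)) {Φ : G →* G}
    (hΦ : ContMDiff 𝓘(ℝ, Eu m) 𝓘(ℝ, Eu m) ∞ Φ) :
    IsMIntegralCurve (fun t ↦ Φ (c t)) (mulInvariantVectorField (I := 𝓡 m)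
      (lieMap (m := m) Φ X)) := by
  have hc := isMIntegralCurve_iff.1 hc
  refine isMIntegralCurve_iff.2 fun t ↦ ⟨(hΦ.mdiff _).comp t (hc t).1, ?_⟩
  rw [tderiv_comp_apply t (hΦ.mdiff _) (hc t).1, (hc t).2]
  exact tderiv_hom_leftField hΦ _ _

lemma contMDiff_one_mulInvariantVectorField (X : GroupLieAlgebra (𝓡 m) G) :
    ContMDiff (𝓡 m) (𝓡 m).tangent 1
      (fun a ↦ (⟨a, mulInvariantVectorField X a⟩ : TangentBundle (𝓡 m) G)) :=
  (contMDiff_mulInvariantVectorField X).of_le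
    (by rw [minSmoothness_of_isRCLikeNormedField]; exact one_le_two)

lemma integralCurve_eq [T2Space G] {X : GroupLieAlgebra (𝓡 m) G} {c c' : ℝ → G}
    (hc : IsMIntegralCurve c (mulInvariantVectorField (I := 𝓡 m) X))
    (hc' : IsMIntegralCurve c' (mulInvariantVectorField (I := 𝓡 m) X)) (h : c 0 = c' 0) :
    c = c' :=
  haveI : IsManifold (𝓡 m) 1 G := .of_le (n := ∞) (by simp)
  isMIntegralCurve_Ioo_eq_of_contMDiff_boundaryless (contMDiff_one_mulInvariantVectorField X)
    hc hc' h

/-- The one-parameter group of an element of the Lie algebra. -/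
lemma exists_exp [T2Space G] (X : GroupLieAlgebra (𝓡 m) G) :
    ∃ c : ℝ → G, c 0 = 1 ∧ IsMIntegralCurve c (mulInvariantVectorField (I := 𝓡 m) X) := by
  have hman : IsManifold (𝓡 m) 1 G := .of_le (n := ∞) (by simp)
  have hX := contMDiff_one_mulInvariantVectorField X
  obtain ⟨c, hc0, hc⟩ := exists_isMIntegralCurveAt_of_contMDiffAt_boundaryless (I := 𝓡 m) 0
    (hX (1 : G))
  rw [isMIntegralCurveAt_iff'] at hc
  obtain ⟨ε, hε, hc⟩ := hc
  rw [Real.ball_eq_Ioo, zero_sub, zero_add] at hc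
  refine exists_isMIntegralCurve_of_isMIntegralCurveOn hX hε (fun a ↦ ⟨fun t ↦ a * c t, ?_, ?_⟩) 1
  · change a * c 0 = a
    rw [hc0, mul_one]
  · intro t ht
    have h1 : HasMFDerivAt 𝓘(ℝ, ℝ) (𝓡 m) c t
        ((1 : ℝ →L[ℝ] ℝ).smulRight (mulInvariantVectorField X (c t))) :=
      (hc t ht).hasMFDerivAt (isOpen_Ioo.mem_nhds ht)
    have h2 : MDifferentiableAt 𝓘(ℝ, ℝ) 𝓘(ℝ, Eu m) (fun t ↦ a * c t) t :=
      ((contMDiff_mulLeft (m := m) a).mdiff _).comp t h1.mdifferentiableAt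
    refine HasMFDerivAt.hasMFDerivWithinAt (h2.hasMFDerivAt.congr_mfderiv ?_)
    ext1
    have h3 := tderiv_comp_apply (g := fun z : G ↦ a * z) (f := c) t
      ((contMDiff_mulLeft (m := m) a).mdiff _) h1.mdifferentiableAt (1 : ℝ)
    refine h3.trans ?_
    have h4 : tderiv ℝ (Eu m) c t 1 = leftField m (c t) X :=
      (congrFun (congrArg DFunLike.coe h1.tderiv_eq) (1 : ℝ)).trans
        (one_smul ℝ (leftField m (c t) X))
    refine (congrArg _ h4).trans ((tderiv_mulLeft_leftField a (c t) X).trans ?_)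
    exact (one_smul ℝ (leftField m (a * c t) X)).symm

lemma leftField_one (X : Eu m) : leftField m (1 : G) X = X := by
  have : (fun b : G ↦ 1 * b) = fun b ↦ b := by ext; simp
  rw [leftField, this, tderiv_id]; rfl

lemma lieMap_Ad {Φ : G →* G} (hΦ : ContMDiff 𝓘(ℝ, Eu m) 𝓘(ℝ, Eu m) ∞ Φ) (a : G) (X : Eu m) :
    tderiv (Eu m) (Eu m) Φ 1 (Ad m a X) = Ad m (Φ a) (tderiv (Eu m) (Eu m) Φ 1 X) := by
  have h1 := tderiv_comp_apply (g := Φ) (f := fun b : G ↦ a * b * a⁻¹) (1 : G)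
    (hΦ.mdiff _) ((contMDiff_conj (m := m) a).mdiff _) X
  have h2 := tderiv_comp_apply (g := fun b : G ↦ Φ a * b * (Φ a)⁻¹) (f := Φ) (1 : G)
    ((contMDiff_conj (m := m) (Φ a)).mdiff _) (hΦ.mdiff _) X
  simp only [map_mul, map_inv] at h1
  rw [h1] at h2
  simpa [Ad] using h2

lemma hasDerivAt_Ad_integralCurve {W : GroupLieAlgebra (𝓡 m) G} {c : ℝ → G} (h0 : c 0 = 1)
    (hc : IsMIntegralCurve c (mulInvariantVectorField (I := 𝓡 m) W))
    (X : GroupLieAlgebra (𝓡 m) G) :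
    HasDerivAt (fun t ↦ Ad m (c t) X) (⁅W, X⁆ : GroupLieAlgebra (𝓡 m) G) 0 := by
  have hc := isMIntegralCurve_iff.1 hc 0
  exact hasDerivAt_Ad h0 hc.1 W X (hc.2.trans (by rw [h0]; exact leftField_one W))

/-- A smooth endomorphism of `G` intertwines the adjoint actions, so differentiating along a
one-parameter group shows that its derivative is a homomorphism of Lie algebras. -/
lemma lieMap_lie [T2Space G] {Φ : G →* G} (hΦ : ContMDiff 𝓘(ℝ, Eu m) 𝓘(ℝ, Eu m) ∞ Φ)
    (W X : GroupLieAlgebra (𝓡 m) G) :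
    lieMap (m := m) Φ ⁅W, X⁆ = ⁅lieMap (m := m) Φ W, lieMap (m := m) Φ X⁆ := by
  obtain ⟨c, hc0, hc⟩ := exists_exp W
  have h1 := hasDerivAt_Ad_integralCurve hc0 hc X
  have h2 := hasDerivAt_Ad_integralCurve (c := fun t ↦ Φ (c t)) (by simp [hc0])
    (integralCurve_hom hc hΦ) (lieMap (m := m) Φ X)
  have h3 : HasDerivAt (fun t ↦ tderiv (Eu m) (Eu m) Φ 1 (Ad m (c t) X)) _ 0 :=
    (tderiv (Eu m) (Eu m) Φ 1).hasFDerivAt.comp_hasDerivAt 0 h1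
  have h4 : (fun t ↦ tderiv (Eu m) (Eu m) Φ 1 (Ad m (c t) X)) =
      fun t ↦ Ad m (Φ (c t)) (lieMap (m := m) Φ X) := funext fun t ↦ lieMap_Ad hΦ (c t) X
  rw [h4] at h3
  exact h3.unique h2

/-- The derivative at the identity of a smooth automorphism of `G`. -/
def lieEquiv [T2Space G] (Φ Ψ : G →* G) (hΦ : ContMDiff 𝓘(ℝ, Eu m) 𝓘(ℝ, Eu m) ∞ Φ)
    (hΨ : ContMDiff 𝓘(ℝ, Eu m) 𝓘(ℝ, Eu m) ∞ Ψ) (h1 : ∀ a, Ψ (Φ a) = a) (h2 : ∀ a, Φ (Ψ a) = a) :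
    GroupLieAlgebra (𝓡 m) G ≃ₗ⁅ℝ⁆ GroupLieAlgebra (𝓡 m) G where
  __ := lieMap (m := m) Φ
  map_lie' {W X} := lieMap_lie hΦ W X
  invFun := lieMap (m := m) Ψ
  left_inv v := by
    have h := tderiv_leftInverse (hΨ.mdiff (Φ 1)) (hΦ.mdiff 1) (.of_forall h1) v
    rw [map_one] at h
    exact h
  right_inv v := by
    have h := tderiv_leftInverse (hΦ.mdiff (Ψ 1)) (hΨ.mdiff 1) (.of_forall h2) v
    rw [map_one] at h
    exact h

/-- The adjoint action of an element of `G`, as an automorphism of the Lie algebra. -/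
def AdEquiv [T2Space G] (a : G) : GroupLieAlgebra (𝓡 m) G ≃ₗ⁅ℝ⁆ GroupLieAlgebra (𝓡 m) G :=
  lieEquiv (MulAut.conj a).toMonoidHom (MulAut.conj a⁻¹).toMonoidHom (contMDiff_conj a)
    (contMDiff_conj a⁻¹) (fun b ↦ by simp [mul_assoc]) (fun b ↦ by simp [mul_assoc])

end Exponential

/-! ### The Lie algebras of the isotropy group and of its center -/

section Action

open Filter Topology

attribute [local instance] isManifold_group

variable {m : ℕ} {G : Type*} [TopologicalSpace G] [ChartedSpace (EuclideanSpace ℝ (Fin m)) G]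
  [Group G] [LieGroup (𝓡 m) ∞ G]
  {d : ℕ} {N : Type*} [TopologicalSpace N] [ChartedSpace (EuclideanSpace ℝ (Fin d)) N]
  [MulAction G N]

variable (m d G N) in
/-- The action of the Lie group `G` on the manifold `N` is smooth. -/
def SmoothAction : Prop :=
  ContMDiff ((𝓡 m).prod (𝓡 d)) (𝓡 d) ∞ (fun q : G × N ↦ q.1 • q.2)

variable (hs : SmoothAction m G d N)

include hs

lemma SmoothAction.contMDiff_smul (a : G) :
    ContMDiff 𝓘(ℝ, Eu d) 𝓘(ℝ, Eu d) ∞ (fun x : N ↦ a • x) :=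
  ContMDiff.comp (f := fun x : N ↦ (a, x)) hs (contMDiff_const.prodMk contMDiff_id)

lemma SmoothAction.contMDiff_orbit (o : N) :
    ContMDiff 𝓘(ℝ, Eu m) 𝓘(ℝ, Eu d) ∞ (fun a : G ↦ a • o) :=
  ContMDiff.comp (f := fun a : G ↦ (a, o)) hs (contMDiff_id.prodMk contMDiff_const)

omit hs in
variable (m d G) in
/-- The derivative at the identity of the orbit map of `o`. -/
def orbitDeriv (o : N) : Eu m →L[ℝ] Eu d := tderiv (Eu m) (Eu d) (fun a : G ↦ a • o) 1

lemma tderiv_orbit_leftField (o : N) (a : G) (X : Eu m) :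
    tderiv (Eu m) (Eu d) (fun b : G ↦ b • o) a (leftField m a X) =
      tderiv (Eu d) (Eu d) (fun x : N ↦ a • x) o (orbitDeriv m G d o X) := by
  have h1 := tderiv_comp_apply (g := fun b : G ↦ b • o) (f := fun b : G ↦ a * b) (1 : G)
    ((hs.contMDiff_orbit o).mdiff _) ((contMDiff_mulLeft (m := m) a).mdiff _) X
  have h2 := tderiv_comp_apply (g := fun x : N ↦ a • x) (f := fun b : G ↦ b • o) (1 : G)
    ((hs.contMDiff_smul a).mdiff _) ((hs.contMDiff_orbit o).mdiff _) X
  simp only [mul_smul] at h1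
  rw [h1] at h2
  simpa [leftField, orbitDeriv] using h2

lemma orbitDeriv_Ad {o : N} {a : G} (ha : a • o = o) (X : Eu m) :
    orbitDeriv m G d o (Ad m a X) =
      tderiv (Eu d) (Eu d) (fun x : N ↦ a • x) o (orbitDeriv m G d o X) := by
  have ha' : a⁻¹ • o = o := inv_smul_eq_iff.2 ha.symm
  have h1 := tderiv_comp_apply (g := fun b : G ↦ b • o) (f := fun b : G ↦ a * b * a⁻¹) (1 : G)
    ((hs.contMDiff_orbit o).mdiff _) ((contMDiff_conj (m := m) a).mdiff _) X
  have h2 := tderiv_comp_apply (g := fun x : N ↦ a • x) (f := fun b : G ↦ b • o) (1 : G)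
    ((hs.contMDiff_smul a).mdiff _) ((hs.contMDiff_orbit o).mdiff _) X
  simp only [mul_smul, ha'] at h1
  rw [h1] at h2
  simpa [Ad, orbitDeriv] using h2

lemma SmoothAction.mdifferentiableAt_curve {o : N} {c : ℝ → G} {t : ℝ}
    (hc : MDifferentiableAt 𝓘(ℝ, ℝ) 𝓘(ℝ, Eu m) c t) :
    MDifferentiableAt 𝓘(ℝ, ℝ) 𝓘(ℝ, Eu d) (fun t ↦ c t • o) t :=
  ((hs.contMDiff_orbit (m := m) o).mdiff _).comp t hc

lemma orbitDeriv_eq_zero_of_curve {o : N} {X : GroupLieAlgebra (𝓡 m) G} {c : ℝ → G} (h0 : c 0 = 1)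
    (hc : IsMIntegralCurve c (mulInvariantVectorField (I := 𝓡 m) X))
    (h : ∀ t, c t ∈ MulAction.stabilizer G o) : orbitDeriv m G d o X = 0 := by
  have hc := isMIntegralCurve_iff.1 hc 0
  have h1 := tderiv_comp_apply (g := fun b : G ↦ b • o) (f := c) (0 : ℝ)
    ((hs.contMDiff_orbit o).mdiff _) hc.1 1
  have h2 : (fun t ↦ c t • o) = fun _ ↦ o := funext h
  have h3 : tderiv ℝ (Eu m) c 0 1 = (X : Eu m) := hc.2.trans (by rw [h0]; exact leftField_one X)
  rw [h2, tderiv_const, h3, h0] at h1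
  exact h1.symm

variable [IsManifold (𝓡 d) ∞ N] [T2Space N]

omit hs in
/-- A curve with zero velocity is constant, as an integral curve of the zero vector field. -/
lemma eq_of_tderiv_eq_zero {γ : ℝ → N} (h : ∀ t, MDifferentiableAt 𝓘(ℝ, ℝ) 𝓘(ℝ, Eu d) γ t)
    (h' : ∀ t, tderiv ℝ (Eu d) γ t 1 = 0) (t : ℝ) : γ t = γ 0 := by
  have hman : IsManifold (𝓡 d) 1 N := .of_le (n := ∞) (by simp)
  have h0 : ContMDiff (𝓡 d) (𝓡 d).tangent 1
      (fun x : N ↦ (⟨x, 0⟩ : TangentBundle (𝓡 d) N)) :=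
    contMDiff_zeroSection ℝ (TangentSpace (𝓡 d) (M := N))
  have h1 : IsMIntegralCurve (I := 𝓡 d) γ (fun _ ↦ 0) := by
    intro t
    refine (h t).hasMFDerivAt.congr_mfderiv ?_
    ext1
    refine (h' t).trans ?_
    exact (smul_zero (1 : ℝ)).symm
  have h2 : IsMIntegralCurve (I := 𝓡 d) (fun _ ↦ γ 0) (fun _ ↦ 0) := by
    intro t
    refine (hasMFDerivAt_const (γ 0) t).congr_mfderiv ?_
    ext1
    exact (smul_zero (1 : ℝ)).symm
  exact congrFun (isMIntegralCurve_Ioo_eq_of_contMDiff_boundaryless (t₀ := 0) h0 h1 h2 rfl) t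

lemma curve_mem_stabilizer {o : N} {X : GroupLieAlgebra (𝓡 m) G} {c : ℝ → G} (h0 : c 0 = 1)
    (hc : IsMIntegralCurve c (mulInvariantVectorField (I := 𝓡 m) X))
    (h : orbitDeriv m G d o X = 0) (t : ℝ) : c t ∈ MulAction.stabilizer G o := by
  have hc := isMIntegralCurve_iff.1 hc
  have h1 := eq_of_tderiv_eq_zero (γ := fun t ↦ c t • o)
    (fun t ↦ hs.mdifferentiableAt_curve (hc t).1) (fun t ↦ ?_) t
  · simpa [h0] using h1
  · rw [tderiv_comp_apply (g := fun b : G ↦ b • o) (f := c) t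
      ((hs.contMDiff_orbit (m := m) o).mdiff _) (hc t).1, (hc t).2]
    exact (tderiv_orbit_leftField hs o (c t) X).trans ((congrArg _ h).trans (map_zero _))

variable [T2Space G]

lemma mem_lieAlgebraOf_stabilizer {o : N} {X : GroupLieAlgebra (𝓡 m) G} :
    X ∈ lieAlgebraOf (m := m) (MulAction.stabilizer G o) ↔ orbitDeriv m G d o X = 0 := by
  constructor
  · rintro ⟨c, h0, hc, h⟩
    exact orbitDeriv_eq_zero_of_curve hs h0 hc h
  · intro h
    obtain ⟨c, h0, hc⟩ := exists_exp X
    exact ⟨c, h0, hc, curve_mem_stabilizer hs h0 hc h⟩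

/-- The Lie algebra of the centre of the isotropy group consists of the elements of the isotropy
algebra fixed by the adjoint action of the isotropy group. -/
lemma mem_lieAlgebraOf_center {o : N} {X : GroupLieAlgebra (𝓡 m) G} :
    X ∈ lieAlgebraOf (m := m) (centerOf (MulAction.stabilizer G o)) ↔
      orbitDeriv m G d o X = 0 ∧ ∀ a ∈ MulAction.stabilizer G o, AdEquiv a X = X := by
  constructor
  · rintro ⟨c, h0, hc, h⟩
    have hmem (t : ℝ) : c t ∈ MulAction.stabilizer G o ∧
        ∀ a ∈ MulAction.stabilizer G o, a * c t * a⁻¹ = c t := by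
      obtain ⟨z, hz, hzc⟩ := Subgroup.mem_map.1 (h t)
      refine ⟨hzc ▸ z.2, fun a ha ↦ ?_⟩
      have := congrArg Subtype.val (Subgroup.mem_center_iff.1 hz ⟨a, ha⟩)
      rw [mul_inv_eq_iff_eq_mul, ← hzc]
      exact this
    refine ⟨orbitDeriv_eq_zero_of_curve hs h0 hc fun t ↦ (hmem t).1, fun a ha ↦ ?_⟩
    have hc := isMIntegralCurve_iff.1 hc 0
    have h1 := tderiv_comp_apply (g := fun b : G ↦ a * b * a⁻¹) (f := c) (0 : ℝ)
      ((contMDiff_conj (m := m) a).mdiff _) hc.1 1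
    have h2 : (fun t ↦ a * c t * a⁻¹) = c := funext fun t ↦ (hmem t).2 a ha
    have h3 : tderiv ℝ (Eu m) c 0 1 = (X : Eu m) := hc.2.trans (by rw [h0]; exact leftField_one X)
    rw [h2, h3, h0] at h1
    exact h1.symm
  · rintro ⟨hX, h⟩
    obtain ⟨c, h0, hc⟩ := exists_exp X
    have hmem := curve_mem_stabilizer hs h0 hc hX
    refine ⟨c, h0, hc, fun t ↦ Subgroup.mem_map.2 ⟨⟨c t, hmem t⟩, ?_, rfl⟩⟩
    refine Subgroup.mem_center_iff.2 fun a ↦ Subtype.ext ?_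
    have h1 := integralCurve_hom hc (Φ := (MulAut.conj a.1).toMonoidHom) (contMDiff_conj a.1)
    have h2 : lieMap (m := m) (MulAut.conj a.1).toMonoidHom X = X := h a.1 a.2
    rw [h2] at h1
    have h3 := congrFun (integralCurve_eq hc h1 (by simp [h0])) t
    have h4 : a.1 * c t * a.1⁻¹ = c t := h3.symm
    rw [mul_inv_eq_iff_eq_mul] at h4
    exact h4

/-- The centre of the isotropy group centralizes the isotropy algebra. -/
lemma lie_eq_zero_of_Ad_eq {o : N} {W V : GroupLieAlgebra (𝓡 m) G}
    (hW : ∀ a ∈ MulAction.stabilizer G o, AdEquiv a W = W) (hV : orbitDeriv m G d o V = 0) :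
    ⁅W, V⁆ = 0 := by
  obtain ⟨c, h0, hc⟩ := exists_exp V
  have h1 := hasDerivAt_Ad_integralCurve h0 hc W
  have h2 : (fun t ↦ Ad m (c t) W) = fun _ ↦ (W : Eu m) :=
    funext fun t ↦ hW (c t) (curve_mem_stabilizer hs h0 hc hV t)
  rw [h2] at h1
  have h3 : ⁅V, W⁆ = 0 := h1.unique (hasDerivAt_const (F := Eu m) (0 : ℝ) W)
  rw [← lie_skew, h3, neg_zero]

end Action

/-! ### The infinitesimal model of a para-Hermitian symmetric space -/

section Model

open Filter Topology

attribute [local instance] isManifold_group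

section Forms

variable {d : ℕ} {N : Type*} [TopologicalSpace N]
  [ChartedSpace (EuclideanSpace ℝ (Fin d)) N] [IsManifold (𝓡 d) ∞ N]

/-- The metric at a point, as a form on the model space. -/
def PseudoMetric.form (g : PseudoMetric d N) (x : N) : Eu d →L[ℝ] Eu d →L[ℝ] ℝ := g.val x

lemma PseudoMetric.form_symm (g : PseudoMetric d N) (x : N) (v w : Eu d) :
    g.form x v w = g.form x w v := g.symm x v w

lemma PseudoMetric.eq_zero_of_form (g : PseudoMetric d N) (x : N) {v : Eu d}
    (h : ∀ w, g.form x v w = 0) : v = 0 := g.nondegenerate x v h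

end Forms

variable {m n : ℕ} {G : Type*} [TopologicalSpace G] [ChartedSpace (EuclideanSpace ℝ (Fin m)) G]
  [Group G] [LieGroup (𝓡 m) ∞ G]
  {N : Type*} [TopologicalSpace N] [ChartedSpace (EuclideanSpace ℝ (Fin (2 * n))) N]
  [IsManifold (𝓡 (2 * n)) ∞ N] [MulAction G N]

/-- The para-complex structure at a point, as an endomorphism of the model space. -/
def ParaComplex.op (J : ParaComplex n N) (x : N) : Eu (2 * n) →L[ℝ] Eu (2 * n) := J.val x

variable {J : ParaComplex n N} {g : PseudoMetric (2 * n) N} {o : N} {σ : G →* G}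

lemma Preserves.tderiv_op {φ : N → N} (h : Preserves J g φ) (x : N) (v : Eu (2 * n)) :
    tderiv (Eu (2 * n)) (Eu (2 * n)) φ x (J.op x v) =
      J.op (φ x) (tderiv (Eu (2 * n)) (Eu (2 * n)) φ x v) := (h x v v).1

lemma Preserves.form_tderiv {φ : N → N} (h : Preserves J g φ) (x : N) (v w : Eu (2 * n)) :
    g.form (φ x) (tderiv (Eu (2 * n)) (Eu (2 * n)) φ x v)
      (tderiv (Eu (2 * n)) (Eu (2 * n)) φ x w) = g.form x v w := (h x v w).2

lemma IsParaHermitian.form_op (h : IsParaHermitian J g) (x : N) (v w : Eu (2 * n)) :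
    g.form x (J.op x v) w + g.form x v (J.op x w) = 0 := h x v w

variable (m G) in
omit [LieGroup (𝓡 m) ∞ G] in
lemma finiteDimensional_groupLieAlgebra : FiniteDimensional ℝ (GroupLieAlgebra (𝓡 m) G) :=
  inferInstanceAs (FiniteDimensional ℝ (Eu m))

attribute [local instance] finiteDimensional_groupLieAlgebra

namespace IsSymmetricCosetSpace

variable (hN : IsSymmetricCosetSpace (m := m) J g o σ)
include hN

lemma smoothAction : SmoothAction m G (2 * n) N := hN.smooth_smul

lemma form_orbitDeriv_Ad {a : G} (ha : a ∈ MulAction.stabilizer G o) (X Y : Eu m) :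
    g.form o (orbitDeriv m G (2 * n) o (Ad m a X)) (orbitDeriv m G (2 * n) o (Ad m a Y)) =
      g.form o (orbitDeriv m G (2 * n) o X) (orbitDeriv m G (2 * n) o Y) := by
  have h := (hN.preserves a).form_tderiv o (orbitDeriv m G (2 * n) o X)
    (orbitDeriv m G (2 * n) o Y)
  rwa [← orbitDeriv_Ad hN.smoothAction ha, ← orbitDeriv_Ad hN.smoothAction ha,
    show a • o = o from ha] at h

lemma op_orbitDeriv_Ad {a : G} (ha : a ∈ MulAction.stabilizer G o) {X X' : Eu m}
    (h : J.op o (orbitDeriv m G (2 * n) o X) = orbitDeriv m G (2 * n) o X') :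
    J.op o (orbitDeriv m G (2 * n) o (Ad m a X)) = orbitDeriv m G (2 * n) o (Ad m a X') := by
  have h1 := (hN.preserves a).tderiv_op o (orbitDeriv m G (2 * n) o X)
  rw [h, ← orbitDeriv_Ad hN.smoothAction ha, ← orbitDeriv_Ad hN.smoothAction ha,
    show a • o = o from ha] at h1
  exact h1.symm

variable [T2Space G] [T2Space N]

lemma hasDerivAt_orbitDeriv_Ad {W : GroupLieAlgebra (𝓡 m) G} {c : ℝ → G} (h0 : c 0 = 1)
    (hc : IsMIntegralCurve c (mulInvariantVectorField (I := 𝓡 m) W))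
    (X : GroupLieAlgebra (𝓡 m) G) :
    HasDerivAt (fun t ↦ orbitDeriv m G (2 * n) o (Ad m (c t) X))
      (orbitDeriv m G (2 * n) o (⁅W, X⁆ : GroupLieAlgebra (𝓡 m) G)) 0 :=
  (orbitDeriv m G (2 * n) o).hasFDerivAt.comp_hasDerivAt 0 (hasDerivAt_Ad_integralCurve h0 hc X)

/-- The infinitesimal model of a para-Hermitian symmetric space. The invariance under the isotropy
algebra follows by differentiating the invariance under one-parameter groups of isotropies. -/
def model (hsurj : Function.Surjective (orbitDeriv m G (2 * n) o))
    (hθ : ∀ X : Eu m, orbitDeriv m G (2 * n) o (tderiv (Eu m) (Eu m) σ 1 X) =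
      -orbitDeriv m G (2 * n) o X) :
    InfinitesimalModel (GroupLieAlgebra (𝓡 m) G) (Eu (2 * n)) where
  p := (show GroupLieAlgebra (𝓡 m) G →L[ℝ] Eu (2 * n) from
    orbitDeriv m G (2 * n) o).toLinearMap
  θ := lieEquiv σ σ hN.smooth_involution hN.smooth_involution hN.involutive hN.involutive
  γ := LinearMap.mk₂ ℝ (fun v w ↦ g.form o v w) (by simp) (by simp) (by simp) (by simp)
  J := (J.op o).toLinearMap
  surj := hsurj
  inv X := (lieEquiv σ σ hN.smooth_involution hN.smooth_involution hN.involutive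
    hN.involutive).symm_apply_apply X
  p_θ := hθ
  symm := g.form_symm o
  nondeg _ := g.eq_zero_of_form o
  sq := J.sq o
  skew := hN.symmetric.1.form_op o
  γ_lie W X Y hW := by
    obtain ⟨c, h0, hc⟩ := exists_exp W
    have hX := hN.hasDerivAt_orbitDeriv_Ad h0 hc X
    have hY := hN.hasDerivAt_orbitDeriv_Ad h0 hc Y
    have h1 := ((g.form o).hasFDerivAt.comp_hasDerivAt (0 : ℝ) hX).clm_apply hY
    have h2 : (fun t ↦ g.form o (orbitDeriv m G (2 * n) o (Ad m (c t) X))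
        (orbitDeriv m G (2 * n) o (Ad m (c t) Y))) = fun _ ↦
        g.form o (orbitDeriv m G (2 * n) o X) (orbitDeriv m G (2 * n) o Y) :=
      funext fun t ↦ hN.form_orbitDeriv_Ad (curve_mem_stabilizer hN.smoothAction h0 hc hW t) X Y
    have h3 := h1.unique (h2 ▸ hasDerivAt_const (0 : ℝ) _)
    simp only [Function.comp_apply, h0, Ad_one] at h3
    exact h3
  J_lie W X X' hW h := by
    obtain ⟨c, h0, hc⟩ := exists_exp W
    have hX := hN.hasDerivAt_orbitDeriv_Ad h0 hc X
    have hX' := hN.hasDerivAt_orbitDeriv_Ad h0 hc X'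
    have h1 : HasDerivAt (fun t ↦ J.op o (orbitDeriv m G (2 * n) o (Ad m (c t) X))) _ 0 :=
      (J.op o).hasFDerivAt.comp_hasDerivAt (0 : ℝ) hX
    have h2 : (fun t ↦ J.op o (orbitDeriv m G (2 * n) o (Ad m (c t) X))) =
        fun t ↦ orbitDeriv m G (2 * n) o (Ad m (c t) X') :=
      funext fun t ↦ hN.op_orbitDeriv_Ad (curve_mem_stabilizer hN.smoothAction h0 hc hW t) h
    rw [h2] at h1
    exact h1.unique hX'

variable (m n o) in
omit hN [T2Space N] [TopologicalSpace N] [ChartedSpace (EuclideanSpace ℝ (Fin (2 * n))) N]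
  [IsManifold (𝓡 (2 * n)) ∞ N] in
/-- The adjoint action of the isotropy group. -/
def isotropyFamily : Set (GroupLieAlgebra (𝓡 m) G ≃ₗ⁅ℝ⁆ GroupLieAlgebra (𝓡 m) G) :=
  {Φ | ∃ a ∈ MulAction.stabilizer G o, Φ = AdEquiv a}

variable (hsurj : Function.Surjective (orbitDeriv m G (2 * n) o))
    (hθ : ∀ X : Eu m, orbitDeriv m G (2 * n) o (tderiv (Eu m) (Eu m) σ 1 X) =
      -orbitDeriv m G (2 * n) o X)

lemma isIsotropy_AdEquiv {a : G} (ha : a ∈ MulAction.stabilizer G o) :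
    (hN.model hsurj hθ).IsIsotropy (AdEquiv a) where
  metric X Y := hN.form_orbitDeriv_Ad ha X Y
  paraComplex _ _ h := hN.op_orbitDeriv_Ad ha h

lemma lieAlgebraOf_center_eq : lieAlgebraOf (m := m) (centerOf (MulAction.stabilizer G o)) =
    ((hN.model hsurj hθ).fixedSpace (isotropyFamily m o) : Set (GroupLieAlgebra (𝓡 m) G)) := by
  ext X
  refine (mem_lieAlgebraOf_center hN.smoothAction).trans
    (and_congr Iff.rfl ⟨?_, fun h a ha ↦ h _ ⟨a, ha, rfl⟩⟩)
  rintro h _ ⟨a, ha, rfl⟩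
  exact h a ha

lemma lieDim_center_eq : lieDim (m := m) (centerOf (MulAction.stabilizer G o)) =
    finrank ℝ ((hN.model hsurj hθ).fixedSpace (isotropyFamily m o)) := by
  rw [lieDim, Set.finrank, hN.lieAlgebraOf_center_eq hsurj hθ, Submodule.span_eq]

lemma lie_eq_zero_of_mem_fixedSpace {W V : GroupLieAlgebra (𝓡 m) G}
    (hW : W ∈ (hN.model hsurj hθ).fixedSpace (isotropyFamily m o))
    (hV : (hN.model hsurj hθ).p V = 0) : ⁅W, V⁆ = 0 :=
  lie_eq_zero_of_Ad_eq hN.smoothAction (fun a ha ↦ hW.2 _ ⟨a, ha, rfl⟩) hV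

include hsurj hθ in
/-- If `N` is a point, the isotropy group is all of `G`, so that its centre is discrete. -/
lemma nontrivial_of_lieDim_center_ne_zero [LieAlgebra.IsSimple ℝ (GroupLieAlgebra (𝓡 m) G)]
    (h : lieDim (m := m) (centerOf (MulAction.stabilizer G o)) ≠ 0) :
    Nontrivial (Eu (2 * n)) := by
  by_contra hcon
  rw [not_nontrivial_iff_subsingleton] at hcon
  refine h ?_
  rw [hN.lieDim_center_eq hsurj hθ]
  have : (hN.model hsurj hθ).fixedSpace (isotropyFamily m o) = ⊥ := by
    refine (Submodule.eq_bot_iff _).2 fun W hW ↦ InfinitesimalModel.eq_zero_of_forall_lie fun V ↦ ?_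
    exact hN.lie_eq_zero_of_mem_fixedSpace hsurj hθ hW (Subsingleton.elim _ _)
  rw [this, finrank_bot]

end IsSymmetricCosetSpace

end Model

/-! ### Metrics in coordinates -/

section Coordinates

open Filter Topology

lemma contDiffAt_clm_of_apply {D E F : Type*} [NormedAddCommGroup D] [NormedSpace ℝ D]
    [NormedAddCommGroup E] [NormedSpace ℝ E] [NormedAddCommGroup F] [NormedSpace ℝ F]
    [FiniteDimensional ℝ E] {k : WithTop ℕ∞} {f : D → E →L[ℝ] F} {x : D}
    (h : ∀ v, ContDiffAt ℝ k (fun y ↦ f y v) x) : ContDiffAt ℝ k f x := by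
  have hd : finrank ℝ E = finrank ℝ (Fin (finrank ℝ E) → ℝ) := (finrank_fin_fun ℝ).symm
  let e₁ := ContinuousLinearEquiv.ofFinrankEq hd
  let e₂ := (e₁.arrowCongr (1 : F ≃L[ℝ] F)).trans (ContinuousLinearEquiv.piRing (Fin _))
  rw [← Function.id_comp f, ← e₂.symm_comp_self]
  exact e₂.symm.contDiff.contDiffAt.comp x (contDiffAt_pi.mpr fun i => h _)

variable {d : ℕ} {N : Type*} [TopologicalSpace N]
  [ChartedSpace (EuclideanSpace ℝ (Fin d)) N] [IsManifold (𝓡 d) ∞ N]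

/-- The components, in the preferred chart at `x`, of a family of bilinear forms on the tangent
spaces. -/
def gram (β : N → Eu d →L[ℝ] Eu d →L[ℝ] ℝ) (x : N) (y : Eu d) : Eu d →L[ℝ] Eu d →L[ℝ] ℝ :=
  (β (chartInv (Eu d) x y)).bilinearComp (tderiv (Eu d) (Eu d) (chartInv (Eu d) x) y)
    (tderiv (Eu d) (Eu d) (chartInv (Eu d) x) y)

lemma gram_apply (β : N → Eu d →L[ℝ] Eu d →L[ℝ] ℝ) (x : N) (y v w : Eu d) :
    gram β x y v w = β (chartInv (Eu d) x y) (tderiv (Eu d) (Eu d) (chartInv (Eu d) x) y v)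
      (tderiv (Eu d) (Eu d) (chartInv (Eu d) x) y w) := rfl

lemma gram_chartMap (β : N → Eu d →L[ℝ] Eu d →L[ℝ] ℝ) {x z : N} (hz : z ∈ chartDom (Eu d) x)
    (v w : Eu d) : gram β x (chartMap (Eu d) x z) v w =
      β z (tderiv (Eu d) (Eu d) (chartInv (Eu d) x) (chartMap (Eu d) x z) v)
        (tderiv (Eu d) (Eu d) (chartInv (Eu d) x) (chartMap (Eu d) x z) w) := by
  rw [gram_apply, chartInv_chartMap hz]

/-- A coordinate vector field is smooth. -/
lemma contMDiffAt_coordField {x : N} {y : Eu d} (hy : y ∈ chartRan (Eu d) x) (v : Eu d) :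
    ContMDiffAt 𝓘(ℝ, Eu d) (𝓡 d).tangent ∞ (fun y ↦ (⟨chartInv (Eu d) x y,
      tderiv (Eu d) (Eu d) (chartInv (Eu d) x) y v⟩ : TangentBundle (𝓡 d) N)) y := by
  have hopen : IsOpen (chartRan (Eu d) x) := isOpen_chartRan x
  have h1 : ContMDiffOn 𝓘(ℝ, Eu d) (𝓡 d) ∞ (chartInv (Eu d) x) (chartRan (Eu d) x) :=
    contMDiffOn_extChartAt_symm x
  have h2 := h1.contMDiffOn_tangentMapWithin (m := ∞) (by simp) hopen.uniqueMDiffOn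
  have h3 : ContMDiff 𝓘(ℝ, Eu d) 𝓘(ℝ, Eu d).tangent ∞
      (fun y ↦ (⟨y, v⟩ : TangentBundle 𝓘(ℝ, Eu d) (Eu d))) := by
    intro y
    rw [contMDiffAt_totalSpace]
    refine ⟨contMDiffAt_id, ?_⟩
    simp only [trivializationAt_model_space_apply]
    exact contMDiffAt_const
  have h4 := (ContMDiffOn.comp (s := chartRan (Eu d) x) h2 h3.contMDiffOn
    (fun y hy ↦ hy)).contMDiffAt (hopen.mem_nhds hy)
  refine h4.congr_of_eventuallyEq ?_
  filter_upwards [hopen.mem_nhds hy] with z hz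
  have : mfderivWithin 𝓘(ℝ, Eu d) (𝓡 d) (chartInv (Eu d) x) (chartRan (Eu d) x) z =
    mfderiv 𝓘(ℝ, Eu d) (𝓡 d) (chartInv (Eu d) x) z := mfderivWithin_of_isOpen hopen hz
  simp only [Function.comp_apply, tangentMapWithin, this]
  rfl

/-- The components of a pseudo-Riemannian metric are smooth on the range of the chart. -/
lemma PseudoMetric.contDiffAt_gram (g : PseudoMetric d N) {x : N} {y : Eu d}
    (hy : y ∈ chartRan (Eu d) x) : ContDiffAt ℝ ∞ (gram g.form x) y := by
  refine contDiffAt_clm_of_apply fun v ↦ contDiffAt_clm_of_apply fun w ↦ ?_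
  have h1 : ContMDiffAt 𝓘(ℝ, Eu d) ((𝓡 d).prod 𝓘(ℝ, Eu d →L[ℝ] Eu d →L[ℝ] ℝ)) ∞
      (fun y ↦ TotalSpace.mk' (Eu d →L[ℝ] Eu d →L[ℝ] ℝ)
        (E := fun y : N ↦ TangentSpace (𝓡 d) y →L[ℝ] TangentSpace (𝓡 d) y →L[ℝ] ℝ)
        (chartInv (Eu d) x y) (g.val (chartInv (Eu d) x y))) y :=
    (g.contMDiff (chartInv (Eu d) x y)).comp y (contMDiffAt_chartInv hy)
  have h2 := h1.clm_bundle_apply₂ (F₁ := Eu d) (F₂ := Eu d) (F₃ := ℝ)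
    (E₃ := fun _ : N ↦ ℝ) (contMDiffAt_coordField hy v) (contMDiffAt_coordField hy w)
  rw [contMDiffAt_totalSpace] at h2
  exact h2.2.contDiffAt

/-- A family of bilinear forms is smooth if its components in the preferred charts are smooth at
the centres of the charts. -/
lemma contMDiffAt_of_gram {x : N}
    (β : ∀ y : N, TangentSpace (𝓡 d) y →L[ℝ] TangentSpace (𝓡 d) y →L[ℝ] ℝ)
    (h : ContDiffAt ℝ ∞ (gram β x) (chartMap (Eu d) x x)) :
    ContMDiffAt (𝓡 d) ((𝓡 d).prod 𝓘(ℝ, Eu d →L[ℝ] Eu d →L[ℝ] ℝ)) ∞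
      (fun y ↦ TotalSpace.mk' (Eu d →L[ℝ] Eu d →L[ℝ] ℝ)
        (E := fun y : N ↦ TangentSpace (𝓡 d) y →L[ℝ] TangentSpace (𝓡 d) y →L[ℝ] ℝ)
        y (β y)) x := by
  rw [contMDiffAt_hom_bundle]
  refine ⟨contMDiffAt_id, ?_⟩
  have h1 : ContMDiffAt (𝓡 d) 𝓘(ℝ, Eu d →L[ℝ] Eu d →L[ℝ] ℝ) ∞
      (fun z ↦ gram β x (chartMap (Eu d) x z)) x :=
    h.contMDiffAt.comp x (contMDiffAt_chartMap (mem_chartDom x))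
  refine h1.congr_of_eventuallyEq ?_
  filter_upwards [(isOpen_chartDom (E := Eu d) x).mem_nhds (mem_chartDom x)] with z hz
  have hz' : z ∈ (trivializationAt (Eu d) (TangentSpace (𝓡 d)) x).baseSet := by
    rw [TangentBundle.trivializationAt_baseSet, ← extChartAt_source (𝓡 d)]; exact hz
  have hz'' : z ∈ (chartAt (Eu d) x).source := by
    rw [← extChartAt_source (𝓡 d)]; exact hz
  ext v w
  have h2 := TangentBundle.symmL_trivializationAt (I := 𝓡 d) hz''
  have h3 : mfderivWithin 𝓘(ℝ, Eu d) (𝓡 d) (extChartAt (𝓡 d) x).symm (Set.range (𝓡 d))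
      (extChartAt (𝓡 d) x z) = mfderiv 𝓘(ℝ, Eu d) (𝓡 d) (extChartAt (𝓡 d) x).symm
      (extChartAt (𝓡 d) x z) := by
    have : Set.range (𝓡 d) = Set.univ := by simp
    rw [this, mfderivWithin_univ]
  have h4 (v : Eu d) : (trivializationAt (Eu d) (TangentSpace (𝓡 d)) x).symm z v =
      tderiv (Eu d) (Eu d) (chartInv (Eu d) x) (chartMap (Eu d) x z) v :=
    (Trivialization.symmL_apply _ hz' _).symm.trans (congrFun (congrArg DFunLike.coe (h2.trans h3)) v)
  refine (inCoordinates_apply_eq₂ (F₃ := ℝ) (E₃ := fun _ : N ↦ ℝ) hz' hz'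
    (Set.mem_univ _)).trans ?_
  have h5 (r : ℝ) : (trivializationAt ℝ (fun _ : N ↦ ℝ) x).linearMapAt ℝ z r = r := by simp
  refine (h5 _).trans ((congrArg₂ (fun a b ↦ β z a b) (h4 v) (h4 w)).trans ?_)
  exact (gram_chartMap β hz v w).symm

end Coordinates

/-! ### Christoffel symbols and changes of coordinates -/

section LeviCivita

open Filter Topology

section VectorSpace

variable {E : Type*} [NormedAddCommGroup E] [NormedSpace ℝ E]

/-- The Christoffel symbols of the first kind of a family of bilinear forms on a vector space. -/
def christ (G : E → E →L[ℝ] E →L[ℝ] ℝ) (y u v w : E) : ℝ :=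
  (fderiv ℝ G y u v w + fderiv ℝ G y v u w - fderiv ℝ G y w u v) / 2

/-- The left-hand side of the geodesic equation on a vector space. -/
def residual (G : E → E →L[ℝ] E →L[ℝ] ℝ) (c : ℝ → E) (t : ℝ) (w : E) : ℝ :=
  G (c t) (deriv (deriv c) t) w + christ G (c t) (deriv c t) (deriv c t) w

lemma fderiv_apply_apply {G : E → E →L[ℝ] E →L[ℝ] ℝ} {y : E} (hG : DifferentiableAt ℝ G y)
    (u v w : E) : fderiv ℝ (fun z ↦ G z v w) y u = fderiv ℝ G y u v w := by
  have h := ((hG.hasFDerivAt.clm_apply (hasFDerivAt_const v y)).clm_apply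
    (hasFDerivAt_const w y)).fderiv
  rw [h]; simp

variable {G₁ G₂ : E → E →L[ℝ] E →L[ℝ] ℝ} {θ : E → E} {y : E}

lemma fderiv_pullback (h1 : DifferentiableAt ℝ G₁ y) (h2 : DifferentiableAt ℝ G₂ (θ y))
    (hθ : ContDiffAt ℝ 2 θ y)
    (h : ∀ v w, (fun z ↦ G₁ z v w) =ᶠ[𝓝 y] fun z ↦ G₂ (θ z) (fderiv ℝ θ z v) (fderiv ℝ θ z w))
    (u v w : E) :
    fderiv ℝ G₁ y u v w = fderiv ℝ G₂ (θ y) (fderiv ℝ θ y u) (fderiv ℝ θ y v) (fderiv ℝ θ y w)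
      + G₂ (θ y) (fderiv ℝ (fderiv ℝ θ) y u v) (fderiv ℝ θ y w)
      + G₂ (θ y) (fderiv ℝ θ y v) (fderiv ℝ (fderiv ℝ θ) y u w) := by
  have hθ1 := (hθ.differentiableAt (by simp)).hasFDerivAt
  have hθ2 := ((hθ.fderiv_right (m := 1) (by norm_num)).differentiableAt (by simp)).hasFDerivAt
  have hv := hθ2.clm_apply (hasFDerivAt_const v y)
  have hw := hθ2.clm_apply (hasFDerivAt_const w y)
  have hA := HasFDerivAt.comp (g := G₂) (f := θ) y h2.hasFDerivAt hθ1
  have h3 := ((hA.clm_apply hv).clm_apply hw).fderiv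
  rw [← fderiv_apply_apply h1, (h v w).fderiv_eq]
  refine (congrFun (congrArg DFunLike.coe h3) u).trans ?_
  simp
  ring

variable (h1 : DifferentiableAt ℝ G₁ y) (h2 : DifferentiableAt ℝ G₂ (θ y))
  (hθ : ContDiffAt ℝ 2 θ y)
  (h : ∀ v w, (fun z ↦ G₁ z v w) =ᶠ[𝓝 y] fun z ↦ G₂ (θ z) (fderiv ℝ θ z v) (fderiv ℝ θ z w))
  (hsymm : ∀ v w, G₂ (θ y) v w = G₂ (θ y) w v)
include h1 h2 hθ h hsymm

/-- The transformation rule of the Christoffel symbols. -/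
lemma christ_pullback (u v w : E) :
    christ G₁ y u v w = christ G₂ (θ y) (fderiv ℝ θ y u) (fderiv ℝ θ y v) (fderiv ℝ θ y w)
      + G₂ (θ y) (fderiv ℝ (fderiv ℝ θ) y u v) (fderiv ℝ θ y w) := by
  have hs := (hθ.isSymmSndFDerivAt (by simp)).eq
  rw [christ, christ, fderiv_pullback h1 h2 hθ h, fderiv_pullback h1 h2 hθ h,
    fderiv_pullback h1 h2 hθ h, hs v u, hs w u, hs w v,
    hsymm (fderiv ℝ θ y v) (fderiv ℝ (fderiv ℝ θ) y u w)]
  ring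

/-- The geodesic equation does not depend on coordinates. -/
lemma residual_pullback {c : ℝ → E} {t : ℝ} (hc : ContDiffAt ℝ 2 c t) (hy : c t = y) (w : E) :
    residual G₁ c t w = residual G₂ (fun τ ↦ θ (c τ)) t (fderiv ℝ θ y w) := by
  have hc1 := (hc.differentiableAt (by simp)).hasDerivAt
  have hc2 : HasDerivAt (deriv c) (deriv (deriv c) t) t :=
    ((ContDiffAt.derivWithin (m := 1) hc (by norm_num)).differentiableAt (by simp)).hasDerivAt
  have hθc : ∀ᶠ τ in 𝓝 t, deriv (fun τ ↦ θ (c τ)) τ = fderiv ℝ θ (c τ) (deriv c τ) := by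
    have e1 : ∀ᶠ τ in 𝓝 t, ContDiffAt ℝ 1 θ (c τ) :=
      (hy ▸ hc.continuousAt : Tendsto c (𝓝 t) (𝓝 y)).eventually
        ((hθ.of_le one_le_two).eventually (by simp))
    filter_upwards [e1, (hc.of_le one_le_two).eventually (by simp)] with τ h3 h4
    exact ((h3.differentiableAt (by simp)).hasFDerivAt.comp_hasDerivAt τ
      (h4.differentiableAt (by simp)).hasDerivAt).deriv
  have hθ2 := ((hθ.fderiv_right (m := 1) (by norm_num)).differentiableAt (by simp)).hasFDerivAt
  have h5 : deriv (deriv (fun τ ↦ θ (c τ))) t =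
      fderiv ℝ (fderiv ℝ θ) y (deriv c t) (deriv c t) + fderiv ℝ θ y (deriv (deriv c) t) := by
    rw [(show deriv (fun τ ↦ θ (c τ)) =ᶠ[𝓝 t] _ from hθc).deriv_eq]
    rw [← hy] at hθ2 ⊢
    exact ((hθ2.comp_hasDerivAt t hc1).clm_apply hc2).deriv
  have h6 := (h (deriv (deriv c) t) w).eq_of_nhds
  rw [residual, residual, h5, hθc.self_of_nhds, hy, christ_pullback h1 h2 hθ h hsymm, h6]
  simp only [map_add, add_apply]
  ring

end VectorSpace

end LeviCivita

/-! ### Isometries and geodesics -/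

section Isometries

open Filter Topology

variable {d : ℕ} {N : Type*} [TopologicalSpace N]
  [ChartedSpace (EuclideanSpace ℝ (Fin d)) N] [IsManifold (𝓡 d) ∞ N]

namespace PseudoMetric

variable (g : PseudoMetric d N)

lemma differentiableAt_gram {x : N} {y : Eu d} (hy : y ∈ chartRan (Eu d) x) :
    DifferentiableAt ℝ (gram g.form x) y := (g.contDiffAt_gram hy).differentiableAt (by simp)

lemma christoffel_eq {x : N} {y : Eu d} (hy : y ∈ chartRan (Eu d) x) (u v w : Eu d) :
    g.christoffel x y u v w = christ (gram g.form x) y u v w := by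
  have h := g.differentiableAt_gram hy
  rw [christ, ← fderiv_apply_apply h, ← fderiv_apply_apply h, ← fderiv_apply_apply h]
  rfl

lemma gram_symm (x : N) (y v w : Eu d) : gram g.form x y v w = gram g.form x y w v :=
  g.form_symm _ _ _

lemma eq_zero_of_gram {x : N} {y : Eu d} (hy : y ∈ chartRan (Eu d) x) {v : Eu d}
    (h : ∀ w, gram g.form x y v w = 0) : v = 0 := by
  have h1 : tderiv (Eu d) (Eu d) (chartInv (Eu d) x) y v = 0 := by
    refine g.eq_zero_of_form (chartInv (Eu d) x y) fun w ↦ ?_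
    have h2 := h (tderiv (Eu d) (Eu d) (chartMap (Eu d) x) (chartInv (Eu d) x y) w)
    have h3 := tderiv_chartInv_tderiv_chartMap (chartInv_mem hy) w
    rw [chartMap_chartInv hy] at h3
    rwa [gram_apply, h3] at h2
  rw [← tderiv_chartMap_tderiv_chartInv hy v, h1, map_zero]

lemma isGeodesicOn_iff {γ : ℝ → N} {s : Set ℝ} : g.IsGeodesicOn γ s ↔
    ContMDiffOn 𝓘(ℝ, ℝ) (𝓡 d) ∞ γ s ∧ ∀ t ∈ s, ∀ w,
      residual (gram g.form (γ t)) (fun τ ↦ chartMap (Eu d) (γ t) (γ τ)) t w = 0 := by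
  refine and_congr Iff.rfl (forall₂_congr fun t _ ↦ forall_congr' fun w ↦ ?_)
  have h := g.christoffel_eq (chartMap_self_mem (E := Eu d) (γ t))
    (deriv (fun τ ↦ chartMap (Eu d) (γ t) (γ τ)) t) (deriv (fun τ ↦ chartMap (Eu d) (γ t) (γ τ)) t)
    w
  rw [residual, ← h]
  rfl

/-- The map `φ` is smooth and preserves the metric. -/
def IsIsometry (φ : N → N) : Prop :=
  ContMDiff 𝓘(ℝ, Eu d) 𝓘(ℝ, Eu d) ∞ φ ∧ ∀ x v w,
    g.form (φ x) (tderiv (Eu d) (Eu d) φ x v) (tderiv (Eu d) (Eu d) φ x w) = g.form x v w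

variable {g}

lemma isIsometry_id : g.IsIsometry fun x ↦ x :=
  ⟨contMDiff_id, fun x v w ↦ by rw [tderiv_id]; rfl⟩

omit [IsManifold (𝓡 d) ∞ N] in
/-- The map `φ` in the preferred charts at `x` and `x'`. -/
def _root_.ParaHermitian.chartRep (φ : N → N) (x x' : N) (z : Eu d) : Eu d :=
  chartMap (Eu d) x' (φ (chartInv (Eu d) x z))

section

variable {φ : N → N} (hφ : ContMDiff 𝓘(ℝ, Eu d) 𝓘(ℝ, Eu d) ∞ φ) {x x' : N} {z : Eu d}
  (hz : z ∈ chartRan (Eu d) x) (hz' : φ (chartInv (Eu d) x z) ∈ chartDom (Eu d) x')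
include hφ hz hz'

lemma _root_.ParaHermitian.contDiffAt_chartRep : ContDiffAt ℝ ∞ (chartRep φ x x') z := by
  rw [← contMDiffAt_iff_contDiffAt]
  exact ContMDiffAt.comp z (contMDiffAt_chartMap hz') ((hφ _).comp z (contMDiffAt_chartInv hz))

lemma _root_.ParaHermitian.fderiv_chartRep (v : Eu d) : fderiv ℝ (chartRep φ x x') z v =
    tderiv (Eu d) (Eu d) (chartMap (Eu d) x') (φ (chartInv (Eu d) x z))
      (tderiv (Eu d) (Eu d) φ (chartInv (Eu d) x z)
        (tderiv (Eu d) (Eu d) (chartInv (Eu d) x) z v)) := by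
  have h1 := (contMDiffAt_chartInv hz).mdiff
  rw [← tderiv_eq_fderiv, ← tderiv_comp_apply z (hφ.mdiff _) h1]
  exact tderiv_comp_apply (g := chartMap (Eu d) x') (f := fun z ↦ φ (chartInv (Eu d) x z)) z
    (contMDiffAt_chartMap hz').mdiff ((hφ.mdiff _).comp z h1) v

end

lemma IsIsometry.gram_eq {φ : N → N} (hφ : g.IsIsometry φ) {x x' : N} {z : Eu d}
    (hz : z ∈ chartRan (Eu d) x) (hz' : φ (chartInv (Eu d) x z) ∈ chartDom (Eu d) x') (v w : Eu d) :
    gram g.form x' (chartRep φ x x' z) (fderiv ℝ (chartRep φ x x') z v)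
      (fderiv ℝ (chartRep φ x x') z w) = gram g.form x z v w := by
  rw [fderiv_chartRep hφ.1 hz hz', fderiv_chartRep hφ.1 hz hz', chartRep, gram_chartMap _ hz',
    tderiv_chartInv_tderiv_chartMap hz', tderiv_chartInv_tderiv_chartMap hz', hφ.2, gram_apply]

lemma IsIsometry.gram_eventuallyEq {φ : N → N} (hφ : g.IsIsometry φ) {x x' : N} {z : Eu d}
    (hz : z ∈ chartRan (Eu d) x) (hz' : φ (chartInv (Eu d) x z) ∈ chartDom (Eu d) x') (v w : Eu d) :
    (fun z ↦ gram g.form x z v w) =ᶠ[𝓝 z] fun z ↦ gram g.form x' (chartRep φ x x' z)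
      (fderiv ℝ (chartRep φ x x') z v) (fderiv ℝ (chartRep φ x x') z w) := by
  have h1 : ContinuousAt (fun z ↦ φ (chartInv (Eu d) x z)) z :=
    ContinuousAt.comp (g := φ) hφ.1.continuous.continuousAt (continuousAt_chartInv hz)
  filter_upwards [(isOpen_chartRan x).mem_nhds hz,
    h1.eventually_mem ((isOpen_chartDom x').mem_nhds hz')] with z h2 h3
  exact (hφ.gram_eq h2 h3 v w).symm

section

variable {φ : N → N} (hφ : g.IsIsometry φ) {x x' p : N} (hp : p ∈ chartDom (Eu d) x)
  (hp' : φ p ∈ chartDom (Eu d) x')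
include hφ hp hp'

lemma IsIsometry.christ_eq (u v w : Eu d) :
    christ (gram g.form x) (chartMap (Eu d) x p) u v w =
      christ (gram g.form x') (chartMap (Eu d) x' (φ p))
        (fderiv ℝ (chartRep φ x x') (chartMap (Eu d) x p) u)
        (fderiv ℝ (chartRep φ x x') (chartMap (Eu d) x p) v)
        (fderiv ℝ (chartRep φ x x') (chartMap (Eu d) x p) w)
      + gram g.form x' (chartMap (Eu d) x' (φ p))
        (fderiv ℝ (fderiv ℝ (chartRep φ x x')) (chartMap (Eu d) x p) u v)
        (fderiv ℝ (chartRep φ x x') (chartMap (Eu d) x p) w) := by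
  have hz := chartMap_mem hp
  have hI := chartInv_chartMap hp
  have hz' : φ (chartInv (Eu d) x (chartMap (Eu d) x p)) ∈ chartDom (Eu d) x' := by rwa [hI]
  have he : chartRep φ x x' (chartMap (Eu d) x p) = chartMap (Eu d) x' (φ p) := by
    rw [chartRep, hI]
  have h := christ_pullback (g.differentiableAt_gram hz)
    (by rw [he]; exact g.differentiableAt_gram (chartMap_mem hp'))
    ((contDiffAt_chartRep hφ.1 hz hz').of_le ENat.LEInfty.out)
    (hφ.gram_eventuallyEq hz hz') (g.gram_symm x' _) u v w
  rwa [he] at h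

lemma IsIsometry.residual_eq {γ : ℝ → N} {t : ℝ} (hγ : ContMDiffAt 𝓘(ℝ, ℝ) 𝓘(ℝ, Eu d) ∞ γ t)
    (ht : γ t = p) (w : Eu d) :
    residual (gram g.form x) (fun τ ↦ chartMap (Eu d) x (γ τ)) t w =
      residual (gram g.form x') (fun τ ↦ chartMap (Eu d) x' (φ (γ τ))) t
        (fderiv ℝ (chartRep φ x x') (chartMap (Eu d) x p) w) := by
  have hz := chartMap_mem hp
  have hI := chartInv_chartMap hp
  have hz' : φ (chartInv (Eu d) x (chartMap (Eu d) x p)) ∈ chartDom (Eu d) x' := by rwa [hI]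
  have he : chartRep φ x x' (chartMap (Eu d) x p) = chartMap (Eu d) x' (φ p) := by
    rw [chartRep, hI]
  subst ht
  have hc : ContDiffAt ℝ ∞ (fun τ ↦ chartMap (Eu d) x (γ τ)) t := by
    rw [← contMDiffAt_iff_contDiffAt]
    exact ContMDiffAt.comp t (contMDiffAt_chartMap hp) hγ
  have h := residual_pullback (g.differentiableAt_gram hz)
    (by rw [he]; exact g.differentiableAt_gram (chartMap_mem hp'))
    ((contDiffAt_chartRep hφ.1 hz hz').of_le ENat.LEInfty.out)
    (hφ.gram_eventuallyEq hz hz') (g.gram_symm x' _) (hc.of_le ENat.LEInfty.out) rfl w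
  have e : ∀ᶠ τ in 𝓝 t, chartRep φ x x' (chartMap (Eu d) x (γ τ)) =
      chartMap (Eu d) x' (φ (γ τ)) := by
    filter_upwards [hγ.continuousAt.eventually_mem ((isOpen_chartDom x).mem_nhds hp)] with τ hτ
    rw [chartRep, chartInv_chartMap hτ]
  have e' : (fun τ ↦ chartRep φ x x' (chartMap (Eu d) x (γ τ))) =ᶠ[𝓝 t]
      fun τ ↦ chartMap (Eu d) x' (φ (γ τ)) := e
  rw [h, residual, residual, e'.deriv.deriv_eq, e'.deriv_eq, e.self_of_nhds]

/-- Isometries are local diffeomorphisms. -/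
lemma IsIsometry.surjective_fderiv :
    Function.Surjective (fderiv ℝ (chartRep φ x x') (chartMap (Eu d) x p)) := by
  have hz := chartMap_mem hp
  have hz' : φ (chartInv (Eu d) x (chartMap (Eu d) x p)) ∈ chartDom (Eu d) x' := by
    rwa [chartInv_chartMap hp]
  refine (LinearMap.injective_iff_surjective (f := (fderiv ℝ (chartRep φ x x')
    (chartMap (Eu d) x p)).toLinearMap)).1 ?_
  refine (injective_iff_map_eq_zero _).2 fun v hv ↦ g.eq_zero_of_gram hz fun w ↦ ?_
  rw [← hφ.gram_eq hz hz', show fderiv ℝ (chartRep φ x x') (chartMap (Eu d) x p) v = 0 from hv,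
    map_zero, zero_apply]

lemma IsIsometry.residual_eq_zero_iff {γ : ℝ → N} {t : ℝ}
    (hγ : ContMDiffAt 𝓘(ℝ, ℝ) 𝓘(ℝ, Eu d) ∞ γ t) (ht : γ t = p) :
    (∀ w, residual (gram g.form x) (fun τ ↦ chartMap (Eu d) x (γ τ)) t w = 0) ↔
      ∀ w, residual (gram g.form x') (fun τ ↦ chartMap (Eu d) x' (φ (γ τ))) t w = 0 := by
  refine ⟨fun h w ↦ ?_, fun h w ↦ ?_⟩
  · obtain ⟨w, rfl⟩ := hφ.surjective_fderiv hp hp' w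
    rw [← hφ.residual_eq hp hp' hγ ht, h]
  · rw [hφ.residual_eq hp hp' hγ ht, h]

end

/-- The geodesic equation can be checked in any chart. -/
lemma isGeodesicOn_iff_of_chart (x : N) {γ : ℝ → N} {s : Set ℝ} (hs : IsOpen s)
    (h : ∀ t ∈ s, γ t ∈ chartDom (Eu d) x) : g.IsGeodesicOn γ s ↔
      ContMDiffOn 𝓘(ℝ, ℝ) (𝓡 d) ∞ γ s ∧ ∀ t ∈ s, ∀ w,
        residual (gram g.form x) (fun τ ↦ chartMap (Eu d) x (γ τ)) t w = 0 := by
  rw [isGeodesicOn_iff]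
  refine and_congr_right fun hγ ↦ forall₂_congr fun t ht ↦ ?_
  exact isIsometry_id.residual_eq_zero_iff (mem_chartDom (γ t)) (h t ht)
    (hγ.contMDiffAt (hs.mem_nhds ht)) rfl

lemma IsIsometry.isGeodesicOn {φ : N → N} (hφ : g.IsIsometry φ) {γ : ℝ → N} {s : Set ℝ}
    (hs : IsOpen s) (h : g.IsGeodesicOn γ s) : g.IsGeodesicOn (fun t ↦ φ (γ t)) s := by
  rw [isGeodesicOn_iff] at h ⊢
  refine ⟨hφ.1.comp_contMDiffOn h.1, fun t ht ↦ ?_⟩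
  exact (hφ.residual_eq_zero_iff (mem_chartDom (γ t)) (mem_chartDom (φ (γ t)))
    (h.1.contMDiffAt (hs.mem_nhds ht)) rfl).1 (h.2 t ht)

end PseudoMetric

end Isometries

/-! ### Existence of geodesics and the derivative of a symmetry -/

section Geodesics

open Filter Topology

/-- Integral curves of smooth vector fields are smooth. -/
lemma contDiffOn_of_hasDerivAt {E : Type*} [NormedAddCommGroup E] [NormedSpace ℝ E] {F : E → E}
    {U : Set E} (hF : ContDiffOn ℝ ∞ F U) {α : ℝ → E} {s : Set ℝ} (hs : IsOpen s)
    (hU : ∀ t ∈ s, α t ∈ U) (hα : ∀ t ∈ s, HasDerivAt α (F (α t)) t) : ContDiffOn ℝ ∞ α s := by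
  refine contDiffOn_infty.2 fun k ↦ ?_
  induction k with
  | zero => exact contDiffOn_zero.2 fun t ht ↦ (hα t ht).continuousAt.continuousWithinAt
  | succ k ih =>
    rw [Nat.cast_add, Nat.cast_one, contDiffOn_succ_iff_deriv_of_isOpen hs]
    refine ⟨fun t ht ↦ (hα t ht).differentiableAt.differentiableWithinAt, by simp, ?_⟩
    exact ((hF.of_le (by exact_mod_cast le_top)).comp ih hU).congr fun t ht ↦ (hα t ht).deriv

section Spray

variable {E : Type*} [NormedAddCommGroup E] [NormedSpace ℝ E] [FiniteDimensional ℝ E]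
  {G : E → E →L[ℝ] E →L[ℝ] ℝ}

/-- The Christoffel symbols `Γ(p, p; ·)` at `y`, as a function of the pair `(y, p)`. -/
def christDual (G : E → E →L[ℝ] E →L[ℝ] ℝ) (q : E × E) : E →L[ℝ] ℝ :=
  fderiv ℝ G q.1 q.2 q.2 - (1 / 2 : ℝ) • ((fderiv ℝ G q.1).flip q.2).flip q.2

lemma christDual_apply (q : E × E) (w : E) : christDual G q w = christ G q.1 q.2 q.2 w := by
  simp [christDual, christ]
  ring

set_option maxSynthPendingDepth 4 in
lemma contDiffAt_christDual {q : E × E} (hG : ContDiffAt ℝ ∞ G q.1) :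
    ContDiffAt ℝ ∞ (christDual G) q := by
  have h1 := ContDiffAt.comp (g := fderiv ℝ G) (f := Prod.fst (β := E)) q
    (hG.fderiv_right (m := ∞) (by simp)) contDiffAt_fst
  refine contDiffAt_clm_of_apply fun w ↦ ?_
  have h2 := ((h1.clm_apply contDiffAt_snd).clm_apply contDiffAt_snd).clm_apply
    (contDiffAt_const (c := w))
  have h3 := ((h1.clm_apply (contDiffAt_const (c := w))).clm_apply contDiffAt_snd).clm_apply
    contDiffAt_snd
  simpa [christDual] using h2.sub (h3.const_smul (1 / 2 : ℝ))

lemma exists_equiv_of_injective (A : E →L[ℝ] E →L[ℝ] ℝ) (hA : ∀ v, A v = 0 → v = 0) :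
    ∃ e : E ≃L[ℝ] (E →L[ℝ] ℝ), (e : E →L[ℝ] E →L[ℝ] ℝ) = A := by
  have h1 : finrank ℝ E = finrank ℝ (E →L[ℝ] ℝ) := by
    rw [← (LinearMap.toContinuousLinearMap : (E →ₗ[ℝ] ℝ) ≃ₗ[ℝ] E →L[ℝ] ℝ).finrank_eq]
    exact (Subspace.dual_finrank_eq (K := ℝ) (V := E)).symm
  have h2 : Function.Injective A.toLinearMap := (injective_iff_map_eq_zero _).2 hA
  refine ⟨(LinearEquiv.ofInjectiveOfFinrankEq A.toLinearMap h2 h1).toContinuousLinearEquiv, ?_⟩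
  ext v w
  rfl

/-- The geodesic spray. -/
def spray (G : E → E →L[ℝ] E →L[ℝ] ℝ) (q : E × E) : E × E :=
  (q.2, -(G q.1).inverse (christDual G q))

lemma contDiffAt_spray {q : E × E} (hG : ContDiffAt ℝ ∞ G q.1) (h : ∀ v, G q.1 v = 0 → v = 0) :
    ContDiffAt ℝ ∞ (spray G) q := by
  obtain ⟨e, he⟩ := exists_equiv_of_injective _ h
  have h1 : ContDiffAt ℝ ∞ ContinuousLinearMap.inverse (G q.1) := by
    rw [← he]; exact contDiffAt_map_inverse e
  have h2 := ContDiffAt.comp (g := ContinuousLinearMap.inverse) (f := fun q : E × E ↦ G q.1) q h1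
    (ContDiffAt.comp (g := G) (f := Prod.fst (β := E)) q hG contDiffAt_fst)
  exact contDiffAt_snd.prodMk (h2.clm_apply (contDiffAt_christDual hG)).neg

lemma apply_spray {q : E × E} (h : ∀ v, G q.1 v = 0 → v = 0) :
    G q.1 (spray G q).2 = -christDual G q := by
  obtain ⟨e, he⟩ := exists_equiv_of_injective _ h
  rw [spray, ← he]
  simp

/-- Short geodesics exist in every direction. -/
lemma exists_residual_eq_zero {U : Set E} (hU : IsOpen U) (hG : ∀ y ∈ U, ContDiffAt ℝ ∞ G y)
    (h : ∀ y ∈ U, ∀ v, G y v = 0 → v = 0) {y : E} (hy : y ∈ U) (v : E) :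
    ∃ c : ℝ → E, ∃ ε > 0, c 0 = y ∧ deriv c 0 = v ∧ ContDiffOn ℝ ∞ c (Set.Ioo (-ε) ε) ∧
      ∀ t ∈ Set.Ioo (-ε) ε, c t ∈ U ∧ ∀ w, residual G c t w = 0 := by
  have hF (q : E × E) (hq : q.1 ∈ U) : ContDiffAt ℝ ∞ (spray G) q :=
    contDiffAt_spray (hG _ hq) (h _ hq)
  obtain ⟨α, hα0, ε, hε, hα⟩ := ((hF (y, v) hy).of_le
    (ENat.LEInfty.out : (1 : WithTop ℕ∞) ≤ ∞)
    ).exists_forall_mem_closedBall_exists_eq_forall_mem_Ioo_hasDerivAt₀ 0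
  rw [zero_sub, zero_add] at hα
  have hmem : ∀ᶠ t in 𝓝 (0 : ℝ), (α t).1 ∈ U := by
    have h1 : ContinuousAt (fun t ↦ (α t).1) 0 :=
      continuousAt_fst.comp (hα 0 ⟨by linarith, hε⟩).continuousAt
    exact h1.eventually_mem (hU.mem_nhds (by rw [hα0]; exact hy))
  obtain ⟨δ, hδ, hmem⟩ := Metric.eventually_nhds_iff_ball.1 hmem
  rw [Real.ball_eq_Ioo, zero_sub, zero_add] at hmem
  have hsub1 : Set.Ioo (-min ε δ) (min ε δ) ⊆ Set.Ioo (-ε) ε :=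
    Set.Ioo_subset_Ioo (neg_le_neg (min_le_left _ _)) (min_le_left _ _)
  have hsub2 : Set.Ioo (-min ε δ) (min ε δ) ⊆ Set.Ioo (-δ) δ :=
    Set.Ioo_subset_Ioo (neg_le_neg (min_le_right _ _)) (min_le_right _ _)
  have h1 (t) (ht : t ∈ Set.Ioo (-ε) ε) : HasDerivAt (fun t ↦ (α t).1) (α t).2 t :=
    (hα t ht).fst
  have h2 (t) (ht : t ∈ Set.Ioo (-ε) ε) : HasDerivAt (fun t ↦ (α t).2) (spray G (α t)).2 t :=
    (hα t ht).snd
  have h3 (t) (ht : t ∈ Set.Ioo (-ε) ε) : deriv (deriv fun t ↦ (α t).1) t = (spray G (α t)).2 := by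
    have : deriv (fun t ↦ (α t).1) =ᶠ[𝓝 t] fun t ↦ (α t).2 := by
      filter_upwards [isOpen_Ioo.mem_nhds ht] with τ hτ using (h1 τ hτ).deriv
    rw [this.deriv_eq, (h2 t ht).deriv]
  have h0 : (0 : ℝ) ∈ Set.Ioo (-ε) ε := ⟨by linarith, hε⟩
  refine ⟨fun t ↦ (α t).1, min ε δ, lt_min hε hδ, congrArg Prod.fst hα0, by rw [(h1 0 h0).deriv, hα0],
    ?_, fun t ht ↦ ⟨hmem t (hsub2 ht), fun w ↦ ?_⟩⟩
  · refine contDiff_fst.comp_contDiffOn (contDiffOn_of_hasDerivAt (U := {q : E × E | q.1 ∈ U})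
      (fun q hq ↦ (hF q hq).contDiffWithinAt) isOpen_Ioo (fun t ht ↦ hmem t (hsub2 ht))
      fun t ht ↦ hα t (hsub1 ht))
  · have ht' := hsub1 ht
    rw [residual, h3 t ht', (h1 t ht').deriv, apply_spray (h _ (hmem t (hsub2 ht))), neg_apply,
      christDual_apply]
    ring

end Spray

variable {d : ℕ} {N : Type*} [TopologicalSpace N]
  [ChartedSpace (EuclideanSpace ℝ (Fin d)) N] [IsManifold (𝓡 d) ∞ N]

lemma PseudoMetric.exists_isGeodesicOn (g : PseudoMetric d N) (x : N) (v : Eu d) :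
    ∃ γ : ℝ → N, ∃ ε > 0, g.IsGeodesicOn γ (Set.Ioo (-ε) ε) ∧ γ 0 = x ∧
      tderiv ℝ (Eu d) γ 0 1 = v := by
  obtain ⟨c, ε, hε, hc0, hcv, hc, hct⟩ := exists_residual_eq_zero (isOpen_chartRan x)
    (fun y hy ↦ g.contDiffAt_gram hy)
    (fun y hy v hv ↦ g.eq_zero_of_gram hy fun w ↦ by rw [hv, zero_apply])
    (chartMap_self_mem (E := Eu d) x) v
  have hcM : ContMDiffOn 𝓘(ℝ, ℝ) 𝓘(ℝ, Eu d) ∞ c (Set.Ioo (-ε) ε) := hc.contMDiffOn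
  have hγ (t) (ht : t ∈ Set.Ioo (-ε) ε) :
      ContMDiffAt 𝓘(ℝ, ℝ) 𝓘(ℝ, Eu d) ∞ (fun t ↦ chartInv (Eu d) x (c t)) t :=
    ContMDiffAt.comp t (contMDiffAt_chartInv (hct t ht).1)
      (hcM.contMDiffAt (isOpen_Ioo.mem_nhds ht))
  have h0 : (0 : ℝ) ∈ Set.Ioo (-ε) ε := ⟨by linarith, hε⟩
  refine ⟨fun t ↦ chartInv (Eu d) x (c t), ε, hε, ?_, ?_, ?_⟩
  · refine (g.isGeodesicOn_iff_of_chart x isOpen_Ioo fun t ht ↦ chartInv_mem (hct t ht).1).2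
      ⟨fun t ht ↦ (hγ t ht).contMDiffWithinAt, fun t ht w ↦ ?_⟩
    have e : (fun τ ↦ chartMap (Eu d) x (chartInv (Eu d) x (c τ))) =ᶠ[𝓝 t] c := by
      filter_upwards [isOpen_Ioo.mem_nhds ht] with τ hτ using chartMap_chartInv (hct τ hτ).1
    rw [residual, e.deriv.deriv_eq, e.deriv_eq]
    have e0 : chartMap (Eu d) x (chartInv (Eu d) x (c t)) = c t := e.self_of_nhds
    rw [e0]
    exact (hct t ht).2 w
  · change chartInv (Eu d) x (c 0) = x
    rw [hc0, chartInv_chartMap_self]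
  · rw [tderiv_comp_apply (g := chartInv (Eu d) x) (f := c) (0 : ℝ)
      (contMDiffAt_chartInv (hct 0 h0).1).mdiff (hcM.contMDiffAt (isOpen_Ioo.mem_nhds h0)).mdiff,
      tderiv_eq_fderiv, fderiv_apply_one_eq_deriv, hcv, hc0, tderiv_chartInv_self]
    rfl

variable {n : ℕ} {N : Type*} [TopologicalSpace N]
  [ChartedSpace (EuclideanSpace ℝ (Fin (2 * n))) N] [IsManifold (𝓡 (2 * n)) ∞ N]
  {J : ParaComplex n N} {g : PseudoMetric (2 * n) N} {o : N}
  {s : Diffeomorph (𝓡 (2 * n)) (𝓡 (2 * n)) N N ∞}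

lemma IsSymmetryAt.apply_self (h : IsSymmetryAt J g o s) : s o = o := by
  obtain ⟨γ, ε, hε, hγ, h0, -⟩ := g.exists_isGeodesicOn o 0
  have := h.2 γ ε hε hγ h0 0 ⟨by linarith, hε⟩
  rwa [neg_zero, h0] at this

/-- A symmetry at `o` reverses the geodesics through `o`, which exist in every direction. -/
lemma IsSymmetryAt.tderiv_eq (h : IsSymmetryAt J g o s) (v : Eu (2 * n)) :
    tderiv (Eu (2 * n)) (Eu (2 * n)) s o v = -v := by
  obtain ⟨γ, ε, hε, hγ, h0, hv⟩ := g.exists_isGeodesicOn o v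
  have hmem : (0 : ℝ) ∈ Set.Ioo (-ε) ε := ⟨by linarith, hε⟩
  have hγd : MDifferentiableAt 𝓘(ℝ, ℝ) 𝓘(ℝ, Eu (2 * n)) γ 0 :=
    (hγ.1.contMDiffAt (isOpen_Ioo.mem_nhds hmem)).mdiff
  have hs : ContMDiff 𝓘(ℝ, Eu (2 * n)) 𝓘(ℝ, Eu (2 * n)) ∞ s := s.contMDiff
  have h1 := tderiv_comp_apply (g := s) (f := γ) (0 : ℝ) (hs.mdiff _) hγd 1
  have e : (fun t ↦ s (γ t)) =ᶠ[𝓝 0] fun t ↦ γ (-t) := by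
    filter_upwards [isOpen_Ioo.mem_nhds hmem] with t ht using h.2 γ ε hε hγ h0 t ht
  have hneg : DifferentiableAt ℝ (fun t : ℝ ↦ -t) 0 := differentiableAt_id.neg
  have h2 := tderiv_comp_apply (g := γ) (f := fun t : ℝ ↦ -t) (0 : ℝ) (by simpa using hγd)
    hneg.mdifferentiableAt 1
  have h3 : tderiv ℝ ℝ (fun t : ℝ ↦ -t) 0 1 = -1 := by
    rw [tderiv_eq_fderiv, fderiv_apply_one_eq_deriv]; simp
  rw [e.tderiv_eq, h2, h3, neg_zero, map_neg, hv, h0] at h1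
  exact h1.symm

end Geodesics

/-! ### The orbit map is a submersion -/

section OrbitMap

open Filter Topology

attribute [local instance] isManifold_group

variable {m : ℕ} {G : Type*} [TopologicalSpace G] [ChartedSpace (EuclideanSpace ℝ (Fin m)) G]
  [Group G] [LieGroup (𝓡 m) ∞ G]

lemma contMDiffAt_integralCurve {X : GroupLieAlgebra (𝓡 m) G} {c : ℝ → G} (h0 : c 0 = 1)
    (hc : IsMIntegralCurve c (mulInvariantVectorField (I := 𝓡 m) X)) :
    ContMDiffAt 𝓘(ℝ, ℝ) 𝓘(ℝ, Eu m) ∞ c 0 := by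
  have hc' := isMIntegralCurve_iff.1 hc
  have hcc : Continuous c := continuous_iff_continuousAt.2 fun t ↦ (hc' t).1.continuousAt
  have hs : IsOpen (c ⁻¹' chartDom (Eu m) (1 : G)) := (isOpen_chartDom 1).preimage hcc
  have h0s : (0 : ℝ) ∈ c ⁻¹' chartDom (Eu m) (1 : G) := by
    rw [Set.mem_preimage, h0]; exact mem_chartDom 1
  have hV (X : Eu m) : ContDiffOn ℝ ∞ (fun z ↦ fderiv ℝ (chartMul m G) (z, chartOne m G) (0, X))
      (chartRan (Eu m) (1 : G)) := by
    intro z hz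
    have h1 := contDiffAt_chartMul hz chartOne_mem
      (by rw [chartInv_chartOne, mul_one]; exact chartInv_mem hz)
    have h2 : ContDiffAt ℝ ∞ (fun z : Eu m ↦ (z, chartOne m G)) z :=
      contDiffAt_id.prodMk contDiffAt_const
    have h3 := ContDiffAt.comp (g := fderiv ℝ (chartMul m G)) z
      (h1.fderiv_right (m := ∞) (by simp)) h2
    exact (h3.clm_apply (contDiffAt_const (c := ((0 : Eu m), X)))).contDiffWithinAt
  have hy : ContDiffOn ℝ ∞ (fun t ↦ chartMap (Eu m) (1 : G) (c t))
      (c ⁻¹' chartDom (Eu m) (1 : G)) := by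
    refine contDiffOn_of_hasDerivAt (hV X) hs (fun t ht ↦ chartMap_mem ht) fun t ht ↦ ?_
    have hφ := (contMDiffAt_chartMap (E := Eu m) (x := (1 : G)) (y := c t) ht).mdiff
    have h1 : DifferentiableAt ℝ (fun t ↦ chartMap (Eu m) (1 : G) (c t)) t :=
      mdifferentiableAt_iff_differentiableAt.1 (hφ.comp t (hc' t).1)
    have h2 : deriv (fun t ↦ chartMap (Eu m) (1 : G) (c t)) t =
        fderiv ℝ (chartMul m G) (chartMap (Eu m) (1 : G) (c t), chartOne m G) (0, X) := by
      rw [← fderiv_apply_one_eq_deriv, ← tderiv_eq_fderiv, tderiv_comp_apply t hφ (hc' t).1]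
      refine Eq.trans ?_ (fderiv_chartMul_right (chartMap_mem ht) X).symm
      rw [chartInv_chartMap ht]
      exact congrArg _ (hc' t).2
    rw [← h2]
    exact h1.hasDerivAt
  have hyM : ContMDiffAt 𝓘(ℝ, ℝ) 𝓘(ℝ, Eu m) ∞ (fun t ↦ chartMap (Eu m) (1 : G) (c t)) 0 :=
    (hy.contDiffAt (hs.mem_nhds h0s)).contMDiffAt
  have h1 : ContMDiffAt 𝓘(ℝ, ℝ) 𝓘(ℝ, Eu m) ∞
      (fun t ↦ chartInv (Eu m) (1 : G) (chartMap (Eu m) (1 : G) (c t))) 0 :=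
    ContMDiffAt.comp 0 (contMDiffAt_chartInv (chartMap_mem h0s)) hyM
  refine h1.congr_of_eventuallyEq ?_
  filter_upwards [hs.mem_nhds h0s] with t ht using (chartInv_chartMap ht).symm

section Product

variable {S T : Type*} [NormedAddCommGroup S] [NormedSpace ℝ S] [NormedAddCommGroup T]
  [NormedSpace ℝ T] {A : S → G} {B : T → G} (hA0 : A 0 = 1) (hB0 : B 0 = 1)
  (hA : ContMDiffAt 𝓘(ℝ, S) 𝓘(ℝ, Eu m) ∞ A 0) (hB : ContMDiffAt 𝓘(ℝ, T) 𝓘(ℝ, Eu m) ∞ B 0)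
include hA hB

lemma contMDiffAt_mul_prod :
    ContMDiffAt 𝓘(ℝ, S × T) 𝓘(ℝ, Eu m) ∞ (fun q : S × T ↦ A q.1 * B q.2) 0 := by
  have f1 : ContMDiffAt 𝓘(ℝ, S × T) 𝓘(ℝ, S) ∞ Prod.fst (0 : S × T) := contDiffAt_fst.contMDiffAt
  have f2 : ContMDiffAt 𝓘(ℝ, S × T) 𝓘(ℝ, T) ∞ Prod.snd (0 : S × T) := contDiffAt_snd.contMDiffAt
  exact (ContMDiffAt.comp (0 : S × T) (f := Prod.fst) hA f1).mul
    (ContMDiffAt.comp (0 : S × T) (f := Prod.snd) hB f2)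

include hA0 hB0 in
lemma tderiv_mul_prod (v : S) (w : T) :
    tderiv (S × T) (Eu m) (fun q : S × T ↦ A q.1 * B q.2) 0 (v, w) =
      tderiv S (Eu m) A 0 v + tderiv T (Eu m) B 0 w := by
  have hF := (contMDiffAt_mul_prod hA hB).mdiff
  have i1 : HasFDerivAt (fun x : S ↦ (x, (0 : T))) (ContinuousLinearMap.inl ℝ S T) 0 :=
    hasFDerivAt_prodMk_left 0 0
  have i2 : HasFDerivAt (fun x : T ↦ ((0 : S), x)) (ContinuousLinearMap.inr ℝ S T) 0 :=
    hasFDerivAt_prodMk_right 0 0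
  have h1 := tderiv_comp_apply (g := fun q : S × T ↦ A q.1 * B q.2)
    (f := fun x : S ↦ (x, (0 : T))) (0 : S) hF i1.differentiableAt.mdifferentiableAt v
  have h2 := tderiv_comp_apply (g := fun q : S × T ↦ A q.1 * B q.2)
    (f := fun x : T ↦ ((0 : S), x)) (0 : T) hF i2.differentiableAt.mdifferentiableAt w
  rw [tderiv_eq_fderiv, i1.fderiv] at h1
  rw [tderiv_eq_fderiv, i2.fderiv] at h2
  simp only [hA0, hB0, one_mul, mul_one, ContinuousLinearMap.inl_apply,
    ContinuousLinearMap.inr_apply] at h1 h2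
  rw [h1, h2]
  change _ = tderiv (S × T) (Eu m) (fun q : S × T ↦ A q.1 * B q.2) 0 (v, 0) +
    tderiv (S × T) (Eu m) (fun q : S × T ↦ A q.1 * B q.2) 0 (0, w)
  rw [← map_add]
  simp

end Product

/-- A smooth map to `G` whose derivative is onto is open at the point in question. -/
lemma map_nhds_eq_of_surjective {S : Type*} [NormedAddCommGroup S] [NormedSpace ℝ S]
    [CompleteSpace S] {A : S → G} (hA0 : A 0 = 1) (hA : ContMDiffAt 𝓘(ℝ, S) 𝓘(ℝ, Eu m) ∞ A 0)
    (hs : Function.Surjective (tderiv S (Eu m) A 0)) {W : Set S} (hW : W ∈ 𝓝 0) :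
    A '' W ∈ 𝓝 (1 : G) := by
  have hφ : ContMDiffAt 𝓘(ℝ, Eu m) 𝓘(ℝ, Eu m) ∞ (chartMap (Eu m) (1 : G)) (A 0) := by
    rw [hA0]; exact contMDiffAt_chartMap (mem_chartDom 1)
  have h1 : ContDiffAt ℝ ∞ (fun s ↦ chartMap (Eu m) (1 : G) (A s)) 0 := by
    rw [← contMDiffAt_iff_contDiffAt]; exact ContMDiffAt.comp 0 hφ hA
  have h2 := h1.hasStrictFDerivAt (by simp)
  have h3 : fderiv ℝ (fun s ↦ chartMap (Eu m) (1 : G) (A s)) 0 = tderiv S (Eu m) A 0 := by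
    ext1 v
    rw [← tderiv_eq_fderiv, tderiv_comp_apply 0 hφ.mdiff hA.mdiff, hA0, tderiv_chartMap_self]
    rfl
  have h4 := h2.map_nhds_eq_of_surj (by rw [h3]; exact LinearMap.range_eq_top.2 hs)
  have hdom : ∀ᶠ s in 𝓝 (0 : S), A s ∈ chartDom (Eu m) (1 : G) :=
    hA.continuousAt.eventually_mem (by rw [hA0]; exact (isOpen_chartDom 1).mem_nhds (mem_chartDom 1))
  have h5 := h4 ▸ image_mem_map (inter_mem hW hdom)
  rw [hA0] at h5
  filter_upwards [(continuousAt_chartMap (mem_chartDom (E := Eu m) (1 : G))).preimage_mem_nhds h5,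
    (isOpen_chartDom (E := Eu m) (1 : G)).mem_nhds (mem_chartDom 1)] with a ⟨s, ⟨hs1, hs2⟩, hs3⟩ ha
  refine ⟨s, hs1, ?_⟩
  rw [← chartInv_chartMap ha, ← hs3, chartInv_chartMap hs2]

variable {d : ℕ} {N : Type*} [TopologicalSpace N] [ChartedSpace (EuclideanSpace ℝ (Fin d)) N]
  [MulAction G N] [IsManifold (𝓡 d) ∞ N] [T2Space N] [T2Space G]

/-- Products of one-parameter groups of isotropies exhaust any finite set of directions. -/
lemma exists_isotropy_family (hs : SmoothAction m G d N) (o : N)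
    (l : List (GroupLieAlgebra (𝓡 m) G)) (hl : ∀ X ∈ l, orbitDeriv m G d o X = 0) :
    ∃ (T : Type) (_ : NormedAddCommGroup T) (_ : NormedSpace ℝ T) (_ : CompleteSpace T)
      (η : T → G), η 0 = 1 ∧ ContMDiffAt 𝓘(ℝ, T) 𝓘(ℝ, Eu m) ∞ η 0 ∧
      (∀ t, η t ∈ MulAction.stabilizer G o) ∧ ∀ X ∈ l, ∃ t, tderiv T (Eu m) η 0 t = (X : Eu m) := by
  induction l with
  | nil => exact ⟨ℝ, inferInstance, inferInstance, inferInstance, fun _ ↦ 1, rfl,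
      contMDiffAt_const, fun _ ↦ one_mem _, by simp⟩
  | cons W l ih =>
    obtain ⟨T, _, _, _, η, h0, hη, hmem, hX⟩ := ih fun X hX ↦ hl X (List.mem_cons_of_mem _ hX)
    obtain ⟨c, hc0, hc⟩ := exists_exp W
    have hcs := contMDiffAt_integralCurve hc0 hc
    have hcW : tderiv ℝ (Eu m) c 0 1 = (W : Eu m) :=
      ((isMIntegralCurve_iff.1 hc) 0).2.trans (by rw [hc0]; exact leftField_one W)
    refine ⟨T × ℝ, inferInstance, inferInstance, inferInstance, fun q ↦ η q.1 * c q.2,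
      by simp [h0, hc0], contMDiffAt_mul_prod hη hcs, fun q ↦ mul_mem (hmem _)
      (curve_mem_stabilizer hs hc0 hc (hl W List.mem_cons_self) _), fun X hXl ↦ ?_⟩
    rcases List.mem_cons.1 hXl with rfl | hXl
    · refine ⟨(0, 1), ?_⟩
      rw [tderiv_mul_prod h0 hc0 hη hcs, hcW, map_zero]
      exact zero_add (M := Eu m) X
    · obtain ⟨t, ht⟩ := hX X hXl
      refine ⟨(t, 0), ?_⟩
      rw [tderiv_mul_prod h0 hc0 hη hcs, ht, map_zero]
      exact add_zero (M := Eu m) X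

variable [SecondCountableTopology G]

/-- The orbit map of a transitive action is a submersion. Let `K` be a complement of the isotropy
algebra. Near `1`, every element of `G` is a product of an element of a `dim K`-dimensional
submanifold and an isotropy. Hence a neighbourhood of `o`, which is the image of a neighbourhood of
`1` as the orbit map is open by Baire's theorem, is a smooth image of a neighbourhood in `K`. If the
orbit map were not a submersion, `dim K` would be less than `dim N`, and the complement of the image
would be dense. -/
theorem surjective_orbitDeriv (hs : SmoothAction m G d N) [MulAction.IsPretransitive G N] (o : N) :
    Function.Surjective (orbitDeriv m G d o) := by
  set p := orbitDeriv m G d o with hp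
  by_contra hcon
  have hlt : finrank ℝ p.toLinearMap.range < finrank ℝ (Eu d) :=
    Submodule.finrank_lt fun h ↦ hcon (LinearMap.range_eq_top.1 h)
  obtain ⟨K, hK⟩ := Submodule.exists_isCompl p.toLinearMap.ker
  have hKd : finrank ℝ K < finrank ℝ (Eu d) := by
    have h1 := Submodule.finrank_add_eq_of_isCompl hK
    have h2 := LinearMap.finrank_range_add_finrank_ker p.toLinearMap
    omega
  obtain ⟨S, hS⟩ := (IsNoetherian.noetherian p.toLinearMap.ker : p.toLinearMap.ker.FG)
  obtain ⟨T, _, _, _, η, h0, hη, hmem, hX⟩ := exists_isotropy_family hs o S.toList fun X hX ↦ by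
    have : (X : Eu m) ∈ p.toLinearMap.ker := hS ▸ Submodule.subset_span (Finset.mem_toList.1 hX)
    exact this
  have hker : p.toLinearMap.ker ≤ (tderiv T (Eu m) η 0).toLinearMap.range := by
    rw [← hS, Submodule.span_le]
    intro X hXS
    exact hX X (Finset.mem_toList.2 hXS)
  let A : K → G := fun k ↦ chartInv (Eu m) (1 : G) (chartOne m G + k)
  have hA0 : A 0 = 1 := by simp [A, chartInv_chartOne]
  have hadd : HasFDerivAt (fun k : K ↦ chartOne m G + k) K.subtypeL 0 :=
    K.subtypeL.hasFDerivAt.const_add _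
  have hI : ContMDiffAt 𝓘(ℝ, Eu m) 𝓘(ℝ, Eu m) ∞ (chartInv (Eu m) (1 : G))
      (chartOne m G + (0 : K)) := by
    rw [ZeroMemClass.coe_zero, add_zero]; exact contMDiffAt_chartInv chartOne_mem
  have haddM : ContMDiffAt 𝓘(ℝ, K) 𝓘(ℝ, Eu m) ∞ (fun k : K ↦ chartOne m G + k) 0 :=
    (contDiffAt_const.add K.subtypeL.contDiff.contDiffAt).contMDiffAt
  have hA : ContMDiffAt 𝓘(ℝ, K) 𝓘(ℝ, Eu m) ∞ A 0 := ContMDiffAt.comp 0 hI haddM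
  have hAd (k : K) : tderiv K (Eu m) A 0 k = k := by
    have := tderiv_comp_apply (g := chartInv (Eu m) (1 : G)) (0 : K) hI.mdiff haddM.mdiff k
    rw [tderiv_eq_fderiv, hadd.fderiv, ZeroMemClass.coe_zero, add_zero,
      tderiv_chartInv_chartOne] at this
    exact this
  have hsurj : Function.Surjective
      (tderiv (K × T) (Eu m) (fun q : K × T ↦ A q.1 * η q.2) 0) := by
    intro v
    obtain ⟨w, hw, k, hk, rfl⟩ := Submodule.mem_sup.1 (hK.sup_eq_top ▸ Submodule.mem_top :
      v ∈ p.toLinearMap.ker ⊔ K)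
    obtain ⟨t, ht⟩ := hker hw
    refine ⟨(⟨k, hk⟩, t), ?_⟩
    rw [tderiv_mul_prod hA0 h0 hA hη, hAd, add_comm]
    exact congrArg (· + k) ht
  have hf : ContDiffAt ℝ ∞ (fun k : K ↦ chartMap (Eu d) o (A k • o)) 0 := by
    rw [← contMDiffAt_iff_contDiffAt]
    refine ContMDiffAt.comp (g := chartMap (Eu d) o) (f := fun k ↦ A k • o) 0 ?_
      ((hs.contMDiff_orbit o _).comp 0 hA)
    rw [hA0, one_smul]
    exact contMDiffAt_chartMap (mem_chartDom o)
  obtain ⟨u, hu, hfu⟩ := (hf.of_le (ENat.LEInfty.out : (1 : WithTop ℕ∞) ≤ ∞)).contDiffOn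
    (le_refl _) (by simp)
  obtain ⟨ε, hε, hball⟩ := Metric.mem_nhds_iff.1 hu
  have hdense := (hfu.mono hball).dense_compl_image_of_dimH_lt_finrank (convex_ball _ _)
    le_rfl ((dimH_mono (Set.subset_univ _)).trans_lt
      (by rw [Real.dimH_univ_eq_finrank]; exact_mod_cast hKd))
  have hmemG := map_nhds_eq_of_surjective (by simp [hA0, h0]) (contMDiffAt_mul_prod hA hη) hsurj
    (prod_mem_nhds (Metric.ball_mem_nhds (0 : K) hε) (univ_mem (f := 𝓝 (0 : T))))
  have : IsTopologicalGroup G := topologicalGroup_of_lieGroup (𝓡 m) ∞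
  have : LocallyCompactSpace G := Manifold.locallyCompact_of_finiteDimensional (𝓡 m)
  have : LocallyCompactSpace N := Manifold.locallyCompact_of_finiteDimensional (𝓡 d)
  have : ContinuousSMul G N := ⟨ContMDiff.continuous hs⟩
  have hmemN : (fun k ↦ A k • o) '' Metric.ball 0 ε ∈ 𝓝 o := by
    have h1 := smul_singleton_mem_nhds_of_sigmaCompact hmemG o
    refine mem_of_superset h1 ?_
    rintro _ ⟨_, ⟨⟨k, t⟩, ⟨hk, -⟩, rfl⟩, x, hx, rfl⟩
    refine ⟨k, hk, ?_⟩
    change _ = (A k * η t) • x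
    rw [show x = o from hx, mul_smul, show η t • o = o from hmem t]
  have hnhds : (fun k : K ↦ chartMap (Eu d) o (A k • o)) '' Metric.ball 0 ε ∈
      𝓝 (chartMap (Eu d) o o) := by
    have h1 := (continuousAt_chartInv (chartMap_self_mem (E := Eu d) o)).preimage_mem_nhds
      (by rw [chartInv_chartMap_self]; exact hmemN)
    filter_upwards [h1, (isOpen_chartRan (E := Eu d) o).mem_nhds (chartMap_self_mem o)]
      with y ⟨k, hk, hky⟩ hy
    refine ⟨k, hk, ?_⟩
    change chartMap (Eu d) o (A k • o) = y
    rw [show A k • o = chartInv (Eu d) o y from hky, chartMap_chartInv hy]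
  obtain ⟨y, hy1, hy2⟩ := hdense.inter_nhds_nonempty hnhds
  exact hy1 hy2

end OrbitMap

/-! ### Invariant extensions of forms -/

section InvariantMetric

open Filter Topology

attribute [local instance] isManifold_group

variable {m : ℕ} {G : Type*} [TopologicalSpace G] [ChartedSpace (EuclideanSpace ℝ (Fin m)) G]
  [Group G] [LieGroup (𝓡 m) ∞ G]
  {d : ℕ} {N : Type*} [TopologicalSpace N] [ChartedSpace (EuclideanSpace ℝ (Fin d)) N]
  [MulAction G N] [IsManifold (𝓡 d) ∞ N]

/-- A right inverse, near a point, of a smooth map whose derivative is onto. -/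
lemma exists_local_rightInverse {E F : Type*} [NormedAddCommGroup E] [NormedSpace ℝ E]
    [CompleteSpace E] [NormedAddCommGroup F] [NormedSpace ℝ F] [FiniteDimensional ℝ F]
    {q : E → F} {e : E} (hq : ContDiffAt ℝ ∞ q e) (hs : Function.Surjective (fderiv ℝ q e)) :
    ∃ ℓ : F → E, ContDiffAt ℝ ∞ ℓ (q e) ∧ ℓ (q e) = e ∧ ∀ᶠ z in 𝓝 (q e), q (ℓ z) = z := by
  obtain ⟨R, hR⟩ := (fderiv ℝ q e).toLinearMap.exists_rightInverse_of_surjective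
    (LinearMap.range_eq_top.2 hs)
  have : CompleteSpace F := FiniteDimensional.complete ℝ F
  let R' : F →L[ℝ] E := LinearMap.toContinuousLinearMap R
  have hj : ContDiff ℝ ∞ (fun u : F ↦ e + R' u) := contDiff_const.add R'.contDiff
  have hje : e + R' 0 = e := by simp
  have hf : ContDiffAt ℝ ∞ (fun u : F ↦ q (e + R' u)) 0 :=
    ContDiffAt.comp (g := q) 0 (by rw [hje]; exact hq) hj.contDiffAt
  have hd : HasFDerivAt (fun u : F ↦ q (e + R' u))
      ((ContinuousLinearEquiv.refl ℝ F : F ≃L[ℝ] F) : F →L[ℝ] F) 0 := by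
    have h1 : HasFDerivAt (fun u : F ↦ e + R' u) R' 0 := R'.hasFDerivAt.const_add e
    have h2 : HasFDerivAt q (fderiv ℝ q e) (e + R' 0) := by
      rw [hje]; exact (hq.differentiableAt (by simp)).hasFDerivAt
    refine (h2.comp (0 : F) h1).congr_fderiv ?_
    ext v
    exact congrFun (congrArg DFunLike.coe hR) v
  have hn : (∞ : WithTop ℕ∞) ≠ 0 := by simp
  have hst := hf.hasStrictFDerivAt' hd hn
  have h1 := hf.to_localInverse hd hn
  have h2 := hst.eventually_right_inverse
  have h3 := hst.localInverse_apply_image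
  simp only [hje] at h1 h2 h3
  refine ⟨fun z ↦ e + R' (hst.localInverse _ _ _ z), ?_, ?_, h2⟩
  · exact contDiffAt_const.add (R'.contDiff.contDiffAt.comp _ h1)
  · simp [h3]

section Action

variable [T2Space N] [T2Space G] [SecondCountableTopology G]
  (hs : SmoothAction m G d N) [MulAction.IsPretransitive G N]
include hs

/-- A local section of the orbit map of `o`. -/
lemma exists_local_section (o : N) : ∃ τ : N → G,
    ContMDiffAt 𝓘(ℝ, Eu d) 𝓘(ℝ, Eu m) ∞ τ o ∧ ∀ᶠ x in 𝓝 o, τ x • o = x := by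
  have hI := contMDiffAt_chartInv (chartOne_mem (m := m) (G := G))
  have hπ := hs.contMDiff_orbit (m := m) o
  have hφ : ContMDiffAt 𝓘(ℝ, Eu d) 𝓘(ℝ, Eu d) ∞ (chartMap (Eu d) o)
      (chartInv (Eu m) (1 : G) (chartOne m G) • o) := by
    rw [chartInv_chartOne, one_smul]; exact contMDiffAt_chartMap (mem_chartDom o)
  have hq : ContDiffAt ℝ ∞ (fun y ↦ chartMap (Eu d) o (chartInv (Eu m) (1 : G) y • o))
      (chartOne m G) := by
    rw [← contMDiffAt_iff_contDiffAt]
    exact ContMDiffAt.comp (g := chartMap (Eu d) o)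
      (f := fun y ↦ chartInv (Eu m) (1 : G) y • o) _ hφ ((hπ _).comp _ hI)
  have hq0 : chartMap (Eu d) o (chartInv (Eu m) (1 : G) (chartOne m G) • o) =
      chartMap (Eu d) o o := by rw [chartInv_chartOne, one_smul]
  have hd : fderiv ℝ (fun y ↦ chartMap (Eu d) o (chartInv (Eu m) (1 : G) y • o))
      (chartOne m G) = orbitDeriv m G d o := by
    ext1 v
    rw [← tderiv_eq_fderiv, tderiv_comp_apply (g := chartMap (Eu d) o)
      (f := fun y ↦ chartInv (Eu m) (1 : G) y • o) (chartOne m G) hφ.mdiff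
      ((hπ.mdiff _).comp _ hI.mdiff),
      tderiv_comp_apply (g := fun a : G ↦ a • o) (f := chartInv (Eu m) (1 : G)) (chartOne m G)
        (hπ.mdiff _) hI.mdiff, tderiv_chartInv_chartOne, chartInv_chartOne, one_smul,
      tderiv_chartMap_self]
    rfl
  obtain ⟨ℓ, hℓ, hℓ0, hℓq⟩ := exists_local_rightInverse hq
    (by rw [hd]; exact surjective_orbitDeriv hs o)
  rw [hq0] at hℓ hℓ0 hℓq
  have hℓm : ContMDiffAt 𝓘(ℝ, Eu d) 𝓘(ℝ, Eu m) ∞ (fun x ↦ ℓ (chartMap (Eu d) o x)) o :=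
    ContMDiffAt.comp (g := ℓ) o hℓ.contMDiffAt (contMDiffAt_chartMap (mem_chartDom o))
  refine ⟨fun x ↦ chartInv (Eu m) (1 : G) (ℓ (chartMap (Eu d) o x)), ?_, ?_⟩
  · exact ContMDiffAt.comp (g := chartInv (Eu m) (1 : G)) o (by rw [hℓ0]; exact hI) hℓm
  · have hφc : ContinuousAt (chartMap (Eu d) o) o := continuousAt_chartMap (mem_chartDom o)
    have h1 : ContinuousAt
        (fun x ↦ chartInv (Eu m) (1 : G) (ℓ (chartMap (Eu d) o x)) • o) o :=
      (hπ.continuous.continuousAt).comp (ContinuousAt.comp (g := chartInv (Eu m) (1 : G))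
        (by rw [hℓ0]; exact hI.continuousAt) hℓm.continuousAt)
    have h2 : chartInv (Eu m) (1 : G) (ℓ (chartMap (Eu d) o o)) • o = o := by
      rw [hℓ0, chartInv_chartOne, one_smul]
    have h3 := h1.eventually_mem
      (by rw [h2]; exact (isOpen_chartDom (E := Eu d) o).mem_nhds (mem_chartDom o))
    filter_upwards [hφc.eventually hℓq, h3,
      (isOpen_chartDom (E := Eu d) o).mem_nhds (mem_chartDom o)] with x hx1 hx2 hx3
    rw [← chartInv_chartMap hx3, ← hx1, chartInv_chartMap hx2, hx1]

/-- Near any point there is a smooth choice of group elements moving the points to `o`. -/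
lemma exists_local_transport (o x₀ : N) : ∃ b : N → G,
    ContMDiffAt 𝓘(ℝ, Eu d) 𝓘(ℝ, Eu m) ∞ b x₀ ∧ ∀ᶠ x in 𝓝 x₀, b x • x = o := by
  obtain ⟨τ, hτ, hτo⟩ := exists_local_section hs o
  obtain ⟨a, rfl⟩ := MulAction.exists_smul_eq G o x₀
  have ha := hs.contMDiff_smul (m := m) a⁻¹
  refine ⟨fun x ↦ (τ (a⁻¹ • x))⁻¹ * a⁻¹, ?_, ?_⟩
  · have h1 : ContMDiffAt 𝓘(ℝ, Eu d) 𝓘(ℝ, Eu m) ∞ (fun x ↦ τ (a⁻¹ • x)) (a • o) :=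
      ContMDiffAt.comp (g := τ) (a • o) (by rw [inv_smul_smul]; exact hτ) (ha _)
    exact h1.inv.mul contMDiffAt_const
  · have h2 := ha.continuous.continuousAt (x := a • o)
    rw [ContinuousAt, inv_smul_smul] at h2
    filter_upwards [h2.eventually hτo] with x hx
    rw [mul_smul, inv_smul_eq_iff, hx]

omit hs in
variable (m G) in
/-- The invariant extension of a bilinear form on the tangent space at `o`, through a chosen element
`b` with `b • x = o`; by `extendForm_apply` the choice does not matter for an invariant form. -/
def extendForm (F : Eu d →L[ℝ] Eu d →L[ℝ] ℝ) (o x : N) : Eu d →L[ℝ] Eu d →L[ℝ] ℝ :=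
  let b : G := (MulAction.exists_smul_eq G x o).choose
  F.bilinearComp (tderiv (Eu d) (Eu d) (fun z : N ↦ b • z) x)
    (tderiv (Eu d) (Eu d) (fun z : N ↦ b • z) x)

variable {F : Eu d →L[ℝ] Eu d →L[ℝ] ℝ} {o : N}
  (hF : ∀ a ∈ MulAction.stabilizer G o, ∀ v w,
    F (tderiv (Eu d) (Eu d) (fun x : N ↦ a • x) o v)
      (tderiv (Eu d) (Eu d) (fun x : N ↦ a • x) o w) = F v w)
include hF

lemma extendForm_apply {x : N} {b : G} (hb : b • x = o) (v w : Eu d) :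
    extendForm G F o x v w = F (tderiv (Eu d) (Eu d) (fun z : N ↦ b • z) x v)
      (tderiv (Eu d) (Eu d) (fun z : N ↦ b • z) x w) := by
  have hc := (MulAction.exists_smul_eq G x o).choose_spec
  set c := (MulAction.exists_smul_eq G x o).choose with hcdef
  have hmem : c * b⁻¹ ∈ MulAction.stabilizer G o := by
    change (c * b⁻¹) • o = o
    rw [mul_smul, ← hb, inv_smul_smul, hc, hb]
  have key (v : Eu d) : tderiv (Eu d) (Eu d) (fun z : N ↦ c • z) x v =
      tderiv (Eu d) (Eu d) (fun z : N ↦ (c * b⁻¹) • z) o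
        (tderiv (Eu d) (Eu d) (fun z : N ↦ b • z) x v) := by
    have h1 := tderiv_comp_apply (g := fun z : N ↦ (c * b⁻¹) • z) (f := fun z : N ↦ b • z) x
      ((hs.contMDiff_smul _).mdiff _) ((hs.contMDiff_smul _).mdiff _) v
    simp only [smul_smul, inv_mul_cancel_right] at h1
    rw [h1, hb]
  change F (tderiv (Eu d) (Eu d) (fun z : N ↦ c • z) x v)
    (tderiv (Eu d) (Eu d) (fun z : N ↦ c • z) x w) = _
  rw [key, key, hF _ hmem]

lemma extendForm_self (v w : Eu d) : extendForm G F o o v w = F v w := by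
  rw [extendForm_apply hs hF (one_smul G o)]
  simp only [one_smul, tderiv_id]
  rfl

lemma extendForm_smul (a : G) (x : N) (v w : Eu d) :
    extendForm G F o (a • x) (tderiv (Eu d) (Eu d) (fun z : N ↦ a • z) x v)
      (tderiv (Eu d) (Eu d) (fun z : N ↦ a • z) x w) = extendForm G F o x v w := by
  obtain ⟨b, hb⟩ := MulAction.exists_smul_eq G (a • x) o
  have key (v : Eu d) : tderiv (Eu d) (Eu d) (fun z : N ↦ b • z) (a • x)
      (tderiv (Eu d) (Eu d) (fun z : N ↦ a • z) x v) =
      tderiv (Eu d) (Eu d) (fun z : N ↦ (b * a) • z) x v := by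
    have h1 := tderiv_comp_apply (g := fun z : N ↦ b • z) (f := fun z : N ↦ a • z) x
      ((hs.contMDiff_smul _).mdiff _) ((hs.contMDiff_smul _).mdiff _) v
    simp only [smul_smul] at h1
    exact h1.symm
  rw [extendForm_apply hs hF hb, extendForm_apply hs hF (b := b * a) (by rw [mul_smul, hb]),
    key, key]

/-- The invariant extension is smooth: near `x₀`, it is obtained by transporting the form along a
smooth family of elements of `G`. -/
lemma contDiffAt_gram_extendForm (x₀ : N) :
    ContDiffAt ℝ ∞ (gram (extendForm G F o) x₀) (chartMap (Eu d) x₀ x₀) := by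
  obtain ⟨b, hb, hbo⟩ := exists_local_transport hs o x₀
  set y₀ := chartMap (Eu d) x₀ x₀ with hy₀
  have hy₀mem : y₀ ∈ chartRan (Eu d) x₀ := chartMap_self_mem x₀
  have hI := contMDiffAt_chartInv hy₀mem
  have hIy : chartInv (Eu d) x₀ y₀ = x₀ := chartInv_chartMap_self x₀
  let Ψ : Eu d × Eu d → Eu d := fun q ↦
    chartMap (Eu d) o (b (chartInv (Eu d) x₀ q.1) • chartInv (Eu d) x₀ q.2)
  have hΨ : ContDiffAt ℝ ∞ Ψ (y₀, y₀) := by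
    rw [← contMDiffAt_iff_contDiffAt]
    have f1 : ContMDiffAt 𝓘(ℝ, Eu d × Eu d) 𝓘(ℝ, Eu d) ∞ Prod.fst (y₀, y₀) :=
      contDiffAt_fst.contMDiffAt
    have f2 : ContMDiffAt 𝓘(ℝ, Eu d × Eu d) 𝓘(ℝ, Eu d) ∞ Prod.snd (y₀, y₀) :=
      contDiffAt_snd.contMDiffAt
    have h1 : ContMDiffAt 𝓘(ℝ, Eu d × Eu d) 𝓘(ℝ, Eu m) ∞
        (fun q : Eu d × Eu d ↦ b (chartInv (Eu d) x₀ q.1)) (y₀, y₀) :=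
      ContMDiffAt.comp (g := b) (y₀, y₀) (by simpa only [hIy] using hb)
        (ContMDiffAt.comp (g := chartInv (Eu d) x₀) (f := Prod.fst) (y₀, y₀) hI f1)
    have h2 : ContMDiffAt 𝓘(ℝ, Eu d × Eu d) 𝓘(ℝ, Eu d) ∞
        (fun q : Eu d × Eu d ↦ chartInv (Eu d) x₀ q.2) (y₀, y₀) :=
      ContMDiffAt.comp (g := chartInv (Eu d) x₀) (f := Prod.snd) (y₀, y₀) hI f2
    have h3 : ContMDiffAt 𝓘(ℝ, Eu d × Eu d) 𝓘(ℝ, Eu d) ∞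
        (fun q : Eu d × Eu d ↦ b (chartInv (Eu d) x₀ q.1) • chartInv (Eu d) x₀ q.2) (y₀, y₀) :=
      ContMDiffAt.comp (g := fun q : G × N ↦ q.1 • q.2) (y₀, y₀) (hs _) (h1.prodMk h2)
    refine ContMDiffAt.comp (g := chartMap (Eu d) o) (y₀, y₀) ?_ h3
    simp only [hIy, hbo.self_of_nhds]
    exact contMDiffAt_chartMap (mem_chartDom o)
  have hdiag : ContDiffAt ℝ ∞ (fun y : Eu d ↦ (y, y)) y₀ := contDiffAt_id.prodMk contDiffAt_id
  have hD : ContDiffAt ℝ ∞ (fun y ↦ fderiv ℝ Ψ (y, y)) y₀ :=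
    ContDiffAt.comp (g := fderiv ℝ Ψ) y₀ (hΨ.fderiv_right (m := ∞) (by simp)) hdiag
  have hev : ∀ᶠ y in 𝓝 y₀, ∀ v, fderiv ℝ Ψ (y, y) (0, v) =
      tderiv (Eu d) (Eu d) (fun z : N ↦ b (chartInv (Eu d) x₀ y) • z) (chartInv (Eu d) x₀ y)
        (tderiv (Eu d) (Eu d) (chartInv (Eu d) x₀) y v) := by
    have e1 := hdiag.continuousAt.eventually
      ((hΨ.of_le (ENat.LEInfty.out : (1 : WithTop ℕ∞) ≤ ∞)).eventually (by simp))
    have e2 : ∀ᶠ y in 𝓝 y₀, b (chartInv (Eu d) x₀ y) • chartInv (Eu d) x₀ y = o :=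
      hI.continuousAt.eventually (by rw [hIy]; exact hbo)
    filter_upwards [e1, e2, (isOpen_chartRan x₀).mem_nhds hy₀mem] with y h1 h2 hy v
    have i2 : HasFDerivAt (fun z : Eu d ↦ (y, z)) (ContinuousLinearMap.inr ℝ (Eu d) (Eu d)) y :=
      hasFDerivAt_prodMk_right y y
    have h3 := ((h1.differentiableAt (by simp)).hasFDerivAt.comp y i2).fderiv
    have h4 : fderiv ℝ (fun z ↦ Ψ (y, z)) y v = fderiv ℝ Ψ (y, y) (0, v) := by
      refine (congrFun (congrArg DFunLike.coe h3) v).trans ?_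
      simp
    have hIy' := (contMDiffAt_chartInv hy).mdiff
    have hba := hs.contMDiff_smul (m := m) (b (chartInv (Eu d) x₀ y))
    rw [← h4, ← tderiv_eq_fderiv, tderiv_comp_apply (g := chartMap (Eu d) o)
      (f := fun z ↦ b (chartInv (Eu d) x₀ y) • chartInv (Eu d) x₀ z) y
      (by rw [h2]; exact (contMDiffAt_chartMap (mem_chartDom o)).mdiff)
      ((hba.mdiff _).comp y hIy'), h2, tderiv_chartMap_self,
      tderiv_comp_apply (g := fun z : N ↦ b (chartInv (Eu d) x₀ y) • z) y (hba.mdiff _) hIy']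
    rfl
  refine contDiffAt_clm_of_apply fun v ↦ contDiffAt_clm_of_apply fun w ↦ ?_
  have hDv (v : Eu d) : ContDiffAt ℝ ∞ (fun y ↦ fderiv ℝ Ψ (y, y) (0, v)) y₀ :=
    hD.clm_apply contDiffAt_const
  have hfin : ContDiffAt ℝ ∞
      (fun y ↦ F (fderiv ℝ Ψ (y, y) (0, v)) (fderiv ℝ Ψ (y, y) (0, w))) y₀ :=
    (F.contDiff.contDiffAt.comp y₀ (hDv v)).clm_apply (hDv w)
  refine hfin.congr_of_eventuallyEq ?_
  have e2 : ∀ᶠ y in 𝓝 y₀, b (chartInv (Eu d) x₀ y) • chartInv (Eu d) x₀ y = o :=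
    hI.continuousAt.eventually (by rw [hIy]; exact hbo)
  filter_upwards [hev, e2] with y h1 h2
  rw [gram_apply, extendForm_apply hs hF h2, h1, h1]

/-- An invariant, symmetric, nondegenerate form on the tangent space at `o` extends to an
invariant metric. -/
theorem exists_invariant_metric (hsymm : ∀ v w, F v w = F w v)
    (hnd : ∀ v, (∀ w, F v w = 0) → v = 0) : ∃ g : PseudoMetric d N,
      (∀ v w, g.form o v w = F v w) ∧ ∀ (a : G) (x : N) (v w : Eu d),
        g.form (a • x) (tderiv (Eu d) (Eu d) (fun z : N ↦ a • z) x v)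
          (tderiv (Eu d) (Eu d) (fun z : N ↦ a • z) x w) = g.form x v w := by
  refine ⟨{
    val := extendForm G F o
    symm := fun x v w ↦ hsymm _ _
    nondegenerate := fun x v hv ↦ ?_
    contMDiff := fun x ↦ contMDiffAt_of_gram (extendForm G F o)
      (contDiffAt_gram_extendForm hs hF x) }, extendForm_self hs hF, extendForm_smul hs hF⟩
  obtain ⟨b, hb⟩ := MulAction.exists_smul_eq G x o
  have hinv (x : N) (b : G) (w : Eu d) : tderiv (Eu d) (Eu d) (fun z : N ↦ b⁻¹ • z) (b • x)
      (tderiv (Eu d) (Eu d) (fun z : N ↦ b • z) x w) = w :=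
    tderiv_leftInverse ((hs.contMDiff_smul b⁻¹).mdiff _) ((hs.contMDiff_smul b).mdiff _)
      (.of_forall fun z ↦ inv_smul_smul b z) w
  have h1 : tderiv (Eu d) (Eu d) (fun z : N ↦ b • z) x v = 0 := by
    refine hnd _ fun w ↦ ?_
    have h2 := hinv (b • x) b⁻¹ w
    rw [inv_inv, inv_smul_smul, hb] at h2
    have h3 := hv (tderiv (Eu d) (Eu d) (fun z : N ↦ b⁻¹ • z) o w)
    have h4 := extendForm_apply hs hF hb v (tderiv (Eu d) (Eu d) (fun z : N ↦ b⁻¹ • z) o w)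
    rw [h2] at h4
    rw [← h4]
    exact h3
  exact (hinv x b v).symm.trans ((congrArg _ h1).trans (map_zero _))

end Action

end InvariantMetric

/-! ### The forms on the tangent space given by the centroid -/

section TwistedForms

/-- A nondegenerate symmetric bilinear form with an isotropic subspace of half the dimension has
split signature. -/
lemma signature_of_isotropic {V : Type*} [AddCommGroup V] [Module ℝ V] [FiniteDimensional ℝ V]
    (b : LinearMap.BilinForm ℝ V) (hs : ∀ v w, b v w = b w v) (hn : ∀ v, (∀ w, b v w = 0) → v = 0)
    {k : ℕ} (hV : finrank ℝ V = 2 * k) (U : Submodule ℝ V) (hU : finrank ℝ U = k)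
    (hi : ∀ v ∈ U, b v v = 0) :
    sigPos (LinearMap.BilinMap.toQuadraticMap b) = k ∧
      sigNeg (LinearMap.BilinMap.toQuadraticMap b) = k := by
  set Q := LinearMap.BilinMap.toQuadraticMap b
  have hQ (v : V) : Q v = b v v := rfl
  have h1 := QuadraticForm.sigPos_add_finrank_le_of_nonpos (Q := Q) (V := U)
    fun v hv ↦ by rw [hQ, hi v hv]
  have h2 := QuadraticForm.sigPos_add_finrank_le_of_nonpos (Q := -Q) (V := U)
    fun v hv ↦ by rw [neg_apply, hQ, hi v hv, neg_zero]
  have h3 := QuadraticForm.sigPos_add_sigNeg_add_radical (Q := Q)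
  have h4 : Q.radical = ⊥ := by
    refine (Submodule.eq_bot_iff _).2 fun v hv ↦ hn v fun w ↦ ?_
    obtain ⟨h5, h6⟩ := QuadraticMap.mem_radical_iff'.1 hv
    have h7 := h6 w
    rw [hQ] at h5
    simp only [hQ, map_add, LinearMap.add_apply, h5, hs w v] at h7
    linarith
  rw [h4, finrank_bot] at h3
  rw [sigPos_neg] at h2
  omega

variable {L T : Type*} [LieRing L] [LieAlgebra ℝ L] [AddCommGroup T] [Module ℝ T]

section

variable [FiniteDimensional ℝ L] {i : L →ₗ[ℝ] L} (hi : IsComplexStructure i) (a b : ℝ)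

include hi

lemma isCentroid_twist : IsCentroid (a • (LinearMap.id : L →ₗ[ℝ] L) + b • i) :=
  (IsCentroid.id_smul a).add (hi.isCentroid.smul b)

lemma twistedKilling_symm (X Y : L) : twistedKilling i a b X Y = twistedKilling i a b Y X := by
  rw [twistedKilling_apply, (isCentroid_twist hi a b).killingForm_apply, twistedKilling_apply]
  exact LieModule.traceForm_comm ℝ L L _ _

lemma twistedKilling_lie (W X Y : L) :
    twistedKilling i a b ⁅W, X⁆ Y + twistedKilling i a b X ⁅W, Y⁆ = 0 := by
  rw [twistedKilling_apply, twistedKilling_apply, (isCentroid_twist hi a b).lie_right,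
    InfinitesimalModel.killingForm_lie]
  ring

omit hi in
lemma twistedKilling_equiv {Φ : L ≃ₗ⁅ℝ⁆ L} (hΦ : ∀ X, i (Φ X) = Φ (i X)) (X Y : L) :
    twistedKilling i a b (Φ X) (Φ Y) = twistedKilling i a b X Y := by
  have h : (a • (LinearMap.id : L →ₗ[ℝ] L) + b • i) (Φ X) =
      Φ ((a • (LinearMap.id : L →ₗ[ℝ] L) + b • i) X) := by simp [hΦ]
  rw [twistedKilling_apply, twistedKilling_apply, h, LieAlgebra.killingForm_of_equiv_apply]

end

namespace InfinitesimalModel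

variable (M : InfinitesimalModel L T) [LieAlgebra.IsSimple ℝ L] [FiniteDimensional ℝ L]
  {i : L →ₗ[ℝ] L} (hi : IsComplexStructure i) (hθ : ∀ X, i (M.θ X) = M.θ (i X)) (a b : ℝ)

include hi

variable [Nontrivial T]

include hθ in
/-- The centroid element `a + b i` is invertible and commutes with `θ`. -/
lemma eq_zero_of_twistedKilling (hab : (a, b) ≠ (0, 0)) {X : L} (hX : M.θ X = -X)
    (h : ∀ Y, M.θ Y = -Y → twistedKilling i a b X Y = 0) : X = 0 := by
  set A := a • (LinearMap.id : L →ₗ[ℝ] L) + b • i with hA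
  have hAX : A X = a • X + b • i X := by simp [hA]
  have h1 : A X = 0 := by
    refine M.eq_of_killingForm_eq_minus ?_ (by simp) fun Y hY ↦ ?_
    · rw [hAX, map_add, map_smul, map_smul, ← hθ, hX, map_neg, smul_neg, smul_neg, neg_add]
    · rw [hA, ← twistedKilling_apply, h Y hY]; simp
  have h2 : (a ^ 2 + b ^ 2) • X = 0 := by
    have h3 : a • A X - b • i (A X) = (a ^ 2 + b ^ 2) • X := by
      rw [hAX, map_add, map_smul, map_smul, hi.1]
      module
    rw [← h3, h1]; simp
  refine (smul_eq_zero.1 h2).resolve_left fun h3 ↦ hab ?_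
  have ha : a = 0 := by nlinarith [sq_nonneg a, sq_nonneg b]
  have hb : b = 0 := by nlinarith [sq_nonneg a, sq_nonneg b]
  rw [ha, hb]

lemma twistedKilling_structureMap {X Y : L} :
    twistedKilling i a b (M.structureMap X) Y + twistedKilling i a b X (M.structureMap Y) = 0 := by
  rw [← char_lie, ← char_lie, twistedKilling_lie hi]

omit hi [FiniteDimensional ℝ L] in
lemma finrank_minus {S : Submodule ℝ L} (hS : ∀ X, X ∈ S ↔ M.θ X = -X) :
    finrank ℝ S = finrank ℝ T :=
  (LinearEquiv.ofBijective (M.p ∘ₗ S.subtype)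
    ⟨fun X Y h ↦ Subtype.ext (M.eq_of_p_eq ((hS _).1 X.2) ((hS _).1 Y.2) h),
      fun v ↦ ⟨⟨M.lift v, (hS _).2 (M.θ_lift v)⟩, M.p_lift v⟩⟩).finrank_eq

include hθ in
/-- The form has split signature on the `(-1)`-eigenspace of `θ`: the `1`-eigenspace of the
para-complex structure is isotropic, since the para-complex structure is skew. -/
lemma signature_twistedKilling (hab : (a, b) ≠ (0, 0)) {S : Submodule ℝ L}
    (hS : ∀ X, X ∈ S ↔ M.θ X = -X) {k : ℕ} (hk : finrank ℝ T = 2 * k)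
    (hJ : finrank ℝ (End.eigenspace M.J (1 : ℝ)) = k) :
    sigPos (LinearMap.BilinMap.toQuadraticMap ((twistedKilling i a b).restrict S)) = k ∧
      sigNeg (LinearMap.BilinMap.toQuadraticMap ((twistedKilling i a b).restrict S)) = k := by
  set e : T →ₗ[ℝ] S := M.lift.codRestrict S fun v ↦ (hS _).2 (M.θ_lift v)
  have he (v : T) : (e v : L) = M.lift v := rfl
  have hinj : Function.Injective e := fun v w h ↦ by
    have := congrArg (fun X : S ↦ M.p X) h
    simpa [he, M.p_lift] using this
  refine signature_of_isotropic ((twistedKilling i a b).restrict S) (fun X Y ↦ twistedKilling_symm hi a b X Y) (fun X h ↦ ?_)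
    ((M.finrank_minus hS).trans hk) ((End.eigenspace M.J (1 : ℝ)).map e)
    ((Submodule.equivMapOfInjective e hinj _).finrank_eq.symm.trans hJ) ?_
  · exact Subtype.ext (M.eq_zero_of_twistedKilling hi hθ a b hab ((hS _).1 X.2)
      fun Y hY ↦ h ⟨Y, (hS _).2 hY⟩)
  · rintro _ ⟨v, hv, rfl⟩
    have h1 : M.structureMap (M.lift v) = M.lift v := by
      have := End.mem_eigenspace_iff.1 hv
      rw [structureMap, LinearMap.comp_apply, LinearMap.comp_apply, M.p_lift, this, one_smul]
    have h2 := M.twistedKilling_structureMap hi a b (X := M.lift v) (Y := M.lift v)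
    rw [h1] at h2
    show twistedKilling i a b (M.lift v) (M.lift v) = 0
    linarith

end InfinitesimalModel

end TwistedForms

/-! ### Point reflections and geodesics -/

section Reflections

open Filter Topology

set_option maxSynthPendingDepth 4 in
set_option synthInstance.maxHeartbeats 200000 in
lemma christ_neg {E : Type*} [NormedAddCommGroup E] [NormedSpace ℝ E]
    (G : E → E →L[ℝ] E →L[ℝ] ℝ) (y u v w : E) : christ G y (-u) (-v) (-w) = -christ G y u v w := by
  simp only [christ, map_neg, neg_apply]
  ring

section

variable {d : ℕ} {N : Type*} [TopologicalSpace N]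
  [ChartedSpace (EuclideanSpace ℝ (Fin d)) N] [IsManifold (𝓡 d) ∞ N] {g g' : PseudoMetric d N}

namespace PseudoMetric

variable {φ : N → N} {x : N}

lemma fderiv_chartRep_of_reflection (hφ : ContMDiff 𝓘(ℝ, Eu d) 𝓘(ℝ, Eu d) ∞ φ) (hx : φ x = x)
    (hd : ∀ v, tderiv (Eu d) (Eu d) φ x v = -v) (v : Eu d) :
    fderiv ℝ (chartRep φ x x) (chartMap (Eu d) x x) v = -v := by
  have hI := chartInv_chartMap_self (E := Eu d) x
  rw [fderiv_chartRep hφ (chartMap_self_mem x) (by rw [hI, hx]; exact mem_chartDom x), hI, hd, hx,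
    tderiv_chartInv_self, tderiv_chartMap_self]
  rfl

/-- The Christoffel symbols at the centre of an isometric point reflection are determined by the
second derivative of the reflection. -/
lemma IsIsometry.christ_of_reflection (hφ : g.IsIsometry φ) (hx : φ x = x)
    (hd : ∀ v, tderiv (Eu d) (Eu d) φ x v = -v) (u v w : Eu d) :
    christ (gram g.form x) (chartMap (Eu d) x x) u v w =
      -(1 / 2) * gram g.form x (chartMap (Eu d) x x)
        (fderiv ℝ (fderiv ℝ (chartRep φ x x)) (chartMap (Eu d) x x) u v) w := by
  have h := hφ.christ_eq (mem_chartDom x) (by rw [hx]; exact mem_chartDom x) u v w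
  simp only [fderiv_chartRep_of_reflection hφ.1 hx hd, hx] at h
  have h1 : christ (gram g.form x) (chartMap (Eu d) x x) (-u) (-v) (-w) =
      -christ (gram g.form x) (chartMap (Eu d) x x) u v w := by
    exact christ_neg _ _ _ _ _
  rw [h1, map_neg] at h
  linarith

lemma IsIsometry.residual_of_reflection (hφ : g.IsIsometry φ) (hx : φ x = x)
    (hd : ∀ v, tderiv (Eu d) (Eu d) φ x v = -v) {c : ℝ → Eu d} {t : ℝ}
    (hc : c t = chartMap (Eu d) x x) (w : Eu d) :
    residual (gram g.form x) c t w = gram g.form x (chartMap (Eu d) x x)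
      (deriv (deriv c) t - (1 / 2 : ℝ) • fderiv ℝ (fderiv ℝ (chartRep φ x x))
        (chartMap (Eu d) x x) (deriv c t) (deriv c t)) w := by
  rw [residual, hc, hφ.christ_of_reflection hx hd, map_sub, map_smul, sub_apply, smul_apply,
    smul_eq_mul]
  ring

/-- Two metrics with the same isometric point reflections have the same Levi-Civita connection,
hence the same geodesics. -/
lemma IsGeodesicOn.of_reflections {γ : ℝ → N} {s : Set ℝ} (h : g.IsGeodesicOn γ s)
    (hr : ∀ x, ∃ φ : N → N, g.IsIsometry φ ∧ g'.IsIsometry φ ∧ φ x = x ∧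
      ∀ v, tderiv (Eu d) (Eu d) φ x v = -v) : g'.IsGeodesicOn γ s := by
  rw [isGeodesicOn_iff] at h ⊢
  refine ⟨h.1, fun t ht w ↦ ?_⟩
  obtain ⟨φ, h1, h2, hx, hd⟩ := hr (γ t)
  rw [h2.residual_of_reflection hx hd rfl]
  have h3 := h.2 t ht
  simp only [h1.residual_of_reflection hx hd
    (c := fun τ ↦ chartMap (Eu d) (γ t) (γ τ)) (t := t) rfl] at h3
  rw [g.eq_zero_of_gram (chartMap_self_mem _) h3, map_zero, zero_apply]

lemma IsIsometry.comp {φ ψ : N → N} (hφ : g.IsIsometry φ) (hψ : g.IsIsometry ψ) :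
    g.IsIsometry fun x ↦ φ (ψ x) := by
  refine ⟨hφ.1.comp hψ.1, fun x v w ↦ ?_⟩
  have e (v : Eu d) : tderiv (Eu d) (Eu d) (fun x ↦ φ (ψ x)) x v = _ :=
    tderiv_comp_apply (g := φ) (f := ψ) x (hφ.1.mdiff _) (hψ.1.mdiff _) v
  rw [e, e, hφ.2, hψ.2]

end PseudoMetric

end

attribute [local instance] isManifold_group

variable {m n : ℕ} {G : Type*} [TopologicalSpace G] [ChartedSpace (EuclideanSpace ℝ (Fin m)) G]
  [Group G] [LieGroup (𝓡 m) ∞ G]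
  {N : Type*} [TopologicalSpace N] [ChartedSpace (EuclideanSpace ℝ (Fin (2 * n))) N]
  [IsManifold (𝓡 (2 * n)) ∞ N] [MulAction G N]

/-- An element of a Lie group acting smoothly, as a diffeomorphism. -/
def smulDiffeomorph (hs : SmoothAction m G (2 * n) N) (a : G) :
    Diffeomorph (𝓡 (2 * n)) (𝓡 (2 * n)) N N ∞ where
  toEquiv := MulAction.toPerm a
  contMDiff_toFun := hs.contMDiff_smul a
  contMDiff_invFun := hs.contMDiff_smul a⁻¹

variable {J : ParaComplex n N} {g g' : PseudoMetric (2 * n) N} {o : N} {σ : G →* G}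

lemma Preserves.isIsometry {φ : N → N} (h : Preserves J g φ)
    (hφ : ContMDiff 𝓘(ℝ, Eu (2 * n)) 𝓘(ℝ, Eu (2 * n)) ∞ φ) : g.IsIsometry φ :=
  ⟨hφ, h.form_tderiv⟩

lemma Preserves.of_isIsometry {φ : N → N} (h : Preserves J g φ) (h' : g'.IsIsometry φ) :
    Preserves J g' φ := fun x v w ↦ ⟨(h x v w).1, h'.2 x v w⟩

lemma Preserves.comp {φ ψ : N → N} (h : Preserves J g φ) (h' : Preserves J g ψ)
    (hφ : ContMDiff 𝓘(ℝ, Eu (2 * n)) 𝓘(ℝ, Eu (2 * n)) ∞ φ)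
    (hψ : ContMDiff 𝓘(ℝ, Eu (2 * n)) 𝓘(ℝ, Eu (2 * n)) ∞ ψ) :
    Preserves J g fun x ↦ φ (ψ x) := by
  have e (x : N) (v : Eu (2 * n)) : tderiv (Eu (2 * n)) (Eu (2 * n)) (fun x ↦ φ (ψ x)) x v = _ :=
    tderiv_comp_apply (g := φ) (f := ψ) x (hφ.mdiff _) (hψ.mdiff _) v
  have hJ (x : N) (v : Eu (2 * n)) : tderiv (Eu (2 * n)) (Eu (2 * n)) (fun x ↦ φ (ψ x)) x (J.op x v)
      = J.op (φ (ψ x)) (tderiv (Eu (2 * n)) (Eu (2 * n)) (fun x ↦ φ (ψ x)) x v) := by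
    rw [e, e, h'.tderiv_op, h.tderiv_op]
  exact fun x v w ↦ ⟨hJ x v, ((h.isIsometry hφ).comp (h'.isIsometry hψ)).2 x v w⟩

/-- Differentiate `s (a • o) = σ a • o` at `a = 1`. -/
lemma orbitDeriv_involution (hs : SmoothAction m G (2 * n) N)
    (hσ : ContMDiff 𝓘(ℝ, Eu m) 𝓘(ℝ, Eu m) ∞ σ) {s : N → N}
    (hsm : ContMDiff 𝓘(ℝ, Eu (2 * n)) 𝓘(ℝ, Eu (2 * n)) ∞ s) (ho : s o = o)
    (hd : ∀ v, tderiv (Eu (2 * n)) (Eu (2 * n)) s o v = -v)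
    (hc : ∀ (a : G) (x : N), s (a • x) = σ a • s x) (X : Eu m) :
    orbitDeriv m G (2 * n) o (tderiv (Eu m) (Eu m) σ 1 X) = -orbitDeriv m G (2 * n) o X := by
  have h1 := tderiv_comp_apply (g := s) (f := fun a : G ↦ a • o) (1 : G) (hsm.mdiff _)
    ((hs.contMDiff_orbit o).mdiff _) X
  have h2 := tderiv_comp_apply (g := fun a : G ↦ a • o) (f := σ) (1 : G)
    ((hs.contMDiff_orbit o).mdiff _) (hσ.mdiff _) X
  simp only [hc, ho, one_smul] at h1
  rw [h1, map_one, hd] at h2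
  exact h2.symm

section

variable [MulAction.IsPretransitive G N] (hs : SmoothAction m G (2 * n) N)
  (hg' : ∀ a : G, g'.IsIsometry fun x ↦ a • x)

include hs in
lemma exists_tderiv_smul (x : N) : ∃ a : G, a • o = x ∧ ∀ v : Eu (2 * n), ∃ v' : Eu (2 * n),
    tderiv (Eu (2 * n)) (Eu (2 * n)) (fun z : N ↦ a • z) o v' = v := by
  obtain ⟨a, rfl⟩ := MulAction.exists_smul_eq G o x
  refine ⟨a, rfl, fun v ↦ ⟨tderiv (Eu (2 * n)) (Eu (2 * n)) (fun z : N ↦ a⁻¹ • z) (a • o) v, ?_⟩⟩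
  have h := tderiv_leftInverse (g := fun z : N ↦ a • z) (f := fun z : N ↦ a⁻¹ • z) (x := a • o)
    ((hs.contMDiff_smul a).mdiff _) ((hs.contMDiff_smul a⁻¹).mdiff _)
    (Filter.Eventually.of_forall fun z ↦ smul_inv_smul a z) v
  rwa [inv_smul_smul] at h

include hs hg'

/-- A point reflection normalizing the group is an isometry of every invariant metric. -/
lemma isIsometry_of_reflection {s : N → N}
    (hsm : ContMDiff 𝓘(ℝ, Eu (2 * n)) 𝓘(ℝ, Eu (2 * n)) ∞ s) (ho : s o = o)
    (hd : ∀ v, tderiv (Eu (2 * n)) (Eu (2 * n)) s o v = -v)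
    (hc : ∀ (a : G) (x : N), s (a • x) = σ a • s x) : g'.IsIsometry s := by
  refine ⟨hsm, fun x v w ↦ ?_⟩
  obtain ⟨a, rfl, ha⟩ := exists_tderiv_smul hs (o := o) x
  obtain ⟨v, rfl⟩ := ha v
  obtain ⟨w, rfl⟩ := ha w
  have e (v : Eu (2 * n)) : tderiv (Eu (2 * n)) (Eu (2 * n)) s (a • o)
      (tderiv (Eu (2 * n)) (Eu (2 * n)) (fun z : N ↦ a • z) o v) =
      -tderiv (Eu (2 * n)) (Eu (2 * n)) (fun z : N ↦ σ a • z) o v := by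
    have h1 := tderiv_comp_apply (g := s) (f := fun z : N ↦ a • z) o (hsm.mdiff _)
      ((hs.contMDiff_smul a).mdiff _) v
    have h2 := tderiv_comp_apply (g := fun z : N ↦ σ a • z) (f := s) o
      ((hs.contMDiff_smul (σ a)).mdiff _) (hsm.mdiff _) v
    simp only [hc] at h1
    rw [h1, hd, ho, map_neg] at h2
    exact h2
  rw [e, e, hc, ho, map_neg, map_neg, neg_apply, neg_neg, (hg' (σ a)).2, (hg' a).2]

lemma isParaHermitian_of_invariant (hJ : ∀ a : G, Preserves J g fun x ↦ a • x)
    (h : ∀ v w, g'.form o (J.op o v) w + g'.form o v (J.op o w) = 0) : IsParaHermitian J g' := by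
  intro x v w
  show g'.form x (J.op x v) w + g'.form x v (J.op x w) = 0
  obtain ⟨a, rfl, ha⟩ := exists_tderiv_smul hs (o := o) x
  obtain ⟨v, rfl⟩ := ha v
  obtain ⟨w, rfl⟩ := ha w
  rw [← (hJ a).tderiv_op, ← (hJ a).tderiv_op, (hg' a).2, (hg' a).2, h]

/-- The symmetries of `g` are symmetries of every invariant para-Hermitian metric `g'`: they are
isometries of `g'`, so that `g` and `g'` have the same geodesics. -/
theorem isParaHermitianSymmetric_of_invariant (hJ : ∀ a : G, Preserves J g fun x ↦ a • x)
    {s : Diffeomorph (𝓡 (2 * n)) (𝓡 (2 * n)) N N ∞} (hso : IsSymmetryAt J g o s)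
    (hc : ∀ (a : G) (x : N), s (a • x) = σ a • s x)
    (h : ∀ v w, g'.form o (J.op o v) w + g'.form o v (J.op o w) = 0) :
    IsParaHermitianSymmetric J g' := by
  have hsm : ContMDiff 𝓘(ℝ, Eu (2 * n)) 𝓘(ℝ, Eu (2 * n)) ∞ s := s.contMDiff
  have hs' : g'.IsIsometry s :=
    isIsometry_of_reflection hs hg' hsm hso.apply_self hso.tderiv_eq hc
  have hg (a : G) : g.IsIsometry fun x ↦ a • x := (hJ a).isIsometry (hs.contMDiff_smul a)
  have hsg : g.IsIsometry s := hso.1.isIsometry hsm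
  have hr (x : N) : ∃ φ : N → N, g'.IsIsometry φ ∧ g.IsIsometry φ ∧ φ x = x ∧
      ∀ v, tderiv (Eu (2 * n)) (Eu (2 * n)) φ x v = -v := by
    obtain ⟨a, rfl, ha⟩ := exists_tderiv_smul hs (o := o) x
    have ho : a • s (a⁻¹ • a • o) = a • o := by rw [inv_smul_smul, hso.apply_self]
    refine ⟨fun x ↦ a • s (a⁻¹ • x), (hg' a).comp (hs'.comp (hg' a⁻¹)),
      (hg a).comp (hsg.comp (hg a⁻¹)), ho, fun v ↦ ?_⟩
    obtain ⟨v, rfl⟩ := ha v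
    have hφ := ((hg a).comp (hsg.comp (hg a⁻¹))).1
    have h1 := tderiv_comp_apply (g := fun x ↦ a • s (a⁻¹ • x)) (f := fun z : N ↦ a • z) o
      (hφ.mdiff _) ((hs.contMDiff_smul a).mdiff _) v
    have h2 := tderiv_comp_apply (g := fun z : N ↦ a • z) (f := s) o
      ((hs.contMDiff_smul a).mdiff _) (hsm.mdiff _) v
    simp only [inv_smul_smul] at h1
    rw [← h1, h2, hso.tderiv_eq, hso.apply_self, map_neg]
  refine ⟨isParaHermitian_of_invariant hs hg' hJ h, fun x ↦ ?_⟩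
  obtain ⟨a, rfl⟩ := MulAction.exists_smul_eq G o x
  have hp := (hJ a).comp (hso.1.comp (hJ a⁻¹) hsm (hs.contMDiff_smul a⁻¹))
    (hs.contMDiff_smul a) (hsg.comp (hg a⁻¹)).1
  refine ⟨(smulDiffeomorph hs a⁻¹).trans (s.trans (smulDiffeomorph hs a)),
    hp.of_isIsometry ((hg' a).comp (hs'.comp (hg' a⁻¹))), fun γ ε hε hγ h0 t ht ↦ ?_⟩
  have h1 := (hg a⁻¹).isGeodesicOn isOpen_Ioo (hγ.of_reflections hr)
  have h2 : s (a⁻¹ • γ t) = a⁻¹ • γ (-t) :=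
    hso.2 (fun t ↦ a⁻¹ • γ t) ε hε h1 (by rw [h0, inv_smul_smul]) t ht
  show a • s (a⁻¹ • γ t) = γ (-t)
  rw [h2, smul_inv_smul]

end

end Reflections

/-! ### Invariant extensions and the symmetric spaces they define -/

section Conclusion

attribute [local instance] isManifold_group finiteDimensional_groupLieAlgebra

variable {m n : ℕ} {G : Type*} [TopologicalSpace G] [ChartedSpace (EuclideanSpace ℝ (Fin m)) G]
  [Group G] [LieGroup (𝓡 m) ∞ G] [T2Space G]
  {N : Type*} [TopologicalSpace N] [ChartedSpace (EuclideanSpace ℝ (Fin (2 * n))) N]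
  [IsManifold (𝓡 (2 * n)) ∞ N] [T2Space N] [MulAction G N]
  {J : ParaComplex n N} {g g' : PseudoMetric (2 * n) N} {o : N} {σ : G →* G}

namespace IsSymmetricCosetSpace

variable (hN : IsSymmetricCosetSpace (m := m) J g o σ)
  (hsurj : Function.Surjective (orbitDeriv m G (2 * n) o))
  (hθ : ∀ X : Eu m, orbitDeriv m G (2 * n) o (tderiv (Eu m) (Eu m) σ 1 X) =
    -orbitDeriv m G (2 * n) o X)
include hN

lemma mem_minusSpace {X : GroupLieAlgebra (𝓡 m) G} :
    X ∈ minusSpace (m := m) σ ↔ (hN.model hsurj hθ).θ X = -X := by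
  rw [minusSpace, End.mem_eigenspace_iff, neg_one_smul]
  rfl

lemma mem_lieAlgebraOf {W : GroupLieAlgebra (𝓡 m) G} :
    W ∈ lieAlgebraOf (m := m) (MulAction.stabilizer G o) ↔ (hN.model hsurj hθ).p W = 0 :=
  mem_lieAlgebraOf_stabilizer hN.smoothAction

omit hN [T2Space G] [T2Space N] [LieGroup (𝓡 m) ∞ G] in
/-- In `IsInvariantExtension` the base point is `1 • o`. -/
lemma form_one_smul (X Y : Eu m) :
    g'.form ((1 : G) • o) (orbitDeriv m G (2 * n) o X) (orbitDeriv m G (2 * n) o Y) =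
      g'.form o (orbitDeriv m G (2 * n) o X) (orbitDeriv m G (2 * n) o Y) := by
  rw [one_smul]

variable [LieAlgebra.IsSimple ℝ (GroupLieAlgebra (𝓡 m) G)] [Nontrivial (Eu (2 * n))]

include hsurj hθ in
lemma isInvariantExtension {f : LinearMap.BilinForm ℝ (GroupLieAlgebra (𝓡 m) G)}
    (hg' : ∀ a : G, g'.IsIsometry fun x ↦ a • x)
    (hf : ∀ X Y : GroupLieAlgebra (𝓡 m) G, (hN.model hsurj hθ).θ X = -X →
      (hN.model hsurj hθ).θ Y = -Y →
      g'.form o ((hN.model hsurj hθ).p X) ((hN.model hsurj hθ).p Y) = f X Y) :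
    IsInvariantExtension (m := m) g' o σ f where
  bijOn := by
    refine ⟨fun _ _ ↦ trivial, fun X hX Y hY h ↦ ?_, fun v _ ↦ ?_⟩
    · exact (hN.model hsurj hθ).eq_of_p_eq ((hN.mem_minusSpace hsurj hθ).1 hX)
        ((hN.mem_minusSpace hsurj hθ).1 hY) h
    · exact ⟨(hN.model hsurj hθ).lift v, (hN.mem_minusSpace hsurj hθ).2
        ((hN.model hsurj hθ).θ_lift v), (hN.model hsurj hθ).p_lift v⟩
  val_eq X Y hX hY := (form_one_smul X Y).trans
    (hf X Y ((hN.mem_minusSpace hsurj hθ).1 hX) ((hN.mem_minusSpace hsurj hθ).1 hY))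
  invariant a x v w := (hg' a).2 x v w

lemma isIsometry_smul (a : G) : g.IsIsometry fun x ↦ a • x :=
  (hN.preserves a).isIsometry (hN.smoothAction.contMDiff_smul a)

variable {i : GroupLieAlgebra (𝓡 m) G →ₗ[ℝ] GroupLieAlgebra (𝓡 m) G} (hi : IsComplexStructure i)
  (hiθ : ∀ X, i ((hN.model hsurj hθ).θ X) = (hN.model hsurj hθ).θ (i X)) {a b : ℝ}
  (hab : (a, b) ≠ (0, 0))
include hi hiθ hab

lemma isAdmissible_twistedKilling :
    IsAdmissible (m := m) n (MulAction.stabilizer G o) σ (twistedKilling i a b) := by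
  set M := hN.model hsurj hθ
  have hS (X : GroupLieAlgebra (𝓡 m) G) : X ∈ minusSpace (m := m) σ ↔ M.θ X = -X :=
    hN.mem_minusSpace hsurj hθ
  have hsig := M.signature_twistedKilling hi hiθ a b hab hS (k := n) (by simp)
    (J.finrank_pos o)
  have hnd (X : minusSpace (m := m) σ)
      (h : ∀ Y, (twistedKilling i a b).restrict (minusSpace (m := m) σ) X Y = 0) : X = 0 :=
    Subtype.ext (M.eq_zero_of_twistedKilling hi hiθ a b hab ((hS _).1 X.2)
      fun Y hY ↦ h ⟨Y, (hS _).2 hY⟩)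
  have hsymm : ((twistedKilling i a b).restrict (minusSpace (m := m) σ)).IsSymm :=
    ⟨fun X Y ↦ twistedKilling_symm hi a b X Y⟩
  refine ⟨(M.finrank_minus hS).trans (by simp), hsymm, ⟨hnd, fun X h ↦ hnd X fun Y ↦ ?_⟩,
    fun W hW X hX ↦ ?_, fun W _ X Y _ _ ↦ twistedKilling_lie hi a b W X Y, hsig.1, hsig.2⟩
  · exact (twistedKilling_symm hi a b _ _).trans (h Y)
  · exact (hS _).2 (M.θ_lie_minus (M.p_eq_zero_iff.1 ((hN.mem_lieAlgebraOf hsurj hθ).1 hW))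
      ((hS _).1 hX))

/-- The metric determined by an invariant form on the `(-1)`-eigenspace. -/
lemma exists_metric_twistedKilling [MulAction.IsPretransitive G N] [SecondCountableTopology G]
    (hiΦ : ∀ Φ ∈ isotropyFamily m o, ∀ X, i (Φ X) = Φ (i X)) :
    ∃ g' : PseudoMetric (2 * n) N,
      IsInvariantExtension (m := m) g' o σ (twistedKilling i a b) ∧
      IsParaHermitianSymmetric J g' := by
  set M := hN.model hsurj hθ with hM
  obtain ⟨F, hF⟩ : ∃ F : Eu (2 * n) →L[ℝ] Eu (2 * n) →L[ℝ] ℝ,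
      ∀ v w, F v w = twistedKilling i a b (M.lift v) (M.lift w) :=
    ⟨LinearMap.toContinuousLinearMap ((LinearMap.toContinuousLinearMap :
        (Eu (2 * n) →ₗ[ℝ] ℝ) ≃ₗ[ℝ] Eu (2 * n) →L[ℝ] ℝ).toLinearMap ∘ₗ
          ((twistedKilling i a b).compl₁₂ M.lift M.lift)), fun _ _ ↦ rfl⟩
  have hsymm (v w) : F v w = F w v := by
    rw [hF, hF, twistedKilling_symm hi]
  have hnd (v) (h : ∀ w, F v w = 0) : v = 0 := by
    have h1 := M.eq_zero_of_twistedKilling hi hiθ a b hab (M.θ_lift v) fun Y hY ↦ by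
      have := h (M.p Y)
      rwa [hF, M.lift_p hY] at this
    rw [← M.p_lift v, h1, map_zero]
  have hinv (c : G) (hc : c ∈ MulAction.stabilizer G o) (v w : Eu (2 * n)) :
      F (tderiv (Eu (2 * n)) (Eu (2 * n)) (fun x : N ↦ c • x) o v)
        (tderiv (Eu (2 * n)) (Eu (2 * n)) (fun x : N ↦ c • x) o w) = F v w := by
    have e (v : Eu (2 * n)) : M.lift (tderiv (Eu (2 * n)) (Eu (2 * n)) (fun x : N ↦ c • x) o v) =
        AdEquiv c (M.lift v) := by
      have h1 : tderiv (Eu (2 * n)) (Eu (2 * n)) (fun x : N ↦ c • x) o v =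
          M.p (AdEquiv c (M.lift v)) := by
        refine Eq.trans ?_ (orbitDeriv_Ad hN.smoothAction hc (M.lift v)).symm
        exact congrArg _ (M.p_lift v).symm
      rw [h1, M.lift_p ((hN.isIsotropy_AdEquiv hsurj hθ hc).θ_minus (M.θ_lift v))]
    rw [hF, hF, e, e, twistedKilling_equiv a b (hiΦ _ ⟨c, hc, rfl⟩)]
  obtain ⟨g', h1, h2⟩ := exists_invariant_metric hN.smoothAction hinv hsymm hnd
  have hg' (c : G) : g'.IsIsometry fun x ↦ c • x := ⟨hN.smoothAction.contMDiff_smul c, h2 c⟩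
  refine ⟨g', hN.isInvariantExtension hsurj hθ hg' fun X Y hX hY ↦ ?_, ?_⟩
  · rw [h1, hF, M.lift_p hX, M.lift_p hY]
  · obtain ⟨s, hso, hc⟩ := hN.conj_symmetry
    refine isParaHermitianSymmetric_of_invariant hN.smoothAction hg' hN.preserves hso hc
      fun v w ↦ ?_
    have e (v : Eu (2 * n)) : M.lift (J.op o v) = M.structureMap (M.lift v) := by
      rw [InfinitesimalModel.structureMap, LinearMap.comp_apply, LinearMap.comp_apply, M.p_lift]
      rfl
    rw [h1, h1, hF, hF, e, e, M.twistedKilling_structureMap hi]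

end IsSymmetricCosetSpace

end Conclusion

end ParaHermitian

end

open ParaHermitian in
theorem mainTheorem6 {m n : ℕ}
    {G : Type*} [TopologicalSpace G] [ChartedSpace (EuclideanSpace ℝ (Fin m)) G] [Group G]
    [LieGroup (𝓡 m) ∞ G] [T2Space G] [SecondCountableTopology G] [ConnectedSpace G]
    {N : Type*} [TopologicalSpace N] [ChartedSpace (EuclideanSpace ℝ (Fin (2 * n))) N]
    [IsManifold (𝓡 (2 * n)) ∞ N] [T2Space N] [SecondCountableTopology N]
    [MulAction G N]
    (J : ParaComplex n N) (g : PseudoMetric (2 * n) N) (o : N) (σ : G →* G)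
    (hN : IsSymmetricCosetSpace (m := m) J g o σ)
    (hG : LieAlgebra.IsSimple ℝ (GroupLieAlgebra (𝓡 m) G)) :
    (lieDim (m := m) (centerOf (MulAction.stabilizer G o)) = 1 →
      ∃ a : ℝ, a ≠ 0 ∧
        IsInvariantExtension (m := m) g o σ (a • killingForm ℝ (GroupLieAlgebra (𝓡 m) G))) ∧
    (lieDim (m := m) (centerOf (MulAction.stabilizer G o)) = 2 →
      ∃ i : GroupLieAlgebra (𝓡 m) G →ₗ[ℝ] GroupLieAlgebra (𝓡 m) G,
        IsComplexStructure i ∧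
        (∃ a b : ℝ, (a, b) ≠ (0, 0) ∧
          IsInvariantExtension (m := m) g o σ (twistedKilling i a b)) ∧
        ∀ a b : ℝ, (a, b) ≠ (0, 0) →
          IsAdmissible (m := m) n (MulAction.stabilizer G o) σ (twistedKilling i a b) ∧
          ∃ g' : PseudoMetric (2 * n) N,
            IsInvariantExtension (m := m) g' o σ (twistedKilling i a b) ∧
            IsParaHermitianSymmetric J g') := by
  have := hN.transitive
  have hsurj := surjective_orbitDeriv (m := m) (d := 2 * n) hN.smoothAction o
  have hθ : ∀ X : Eu m, orbitDeriv m G (2 * n) o (tderiv (Eu m) (Eu m) σ 1 X) =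
      -orbitDeriv m G (2 * n) o X := by
    obtain ⟨s, hso, hc⟩ := hN.conj_symmetry
    exact orbitDeriv_involution hN.smoothAction hN.smooth_involution s.contMDiff hso.apply_self
      hso.tderiv_eq hc
  have hdim := hN.lieDim_center_eq hsurj hθ
  have hiso : ∀ Φ ∈ IsSymmetricCosetSpace.isotropyFamily m o, (hN.model hsurj hθ).IsIsotropy Φ := by
    rintro _ ⟨a, ha, rfl⟩
    exact hN.isIsotropy_AdEquiv hsurj hθ ha
  have := finiteDimensional_groupLieAlgebra m G
  refine ⟨fun h ↦ ?_, fun h ↦ ?_⟩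
  · have := hN.nontrivial_of_lieDim_center_ne_zero hsurj hθ (by rw [h]; norm_num)
    obtain ⟨a, ha, hf⟩ := (hN.model hsurj hθ).exists_killing_of_finrank_eq_one hiso
      (hdim.symm.trans h)
    exact ⟨a, ha, hN.isInvariantExtension hsurj hθ hN.isIsometry_smul hf⟩
  · have := hN.nontrivial_of_lieDim_center_ne_zero hsurj hθ (by rw [h]; norm_num)
    obtain ⟨i, hi, hiθ, hiΦ, a, b, hab, hf⟩ :=
      (hN.model hsurj hθ).exists_twistedKilling_of_finrank_eq_two hiso (hdim.symm.trans h)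
        fun W hW V hV ↦ hN.lie_eq_zero_of_mem_fixedSpace hsurj hθ hW hV
    refine ⟨i, hi, ⟨a, b, hab, hN.isInvariantExtension hsurj hθ hN.isIsometry_smul hf⟩,
      fun a b hab ↦ ⟨hN.isAdmissible_twistedKilling hsurj hθ hi hiθ hab,
        hN.exists_metric_twistedKilling hsurj hθ hi hiθ hab hiΦ⟩⟩
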